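/- Let $\mathcal{H}=\mathbb{C}\times\mathbb{R}$ be the Heisenberg group with the group law $(z,u)\cdot(z',u')=(z+z',u+u'-\tfrac12\operatorname{Im}(z\bar z'))$, the contact form $\theta=du+\tfrac12(y\,dx-x\,dy)$, where $z=x+iy$, the Korányi norm $\|(z,u)\|_{\mathcal H}=(|z|^4+16u^2)^{1/4}$ and the Korányi distance $d_{\mathcal H}(p,q)=\|p^{-1}q\|_{\mathcal H}$. Identify $\mathcal H\cup\{\infty\}$ with the set of null lines in $\mathbb{C}P^2$ of the Hermitian form with matrix $\begin{pmatrix}0&0&-i/2\\0&1&0\\i/2&0&0\end{pmatrix}$ by $(z,u)\mapsto[1:z:-4u+i|z|^2]$, $\infty\mapsto[0:0:1]$; this is the sphere $S^3$ with its standard contact structure, which restricts to $\ker\theta$ on $\mathcal H$. Let $\mathrm{PU}(2,1)$ be the group of transformations of $\mathcal H\cup\{\infty\}$ (Möbius transformations) induced by the matrices that preserve the form. One of them is the inversion $\iota(z,u)=\left(\frac{z}{|z|^2+4iu},-\frac{u}{|z|^4+16u^2}\right)$, which exchanges $0$ and $\infty$. A Legendrian knot $K$ in $\mathcal H\cup\{\infty\}$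 is a smooth closed regular curve without self-intersections that is everywhere tangent to the contact structure. It is called finite if $\infty\notin K$ and open otherwise. Let $dp$ be the arc-length measure on $K\setminus\{\infty\}$, with respect to the norm of horizontal vectors $a\left(\partial_x-\tfrac y2\partial_u\right)+b\left(\partial_y+\tfrac x2\partial_u\right)\mapsto\sqrt{a^2+b^2}$. For $p\in K\setminus\{\infty\}$ put $$V(K;p)=\lim_{\varepsilon\to+0}\left(\int_{\{q\in K\setminus\{\infty\}\,:\,d_{\mathcal H}(p,q)\ge\varepsilon\}}\frac{dq}{d_{\mathcal H}(p,q)^2}-\frac2\varepsilon\right).$$ If $K$ is finite, let $B_K(\zeta)=\iint_{K\times K}d_{\mathcal H}(p,q)^\zeta\,dp\,dq$ for $\operatorname{Re}\zeta>-1$, continued meromorphically to $\mathbb{C}$, and put $E(K)=B_K(-2)$. If $K$ is open, put $E(K)=\int_K V(K;p)\,dp$. Then the following hold. 1. For every Legendrian knot $K$ the integrals and the limit that define $V(K;p)$ converge for every $p\in K\setminus\{\infty\}$, the function $V(K;\cdot)$ is integrable over $K\setminus\{\infty\}$, and $E(K)=\int_K V(K;p)\,dp$. If $K$ is finite, the integral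 that defines $B_K(\zeta)$ converges for $\operatorname{Re}\zeta>-1$, $B_K$ has a meromorphic continuation to $\mathbb{C}$ that is regular at $-2$, and $B_K(-2)$ is the real number $E(K)$. 2. If $K$ and $\tilde K=\iota(K)$ are Legendrian knots, then $V(\tilde K;\iota(p))=\|p\|_{\mathcal H}^2\,V(K;p)$ for every $p\in K\setminus\{0,\infty\}$. 3. For every Legendrian knot $K$ in $\mathcal H\cup\{\infty\}$ and every $T\in\mathrm{PU}(2,1)$, the set $T(K)$ is a Legendrian knot and $E(T(K))=E(K)$. In particular, $B_{T(K)}(-2)=B_K(-2)$ if both $K$ and $T(K)$ lie in $\mathcal H$. -/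

import Mathlib

open MeasureTheory Filter Topology

noncomputable section

/-- The Heisenberg group `ℋ = ℂ × ℝ`, with points `(z, u)`, `z = x + i y`. -/
abbrev Heis : Type := ℂ × ℝ

namespace Heis

/-- The group law `(z,u)·(z',u') = (z + z', u + u' - ½ Im (z conj z'))`. -/
def gmul (p q : Heis) : Heis :=
  (p.1 + q.1, p.2 + q.2 - (1 / 2) * (p.1 * (starRingEnd ℂ) q.1).im)

/-- The inverse for the group law `gmul`. -/
def ginv (p : Heis) : Heis := (-p.1, -p.2)

/-- The Korányi norm `((x² + y²)² + 16 u²)^{1/4}`. -/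
def knorm (p : Heis) : ℝ := ((p.1.re ^ 2 + p.1.im ^ 2) ^ 2 + 16 * p.2 ^ 2) ^ (1 / 4 : ℝ)

/-- The Korányi distance `d(p,q) = ‖p⁻¹ q‖`. -/
def kdist (p q : Heis) : ℝ := knorm (gmul (ginv p) q)

/-- The contact form `θ = du + ½ (y dx - x dy)` at the point `p`, applied to the vector `v`. -/
def contactForm (p v : Heis) : ℝ := v.2 + (1 / 2) * (p.1.im * v.1.re - p.1.re * v.1.im)

/-- The length of a horizontal vector `v = a X + b Y`: its `ℂ`-component is `a + i b`, so that
this is the norm for which `X, Y` are orthonormal. -/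
def hnorm (v : Heis) : ℝ := ‖v.1‖

/-- The coordinates of a finite point of `ℋ ∪ {∞}` (the value at `∞` is irrelevant). -/
def coord : OnePoint Heis → Heis
  | none => 0
  | some p => p

open Classical in
/-- The Heisenberg inversion of `ℋ ∪ {∞}`:
`(z,u) ↦ (z / (|z|² + 4 i u), - u / (|z|⁴ + 16 u²))`, exchanging `0` and `∞`. -/
def inversion : OnePoint Heis → OnePoint Heis
  | none => ((0 : Heis) : OnePoint Heis)
  | some p =>
    if p = 0 then OnePoint.infty
    else (((p.1 / ((‖p.1‖ : ℂ) ^ 2 + 4 * Complex.I * (p.2 : ℂ)),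
      -p.2 / (‖p.1‖ ^ 4 + 16 * p.2 ^ 2)) : Heis) : OnePoint Heis)

/-- The Hermitian form whose null lines in `ℂ³` are the points of `∂D ∪ {∞}`, for the Siegel
domain `D = {(z,w) : Im w > |z|²}` and the affine chart `(z,w) ↦ [1 : z : w]`. -/
def formD : Matrix (Fin 3) (Fin 3) ℂ :=
  !![0, 0, -Complex.I / 2; 0, 1, 0; Complex.I / 2, 0, 0]

/-- Homogeneous coordinates on `ℋ ∪ {∞} = ∂D ∪ {∞}`:
`(z,u) ↦ [1 : z : -4u + i|z|²]` and `∞ ↦ [0 : 0 : 1]`. -/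
def homog : OnePoint Heis → (Fin 3 → ℂ)
  | none => ![0, 0, 1]
  | some p => ![1, p.1, -4 * (p.2 : ℂ) + Complex.I * (‖p.1‖ : ℂ) ^ 2]

/-- The matrix `A` preserves the Hermitian form `formD`. -/
def PreservesForm (A : Matrix (Fin 3) (Fin 3) ℂ) : Prop :=
  A.transpose * formD * A.map (starRingEnd ℂ) = formD

/-- The permutation `T` of `ℋ ∪ {∞}` is the projective action of the matrix `A`. -/
def IsInducedBy (T : Equiv.Perm (OnePoint Heis)) (A : Matrix (Fin 3) (Fin 3) ℂ) : Prop :=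
  ∀ p, ∃ c : ℂ, c ≠ 0 ∧ A.mulVec (homog p) = c • homog (T p)

/-- `PU(2,1)`, the group of Möbius transformations of `ℋ ∪ {∞}`: the projective actions of the
invertible matrices that preserve the Hermitian form. -/
def PU21 : Subgroup (Equiv.Perm (OnePoint Heis)) where
  carrier := {T | ∃ A : GL (Fin 3) ℂ, PreservesForm A.val ∧ IsInducedBy T A.val}
  one_mem' := by
    refine ⟨1, ?_, fun p => ⟨1, one_ne_zero, ?_⟩⟩
    · simp [PreservesForm]
    · simp
  mul_mem' := by
    rintro S T ⟨A, hA, hS⟩ ⟨B, hB, hT⟩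
    refine ⟨A * B, ?_, fun p => ?_⟩
    · unfold PreservesForm at *
      calc (A * B).val.transpose * formD * (A * B).val.map (starRingEnd ℂ)
          = B.val.transpose * (A.val.transpose * formD * A.val.map (starRingEnd ℂ))
              * B.val.map (starRingEnd ℂ) := by
            simp [Matrix.transpose_mul, Matrix.map_mul, Matrix.mul_assoc]
        _ = formD := by rw [hA, hB]
    · obtain ⟨b, hb, hbp⟩ := hT p
      obtain ⟨a, ha, hap⟩ := hS (T p)
      refine ⟨b * a, mul_ne_zero hb ha, ?_⟩
      rw [Units.val_mul, ← Matrix.mulVec_mulVec, hbp, Matrix.mulVec_smul, hap, smul_smul]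
      rfl
  inv_mem' := by
    rintro T ⟨A, hA, hT⟩
    have hAi : A.val * (A⁻¹).val = 1 := by rw [← Units.val_mul]; simp
    have hiA : (A⁻¹).val * A.val = 1 := by rw [← Units.val_mul]; simp
    refine ⟨A⁻¹, ?_, fun p => ?_⟩
    · unfold PreservesForm at *
      have h1 : (A⁻¹).val.transpose * A.val.transpose = 1 := by
        rw [← Matrix.transpose_mul, hAi, Matrix.transpose_one]
      have h2 : A.val.map (starRingEnd ℂ) * (A⁻¹).val.map (starRingEnd ℂ) = 1 := by
        rw [← Matrix.map_mul, hAi]; simp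
      calc (A⁻¹).val.transpose * formD * (A⁻¹).val.map (starRingEnd ℂ)
          = (A⁻¹).val.transpose * (A.val.transpose * formD * A.val.map (starRingEnd ℂ))
              * (A⁻¹).val.map (starRingEnd ℂ) := by rw [hA]
        _ = ((A⁻¹).val.transpose * A.val.transpose) * formD
              * (A.val.map (starRingEnd ℂ) * (A⁻¹).val.map (starRingEnd ℂ)) := by
            simp only [Matrix.mul_assoc]
        _ = formD := by rw [h1, h2]; simp
    · obtain ⟨c, hc, h⟩ := hT (T⁻¹ p)
      refine ⟨c⁻¹, inv_ne_zero hc, ?_⟩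
      have h' : A.val.mulVec (homog (T⁻¹ p)) = c • homog p := by
        rw [h]; simp
      calc (A⁻¹).val.mulVec (homog p)
          = (A⁻¹).val.mulVec (c⁻¹ • c • homog p) := by rw [inv_smul_smul₀ hc]
        _ = c⁻¹ • (A⁻¹).val.mulVec (A.val.mulVec (homog (T⁻¹ p))) := by
            rw [Matrix.mulVec_smul, h']
        _ = c⁻¹ • homog (T⁻¹ p) := by rw [Matrix.mulVec_mulVec, hiA, Matrix.one_mulVec]

/-- A path in `ℋ` (in coordinates) is, at the time `t`, smooth, regular and Legendrian. -/
structure IsRegularLegendrianAt (γ : ℝ → Heis) (t : ℝ) : Prop where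
  smooth : ContDiffAt ℝ ((⊤ : ℕ∞) : WithTop ℕ∞) γ t
  regular : deriv γ t ≠ 0
  legendrian : contactForm (γ t) (deriv γ t) = 0

/-- A Legendrian knot in `ℋ ∪ {∞}`, presented by a regular smooth periodic parametrization without
self-intersections. The smooth contact structure of `ℋ ∪ {∞} ≅ S³` is read in the standard
coordinates away from `∞`, and through the inversion (an automorphism of `S³`) at `∞`. -/
structure LegendrianKnot where
  toFun : ℝ → OnePoint Heis
  period : ℝ
  period_pos : 0 < period
  continuous : Continuous toFun
  periodic : Function.Periodic toFun period
  injOn : Set.InjOn toFun (Set.Ico 0 period)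
  regular_finite : ∀ t, toFun t ≠ OnePoint.infty →
    IsRegularLegendrianAt (fun s => coord (toFun s)) t
  regular_infty : ∀ t, toFun t = OnePoint.infty →
    IsRegularLegendrianAt (fun s => coord (inversion (toFun s))) t

namespace LegendrianKnot

/-- The knot as a subset of `ℋ ∪ {∞}`. -/
def carrier (K : LegendrianKnot) : Set (OnePoint Heis) := Set.range K.toFun

/-- A knot is finite (closed) if it does not pass through `∞`, and open otherwise. -/
def IsFinite (K : LegendrianKnot) : Prop := OnePoint.infty ∉ K.carrier

/-- The arc-length measure `dp` on `K \ {∞}`, as a measure on `ℋ`: the image of `|γ'(t)| dt` on one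
period. -/
def arcLength (K : LegendrianKnot) : Measure Heis :=
  ((volume.restrict (Set.Ico 0 K.period ∩ {t | K.toFun t ≠ OnePoint.infty})).withDensity
    (fun t => ENNReal.ofReal (hnorm (deriv (fun s => coord (K.toFun s)) t)))).map
      (fun t => coord (K.toFun t))

/-- `B` is the beta function of the (finite) knot `K`: the meromorphic continuation to `ℂ`, with a
regular value at `-2`, of `ζ ↦ ∬ d(p,q)^ζ dp dq`, an integral that converges for `Re ζ > -1`. -/
structure IsBetaFunction (K : LegendrianKnot) (B : ℂ → ℂ) : Prop where
  meromorphic : ∀ ζ, MeromorphicAt B ζ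
  regular : AnalyticAt ℂ B (-2)
  converges : ∀ ζ : ℂ, -1 < ζ.re →
    Integrable (fun x : Heis × Heis => (kdist x.1 x.2 : ℂ) ^ ζ) (K.arcLength.prod K.arcLength)
  eq_integral : ∀ ζ : ℂ, -1 < ζ.re →
    B ζ = ∫ x : Heis × Heis, (kdist x.1 x.2 : ℂ) ^ ζ ∂(K.arcLength.prod K.arcLength)

/-- The beta function `B_K` of a finite knot (its value at `-2` is determined by
`IsBetaFunction`). -/
def beta (K : LegendrianKnot) : ℂ → ℂ := Classical.epsilon K.IsBetaFunction

/-- `∫_{K \ B(p;ε)} dq / d(p,q)² - 2 / ε`. -/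
def truncatedPotential (K : LegendrianKnot) (p : Heis) (ε : ℝ) : ℝ :=
  (∫ q in {q | ε ≤ kdist p q}, (kdist p q ^ 2)⁻¹ ∂K.arcLength) - 2 / ε

/-- The potential `V(K;p)`, the limit of `truncatedPotential` as `ε → +0`. -/
def potential (K : LegendrianKnot) (p : Heis) : ℝ :=
  limUnder (𝓝[>] (0 : ℝ)) (K.truncatedPotential p)

open Classical in
/-- The energy: `E(K) = B_K(-2)` for a finite knot, and `E(K) = ∫_K V(K;p) dp` for an open one. -/
def energy (K : LegendrianKnot) : ℝ :=
  if K.IsFinite then (K.beta (-2)).re else ∫ p, K.potential p ∂K.arcLength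

end LegendrianKnot

end Heis

end

/-!
Everything rests on two facts about the Korányi distance.

*Conformal behaviour.* In homogeneous coordinates, `d(p,q)²` is twice the modulus of the Hermitian
form (`kdist_sq_eq_herm`), and the contact form and the length of horizontal vectors are values of
the Hermitian form on derivatives of these coordinates (`herm_dhomog_homog`, `herm_dhomog_self`).
Hence a Möbius transformation `T` with `A · homog p = λ(p) homog (T p)` preserves the contact
structure, divides horizontal lengths at `p` by `|λ(p)|`, and divides `d(p,q)²` by `|λ(p)| |λ(q)|`.
In particular `dp dq / d(p,q)²` is invariant. A knot has dimension one, so that it misses some point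
of `ℋ`; moving this point to `∞` shows that every knot is `T(c)`, where `c` is a closed Legendrian
curve in `ℋ` in arc-length parameter (`LegendrianKnot.exists_isMobiusImage`), and integrals over
`T(c)` can be computed in the parameter of `c`, the arc-length measure being independent of the
parametrization (`IsMobiusImage.integral_arcLength`).

*Expansion near the diagonal.* For a Legendrian curve the vertical displacement from `c(s)` to
`c(s + t)` is `O(t²)`, and then `O(t³)` because it is odd under exchange of the end points. As `d` is
symmetric, it follows that `d(c(s), c(s+t))^ζ = |t|^ζ (1 + t² P)` with `P` smooth in `(s, t)` and entire in `ζ` (`UnitSpeedLoop.exists_kdist_cpow`).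

For the potential of `K = T(c)` at `T(c(s))`, the cut-off `d ≥ ε` becomes `d(c(s), ·) ≥ ε r` with a
variable radius `r`. By `integral_cutoff`, a side of the point contributes to the limit the integral
of `P`, a constant, and a one-sided derivative of `r`; the latter cancels between the two sides.
Therefore `V(K; T(c(s))) = |λ(c(s))| W(s)`, where `W` is a continuous function that depends on `c`
only (`IsMobiusImage.tendsto_truncatedPotential`). This gives the convergence of the potential and,
as `|λ| = ‖p‖²` for the inversion, its behaviour under the inversion. Since `dp = ds / |λ|`, it gives
`∫ V(K;p) dp = ∫ W(s) ds`, which does not depend on `T`.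

For a finite knot the expansion reduces the beta function to an elementary term with a pole at `-1`
and an integral `∫ t^(ζ+2) g(ζ, t) dt` with `g` smooth in `t` and entire in `ζ`. Taylor expansion of
`g` in `t` continues the integral meromorphically (`IsAmplitude.exists_meromorphic`), and it converges
at `ζ = -2`, where the sum of both terms is `∫ W(s) ds`
(`UnitSpeedLoop.exists_meromorphic_continuation`). So `E(K) = ∫ V(K;p) dp = ∫ W(s) ds` for all knots.
-/

namespace Heis

/-! ### Smooth dependence on a parameter -/

section Analysis

variable {H E : Type} [NormedAddCommGroup H] [NormedSpace ℝ H] [ProperSpace H]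
  [NormedAddCommGroup E] [NormedSpace ℝ E]

theorem hasFDerivAt_intervalIntegral_param {k : H × ℝ → E} (hk : ContDiff ℝ 1 k) (a b : ℝ)
    (x₀ : H) :
    HasFDerivAt (fun x => ∫ t in a..b, k (x, t))
      (∫ t in a..b, (fderiv ℝ k (x₀, t)).comp (ContinuousLinearMap.inl ℝ H ℝ)) x₀ := by
  have hcont : Continuous fun y : H × ℝ =>
      (fderiv ℝ k y).comp (ContinuousLinearMap.inl ℝ H ℝ) :=
    (hk.continuous_fderiv one_ne_zero).clm_comp continuous_const
  obtain ⟨C, hC⟩ := ((isCompact_closedBall x₀ 1).prod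
    (isCompact_uIcc (a := a) (b := b))).exists_bound_of_continuousOn hcont.continuousOn
  refine intervalIntegral.hasFDerivAt_integral_of_dominated_of_fderiv_le
    (s := Metric.closedBall x₀ 1) (bound := fun _ => C)
    (F' := fun x t => (fderiv ℝ k (x, t)).comp (ContinuousLinearMap.inl ℝ H ℝ))
    (Metric.closedBall_mem_nhds x₀ one_pos) ?_ ?_ ?_ ?_ ?_ ?_
  · exact .of_forall fun x =>
      (hk.continuous.comp (by fun_prop : Continuous fun t : ℝ => (x, t))).aestronglyMeasurable
  · exact (hk.continuous.comp
      (by fun_prop : Continuous fun t : ℝ => (x₀, t))).intervalIntegrable _ _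
  · exact (hcont.comp (by fun_prop : Continuous fun t : ℝ => (x₀, t))).aestronglyMeasurable
  · exact .of_forall fun t ht x hx => hC (x, t) ⟨hx, Set.uIoc_subset_uIcc ht⟩
  · exact intervalIntegrable_const
  · refine .of_forall fun t _ x _ => ?_
    have h1 : HasFDerivAt k (fderiv ℝ k (x, t)) (x, t) :=
      ((hk.differentiable one_ne_zero) _).hasFDerivAt
    exact h1.comp x (hasFDerivAt_prodMk_left x t)

theorem contDiff_nat_intervalIntegral_param (n : ℕ) {k : H × ℝ → E}
    (hk : ContDiff ℝ n k) (a b : ℝ) :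
    ContDiff ℝ n (fun x => ∫ t in a..b, k (x, t)) := by
  induction n generalizing E with
  | zero =>
    rw [Nat.cast_zero, contDiff_zero] at hk ⊢
    exact intervalIntegral.continuous_parametric_intervalIntegral_of_continuous'
      (f := fun x t => k (x, t)) hk a b
  | succ n ih =>
    have h1 : ContDiff ℝ 1 k := hk.of_le (by exact_mod_cast Nat.le_add_left 1 n)
    push_cast at hk ⊢
    rw [contDiff_succ_iff_fderiv] at hk ⊢
    refine ⟨fun x => (hasFDerivAt_intervalIntegral_param h1 a b x).differentiableAt,
      by simp, ?_⟩
    rw [funext fun x => (hasFDerivAt_intervalIntegral_param h1 a b x).fderiv]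
    exact ih (k := fun y => (fderiv ℝ k y).comp (ContinuousLinearMap.inl ℝ H ℝ))
      (hk.2.2.clm_comp contDiff_const)

theorem contDiff_intervalIntegral_param {k : H × ℝ → E}
    (hk : ContDiff ℝ ((⊤ : ℕ∞) : WithTop ℕ∞) k) (a b : ℝ) :
    ContDiff ℝ ((⊤ : ℕ∞) : WithTop ℕ∞) (fun x => ∫ t in a..b, k (x, t)) := by
  rw [contDiff_infty] at hk ⊢
  exact fun n => contDiff_nat_intervalIntegral_param n (hk n) a b

/-- Hadamard's lemma with parameters: the difference quotient in the last variable of a smooth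
function is smooth, also where the denominator vanishes. -/
theorem exists_contDiff_sub_eq_smul [CompleteSpace E] {f : H × ℝ → E}
    (hf : ContDiff ℝ ((⊤ : ℕ∞) : WithTop ℕ∞) f) :
    ∃ g : H × ℝ → E, ContDiff ℝ ((⊤ : ℕ∞) : WithTop ℕ∞) g ∧
      (∀ x t, f (x, t) - f (x, 0) = t • g (x, t)) ∧
      ∀ x, HasDerivAt (fun t => f (x, t)) (g (x, 0)) 0 := by
  have hd : ContDiff ℝ ((⊤ : ℕ∞) : WithTop ℕ∞) fun y : H × ℝ => fderiv ℝ f y (0, 1) := by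
    rw [contDiff_infty_iff_fderiv] at hf
    exact hf.2.clm_apply contDiff_const
  have hder : ∀ x t, HasDerivAt (fun t => f (x, t)) (fderiv ℝ f (x, t) (0, 1)) t := by
    intro x t
    have h1 : HasFDerivAt f (fderiv ℝ f (x, t)) (x, t) :=
      ((hf.differentiable (by simp)) _).hasFDerivAt
    exact h1.comp_hasDerivAt t ((hasDerivAt_const t x).prodMk (hasDerivAt_id t))
  -- the quotient is the mean of the derivative over the segment from `0` to `t`
  refine ⟨fun y => ∫ θ in (0 : ℝ)..1, fderiv ℝ f (y.1, θ * y.2) (0, 1), ?_, ?_, ?_⟩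
  · exact contDiff_intervalIntegral_param (H := H × ℝ)
      (k := fun y => fderiv ℝ f (y.1.1, y.2 * y.1.2) (0, 1))
      (hd.comp (g := fun y : H × ℝ => fderiv ℝ f y (0, 1))
        (f := fun y : (H × ℝ) × ℝ => (y.1.1, y.2 * y.1.2)) (by fun_prop)) 0 1
  · intro x t
    have h1 : ∀ θ ∈ Set.uIcc (0 : ℝ) 1, HasDerivAt (fun θ => f (x, θ * t))
        (t • fderiv ℝ f (x, θ * t) (0, 1)) θ := by
      intro θ _
      exact (hder x (θ * t)).scomp θ (by simpa using (hasDerivAt_id θ).mul_const t)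
    have h2 := intervalIntegral.integral_eq_sub_of_hasDerivAt h1 (Continuous.intervalIntegrable
      ((hd.continuous.comp (by fun_prop : Continuous fun θ : ℝ => (x, θ * t))).const_smul t) _ _)
    rw [intervalIntegral.integral_smul] at h2
    simpa using h2.symm
  · intro x
    simpa using hder x 0

end Analysis

/-! ### Holomorphic and meromorphic dependence on a parameter -/

/-- An integral of holomorphic functions that are dominated, locally uniformly in the parameter, by
an integrable function is holomorphic: Cauchy's estimate dominates the derivatives. -/
theorem differentiableAt_integral_of_dominated {α : Type*} [MeasurableSpace α] {μ : Measure α}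
    {f : ℂ → α → ℂ} {ζ₀ : ℂ} {r : ℝ} (hr : 0 < r) {b : α → ℝ}
    (hm : ∀ ζ ∈ Metric.ball ζ₀ r, AEStronglyMeasurable (f ζ) μ)
    (hd : ∀ᵐ a ∂μ, ∀ ζ ∈ Metric.ball ζ₀ r, DifferentiableAt ℂ (fun ζ => f ζ a) ζ)
    (hb : ∀ᵐ a ∂μ, ∀ ζ ∈ Metric.ball ζ₀ r, ‖f ζ a‖ ≤ b a) (hbi : Integrable b μ) :
    DifferentiableAt ℂ (fun ζ => ∫ a, f ζ a ∂μ) ζ₀ := by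
  have h0 : ζ₀ ∈ Metric.ball ζ₀ r := Metric.mem_ball_self hr
  have hsub : ∀ ζ ∈ Metric.ball ζ₀ (r / 2), Metric.closedBall ζ (r / 4) ⊆ Metric.ball ζ₀ r := by
    intro ζ hζ
    refine Metric.closedBall_subset_ball' ?_
    have := Metric.mem_ball.1 hζ
    linarith
  refine (hasDerivAt_integral_of_dominated_loc_of_deriv_le (𝕜 := ℂ)
    (F' := fun ζ a => deriv (fun ζ => f ζ a) ζ) (bound := fun a => b a / (r / 4))
    (Metric.ball_mem_nhds ζ₀ (half_pos hr)) ?_ ?_ ?_ ?_ (hbi.div_const _) ?_).2.differentiableAt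
  · filter_upwards [Metric.ball_mem_nhds ζ₀ hr] with ζ hζ using hm ζ hζ
  · exact hbi.mono' (hm _ h0) (hb.mono fun a ha => ha _ h0)
  · -- the derivative is an a.e. limit of difference quotients
    have hseq : Tendsto (fun n : ℕ => ζ₀ + ((r / (n + 2) : ℝ) : ℂ)) atTop (𝓝[≠] ζ₀) := by
      refine tendsto_nhdsWithin_iff.2 ⟨?_, .of_forall fun n => ?_⟩
      · have h1 : Tendsto (fun n : ℕ => r / ((n : ℝ) + 2)) atTop (𝓝 0) :=
          tendsto_const_nhds.div_atTop
            (tendsto_atTop_add_const_right _ _ tendsto_natCast_atTop_atTop)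
        have h2 := (Complex.continuous_ofReal.tendsto 0).comp h1
        simpa using h2.const_add ζ₀
      · have : ((r / ((n : ℝ) + 2) : ℝ) : ℂ) ≠ 0 := by
          rw [Complex.ofReal_ne_zero]
          positivity
        rwa [Set.mem_compl_singleton_iff, Ne, add_eq_left]
    refine aestronglyMeasurable_of_tendsto_ae atTop
      (f := fun (n : ℕ) a => slope (fun ζ => f ζ a) ζ₀ (ζ₀ + ((r / (n + 2) : ℝ) : ℂ))) ?_ ?_
    · intro n
      have hn : ζ₀ + ((r / (n + 2) : ℝ) : ℂ) ∈ Metric.ball ζ₀ r := by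
        rw [Metric.mem_ball, dist_self_add_left, Complex.norm_real, Real.norm_eq_abs,
          abs_of_pos (by positivity)]
        rw [div_lt_iff₀ (by positivity)]
        nlinarith [(Nat.cast_nonneg n : (0 : ℝ) ≤ n)]
      simp only [slope_def_module]
      exact ((hm _ hn).sub (hm _ h0)).const_smul (ζ₀ + ((r / (n + 2) : ℝ) : ℂ) - ζ₀)⁻¹
    · filter_upwards [hd] with a ha
      exact ((ha _ h0).hasDerivAt.tendsto_slope).comp hseq
  · filter_upwards [hd, hb] with a hda hba ζ hζ
    refine Complex.norm_deriv_le_of_forall_mem_sphere_norm_le (by positivity) ?_ ?_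
    · refine DifferentiableOn.diffContOnCl fun w hw => ?_
      rw [closure_ball _ (by positivity)] at hw
      exact (hda w (hsub ζ hζ hw)).differentiableWithinAt
    · exact fun w hw => hba w (hsub ζ hζ (Metric.sphere_subset_closedBall hw))
  · filter_upwards [hd] with a ha ζ hζ
    exact (ha ζ (Metric.ball_subset_ball (by linarith) hζ)).hasDerivAt

/-- Two meromorphic functions on a right half-plane that agree on `Re ζ > -1` agree near every point
of the half-plane, except perhaps at the point. -/
theorem eventuallyEq_of_eq_on_halfPlane {f g : ℂ → ℂ} {a : ℝ} (ha : a ≤ -1)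
    (hf : ∀ ζ : ℂ, a < ζ.re → MeromorphicAt f ζ) (hg : ∀ ζ : ℂ, a < ζ.re → MeromorphicAt g ζ)
    (h : ∀ ζ : ℂ, -1 < ζ.re → f ζ = g ζ) {ζ : ℂ} (hζ : a < ζ.re) : f =ᶠ[𝓝[≠] ζ] g := by
  have hd : MeromorphicOn (f - g) {ζ : ℂ | a < ζ.re} := fun z hz => (hf z hz).sub (hg z hz)
  have hpre : IsPreconnected {ζ : ℂ | a < ζ.re} := (convex_halfSpace_re_gt a).isPreconnected
  have h0 : meromorphicOrderAt (f - g) 0 = ⊤ := by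
    rw [meromorphicOrderAt_eq_top_iff]
    have : ∀ᶠ z : ℂ in 𝓝 0, -1 < z.re :=
      Complex.continuous_re.continuousAt.eventually (lt_mem_nhds (by simp))
    filter_upwards [nhdsWithin_le_nhds this] with z hz
    simp [h z hz]
  have h1 : meromorphicOrderAt (f - g) ζ = ⊤ := by
    by_contra hne
    exact hd.meromorphicOrderAt_ne_top_of_isPreconnected (y := 0) hpre hζ
      (show a < (0 : ℂ).re by simp; linarith) hne h0
  rw [meromorphicOrderAt_eq_top_iff] at h1
  filter_upwards [h1] with z hz
  simpa [sub_eq_zero] using hz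

theorem eq_of_eventuallyEq_punctured {f g : ℂ → ℂ} {ζ : ℂ} (hf : ContinuousAt f ζ)
    (hg : ContinuousAt g ζ) (h : f =ᶠ[𝓝[≠] ζ] g) : f ζ = g ζ :=
  tendsto_nhds_unique ((hf.tendsto.mono_left nhdsWithin_le_nhds).congr' h)
    (hg.tendsto.mono_left nhdsWithin_le_nhds)

/-- An amplitude `g(ζ, t)`: jointly smooth in the real sense, and entire in `ζ`. -/
structure IsAmplitude (g : ℂ × ℝ → ℂ) : Prop where
  smooth : ContDiff ℝ ((⊤ : ℕ∞) : WithTop ℕ∞) g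
  entire : ∀ t, Differentiable ℂ fun ζ => g (ζ, t)

/-- The difference quotient in `t` of an amplitude is an amplitude. At `t = 0` the Cauchy-Riemann
equations hold by continuity. -/
theorem IsAmplitude.exists_quotient {g : ℂ × ℝ → ℂ} (hg : IsAmplitude g) :
    ∃ g₁, IsAmplitude g₁ ∧ ∀ ζ t, g (ζ, t) = g (ζ, 0) + t * g₁ (ζ, t) := by
  obtain ⟨g₁, hs, he, -⟩ := exists_contDiff_sub_eq_smul hg.smooth
  have he' : ∀ ζ t, g (ζ, t) = g (ζ, 0) + t * g₁ (ζ, t) := fun ζ t => by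
    have := he ζ t
    rw [Complex.real_smul] at this
    rw [← this]; ring
  refine ⟨g₁, ⟨hs, fun t ζ => ?_⟩, he'⟩
  have hreal : ∀ t, HasFDerivAt (fun ζ => g₁ (ζ, t))
      ((fderiv ℝ g₁ (ζ, t)).comp (ContinuousLinearMap.inl ℝ ℂ ℝ)) ζ := fun t =>
    HasFDerivAt.comp ζ (((hs.differentiable (by simp)) _).hasFDerivAt) (hasFDerivAt_prodMk_left ζ t)
  have hne : ∀ t : ℝ, t ≠ 0 → DifferentiableAt ℂ (fun ζ => g₁ (ζ, t)) ζ := by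
    intro t ht
    have : (fun ζ => g₁ (ζ, t)) = fun ζ => (t : ℂ)⁻¹ * (g (ζ, t) - g (ζ, 0)) := by
      funext ζ
      have : (t : ℂ) ≠ 0 := by exact_mod_cast ht
      rw [he' ζ t]
      field_simp
      ring
    rw [this]
    exact (((hg.entire t) ζ).sub ((hg.entire 0) ζ)).const_mul _
  rw [differentiableAt_complex_iff_differentiableAt_real]
  refine ⟨(hreal t).differentiableAt, ?_⟩
  have hcr : ∀ t, fderiv ℝ g₁ (ζ, t) (Complex.I, 0) = Complex.I • fderiv ℝ g₁ (ζ, t) (1, 0) := by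
    have hc : Continuous fun t => fderiv ℝ g₁ (ζ, t) :=
      (hs.continuous_fderiv (by simp)).comp (by fun_prop)
    suffices h : (fun t => fderiv ℝ g₁ (ζ, t) (Complex.I, 0)) =
        fun t => Complex.I • fderiv ℝ g₁ (ζ, t) (1, 0) from congrFun h
    refine Continuous.ext_on (dense_compl_singleton (0 : ℝ)) (hc.clm_apply continuous_const)
      ((hc.clm_apply continuous_const).const_smul Complex.I) ?_
    intro t ht
    have h1 := (differentiableAt_complex_iff_differentiableAt_real.1 (hne t ht)).2
    rw [(hreal t).fderiv] at h1
    simpa using h1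
  rw [(hreal t).fderiv]
  simpa using hcr t

theorem IsAmplitude.comp_sub {g : ℂ × ℝ → ℂ} (hg : IsAmplitude g) (w : ℂ) :
    IsAmplitude fun y => g (y.1 - w, y.2) :=
  ⟨hg.smooth.comp (by fun_prop : ContDiff ℝ ((⊤ : ℕ∞) : WithTop ℕ∞)
      fun y : ℂ × ℝ => (y.1 - w, y.2)),
    fun t => (hg.entire t).comp (differentiable_id.sub_const w)⟩

/-- `∫₀ᴸ t^ζ g(ζ, t) dt` is holomorphic for `Re ζ > -1`. -/
theorem IsAmplitude.differentiableAt_integral {g : ℂ × ℝ → ℂ} (hg : IsAmplitude g) {L : ℝ}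
    (hL : 0 < L) {ζ : ℂ} (hζ : -1 < ζ.re) :
    DifferentiableAt ℂ (fun ζ => ∫ t in (0 : ℝ)..L, (t : ℂ) ^ ζ * g (ζ, t)) ζ := by
  simp only [intervalIntegral.integral_of_le hL.le]
  set r : ℝ := (ζ.re + 1) / 2 with hr
  have hr0 : 0 < r := by rw [hr]; linarith
  obtain ⟨C, hC⟩ := ((isCompact_closedBall ζ r).prod
    (isCompact_Icc (a := (0 : ℝ)) (b := L))).exists_bound_of_continuousOn
    hg.smooth.continuous.continuousOn
  refine differentiableAt_integral_of_dominated hr0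
    (b := fun t => (t ^ (ζ.re - r) + t ^ (ζ.re + r)) * C) ?_ ?_ ?_ ?_
  · intro w hw
    refine ContinuousOn.aestronglyMeasurable ?_ measurableSet_Ioc
    refine ContinuousOn.mul (fun t ht => ?_)
      (hg.smooth.continuous.comp (by fun_prop : Continuous fun t : ℝ => (w, t))).continuousOn
    exact (Complex.continuousAt_ofReal_cpow_const _ _ (Or.inr ht.1.ne')).continuousWithinAt
  · refine (ae_restrict_iff' measurableSet_Ioc).2 (.of_forall fun t ht w _ => ?_)
    refine DifferentiableAt.mul ?_ (hg.entire t w)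
    exact (differentiableAt_id).const_cpow (Or.inl (by exact_mod_cast ht.1.ne'))
  · refine (ae_restrict_iff' measurableSet_Ioc).2 (.of_forall fun t ht w hw => ?_)
    rw [norm_mul, Complex.norm_cpow_eq_rpow_re_of_pos ht.1]
    have hw' : |w.re - ζ.re| < r := by
      have h1 := Complex.abs_re_le_norm (w - ζ)
      rw [Metric.mem_ball, dist_eq_norm] at hw
      rw [Complex.sub_re] at h1
      linarith
    rw [abs_lt] at hw'
    refine mul_le_mul ?_ (hC (w, t) ⟨Metric.ball_subset_closedBall hw, ht.1.le, ht.2⟩)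
      (norm_nonneg _) (by have := ht.1; positivity)
    have hp1 : 0 ≤ t ^ (ζ.re - r) := Real.rpow_nonneg ht.1.le _
    have hp2 : 0 ≤ t ^ (ζ.re + r) := Real.rpow_nonneg ht.1.le _
    rcases le_total t 1 with h1 | h1
    · have := Real.rpow_le_rpow_of_exponent_ge ht.1 h1
        (show ζ.re - r ≤ w.re by linarith)
      linarith
    · have := Real.rpow_le_rpow_of_exponent_le h1 (show w.re ≤ ζ.re + r by linarith)
      linarith
  · have h1 := intervalIntegral.intervalIntegrable_rpow' (a := 0) (b := L)
      (r := ζ.re - r) (by linarith)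
    have h2 := intervalIntegral.intervalIntegrable_rpow' (a := 0) (b := L)
      (r := ζ.re + r) (by linarith)
    rw [intervalIntegrable_iff_integrableOn_Ioc_of_le hL.le] at h1 h2
    exact (h1.add h2).mul_const C

theorem intervalIntegrable_cpow_mul {k : ℝ → ℂ} (hk : Continuous k) {L : ℝ} {ζ : ℂ}
    (hζ : -1 < ζ.re) : IntervalIntegrable (fun t : ℝ => (t : ℂ) ^ ζ * k t) volume 0 L :=
  (intervalIntegral.intervalIntegrable_cpow' hζ).mul_continuousOn hk.continuousOn

/-- The continuation of `∫₀ᴸ t^ζ g(ζ, t) dt` to `Re ζ > -1 - n`. With `g(ζ, t) = g(ζ, 0) + t g₁(ζ, t)`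
the first term integrates to `g(ζ, 0) L^(ζ+1) / (ζ+1)`, and the second has the exponent `ζ + 1`. -/
theorem IsAmplitude.exists_meromorphicAt_strip (n : ℕ) {g : ℂ × ℝ → ℂ} (hg : IsAmplitude g) {L : ℝ}
    (hL : 0 < L) : ∃ M : ℂ → ℂ, (∀ ζ : ℂ, -1 - (n : ℝ) < ζ.re → MeromorphicAt M ζ) ∧
      ∀ ζ : ℂ, -1 < ζ.re → M ζ = ∫ t in (0 : ℝ)..L, (t : ℂ) ^ ζ * g (ζ, t) := by
  have hLc : (L : ℂ) ≠ 0 := by exact_mod_cast hL.ne'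
  induction n generalizing g with
  | zero =>
    refine ⟨_, fun ζ hζ => ?_, fun ζ _ => rfl⟩
    have hopen : IsOpen {ζ : ℂ | -1 < ζ.re} := isOpen_lt continuous_const Complex.continuous_re
    have hζ' : -1 < ζ.re := by simpa using hζ
    exact (DifferentiableOn.analyticAt (s := {ζ : ℂ | -1 < ζ.re})
      (fun w hw => (hg.differentiableAt_integral hL hw).differentiableWithinAt)
      (hopen.mem_nhds hζ')).meromorphicAt
  | succ n ih =>
    obtain ⟨g₁, hg₁, he⟩ := hg.exists_quotient
    obtain ⟨M, hM, hMe⟩ := ih (hg₁.comp_sub 1)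
    refine ⟨fun ζ => g (ζ, 0) * ((L : ℂ) ^ (ζ + 1) / (ζ + 1)) + M (ζ + 1), fun ζ hζ => ?_,
      fun ζ hζ => ?_⟩
    · push_cast at hζ
      have ha : AnalyticAt ℂ (fun ζ => g (ζ, 0)) ζ := (hg.entire 0).analyticAt ζ
      have hb : AnalyticAt ℂ (fun ζ : ℂ => (L : ℂ) ^ (ζ + 1)) ζ :=
        analyticAt_const.cpow (by fun_prop) (Complex.ofReal_mem_slitPlane.2 hL)
      have hc : AnalyticAt ℂ (fun ζ : ℂ => ζ + 1) ζ := by fun_prop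
      have hm : MeromorphicAt (M ∘ fun ζ => ζ + 1) ζ :=
        MeromorphicAt.comp_analyticAt (hM _ (by simp; linarith)) hc
      exact (ha.meromorphicAt.mul (hb.meromorphicAt.div hc.meromorphicAt)).add hm
    · have h1 : -1 < (ζ + 1).re := by simp; linarith
      have hζ1 : ζ + 1 ≠ 0 := by
        intro h
        have := congrArg Complex.re h
        simp at this
        linarith
      have hexp : ∀ t ∈ Set.uIcc (0 : ℝ) L, (t : ℂ) ^ ζ * g (ζ, t) =
          (t : ℂ) ^ ζ * g (ζ, 0) + (t : ℂ) ^ (ζ + 1) * g₁ (ζ, t) ∨ t = 0 := by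
        intro t _
        by_cases ht : t = 0
        · exact Or.inr ht
        · left
          have htc : (t : ℂ) ≠ 0 := by exact_mod_cast ht
          rw [he ζ t, Complex.cpow_add _ _ htc, Complex.cpow_one]
          ring
      have hI : ∫ t in (0 : ℝ)..L, (t : ℂ) ^ ζ * g (ζ, t) = ∫ t in (0 : ℝ)..L,
          ((t : ℂ) ^ ζ * g (ζ, 0) + (t : ℂ) ^ (ζ + 1) * g₁ (ζ, t)) := by
        refine intervalIntegral.integral_congr_ae (.of_forall fun t ht => ?_)
        rw [Set.uIoc_of_le hL.le] at ht
        rw [Set.uIcc_of_le hL.le] at hexp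
        exact (hexp t ⟨ht.1.le, ht.2⟩).resolve_right ht.1.ne'
      have hk : Continuous fun t : ℝ => g₁ (ζ, t) := hg₁.smooth.continuous.comp (by fun_prop)
      rw [hI, intervalIntegral.integral_add (intervalIntegrable_cpow_mul continuous_const hζ)
        (intervalIntegrable_cpow_mul hk h1), intervalIntegral.integral_mul_const,
        integral_cpow (Or.inl hζ)]
      beta_reduce
      rw [hMe _ h1]
      simp [Complex.zero_cpow hζ1, mul_comm]

/-- `∫₀ᴸ t^ζ g(ζ, t) dt` extends meromorphically from `Re ζ > -1` to the plane. -/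
theorem IsAmplitude.exists_meromorphic {g : ℂ × ℝ → ℂ} (hg : IsAmplitude g) {L : ℝ}
    (hL : 0 < L) : ∃ M : ℂ → ℂ, (∀ ζ : ℂ, MeromorphicAt M ζ) ∧
      ∀ ζ : ℂ, -1 < ζ.re → M ζ = ∫ t in (0 : ℝ)..L, (t : ℂ) ^ ζ * g (ζ, t) := by
  choose M hM hMe using fun n => hg.exists_meromorphicAt_strip n hL
  -- at `ζ` the continuation to a strip that contains `ζ` is used
  refine ⟨fun ζ => M ⌈-ζ.re⌉₊ ζ, fun ζ => ?_, fun ζ hζ => hMe _ ζ hζ⟩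
  set N := ⌈-ζ.re⌉₊ + 1 with hN
  have hstrip : ∀ n : ℕ, ∀ z : ℂ, ⌈-z.re⌉₊ ≤ n → -1 - (n : ℝ) < z.re := fun n z hn => by
    have := Nat.ceil_le.1 hn
    linarith
  have hNζ : -1 - (N : ℝ) < ζ.re := hstrip N ζ (by omega)
  refine (hM N ζ hNζ).congr ?_
  -- near `ζ` only finitely many of the `M n` are used, and they all agree with `M N` there
  have hfin : ∀ᶠ z in 𝓝[≠] ζ, ∀ n ∈ Finset.range (N + 1), -1 - (n : ℝ) < ζ.re → M N z = M n z := by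
    rw [Filter.eventually_all_finset]
    intro n hn
    by_cases h : -1 - (n : ℝ) < ζ.re
    · have hnN : (n : ℝ) ≤ N := by exact_mod_cast Nat.lt_succ_iff.1 (Finset.mem_range.1 hn)
      filter_upwards [eventuallyEq_of_eq_on_halfPlane (a := -1 - (n : ℝ))
        (by have := Nat.cast_nonneg (α := ℝ) n; linarith)
        (fun z hz => hM N z (by linarith)) (hM n)
        (fun z hz => (hMe N z hz).trans (hMe n z hz).symm) h] with z hz _ using hz
    · exact .of_forall fun z h' => absurd h' h
  have hnear : ∀ᶠ z : ℂ in 𝓝 ζ, |z.re - ζ.re| < 1 := by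
    have : ContinuousAt (fun z : ℂ => |z.re - ζ.re|) ζ := by fun_prop
    exact this.eventually (gt_mem_nhds (by simp))
  filter_upwards [hfin, nhdsWithin_le_nhds hnear] with z hz hz1
  rw [abs_lt] at hz1
  refine hz _ (Finset.mem_range.2 (Nat.lt_succ_of_le ?_)) ?_
  · refine Nat.ceil_le.2 ?_
    have := Nat.le_ceil (-ζ.re)
    push_cast [hN]
    linarith
  · have := Nat.le_ceil (-z.re)
    linarith

/-! ### A cut-off integral -/

/-- The one-sided cut-off computation behind the potential: if `n(t) = 1/t + a + o(1)` as `t → 0+`,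
then `∫_{n ≤ X} (1/t² + w(t)) dt = X - a - 1/L + ∫ w + o(1)` as `X → ∞`. -/
theorem integral_cutoff {L a : ℝ} (hL : 0 < L) {n w : ℝ → ℝ} (hn : ContinuousOn n (Set.Ioc 0 L))
    (ha : Tendsto (fun t => n t - t⁻¹) (𝓝[>] 0) (𝓝 a)) (hw : Continuous w) :
    (∀ X, IntegrableOn (fun t => (t ^ 2)⁻¹ + w t) (Set.Ioc 0 L ∩ {t | n t ≤ X})) ∧
    Tendsto (fun X => (∫ t in Set.Ioc 0 L ∩ {t | n t ≤ X}, ((t ^ 2)⁻¹ + w t)) - X) atTop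
      (𝓝 ((∫ t in Set.Ioc 0 L, w t) - a - L⁻¹)) := by
  set S : ℝ → Set ℝ := fun X => Set.Ioc 0 L ∩ {t | n t ≤ X} with hS
  have hSm : ∀ X, MeasurableSet (S X) := fun X => by
    obtain ⟨u, hu, he⟩ := continuousOn_iff_isClosed.1 hn (Set.Iic X) isClosed_Iic
    have : S X = u ∩ Set.Ioc 0 L := by rw [← he, Set.inter_comm]; rfl
    rw [this]
    exact hu.measurableSet.inter measurableSet_Ioc
  -- the sets `S X` are squeezed between intervals
  have hsq : ∀ δ > 0, ∀ᶠ X in atTop, 0 < X - a - δ ∧ (X - a - δ)⁻¹ ≤ L ∧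
      Set.Icc (X - a - δ)⁻¹ L ⊆ S X ∧ S X ⊆ Set.Icc (X - a + δ)⁻¹ L := by
    intro δ hδ
    obtain ⟨η, hη, hηn⟩ : ∃ η > 0, ∀ t, 0 < t → t ≤ η → |n t - t⁻¹ - a| < δ := by
      obtain ⟨η, hη, h⟩ := Metric.tendsto_nhdsWithin_nhds.1 ha δ hδ
      refine ⟨η / 2, half_pos hη, fun t ht0 ht => ?_⟩
      have := h (Set.mem_Ioi.2 ht0) (by
        rw [Real.dist_eq, sub_zero, abs_of_pos ht0]; linarith)
      rwa [Real.dist_eq] at this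
    obtain ⟨M, hM⟩ := (isCompact_Icc (a := η) (b := L)).exists_bound_of_continuousOn
      (hn.mono fun t ht => ⟨hη.trans_le ht.1, ht.2⟩)
    filter_upwards [eventually_ge_atTop M, eventually_gt_atTop (a + δ + L⁻¹),
      eventually_ge_atTop (a + η⁻¹)] with X hX1 hX2 hX3
    have hLi : 0 < L⁻¹ := inv_pos.2 hL
    have hηi : 0 < η⁻¹ := inv_pos.2 hη
    have hp : 0 < X - a - δ := by linarith
    refine ⟨hp, inv_le_of_inv_le₀ hL (by linarith), fun t ht => ?_, fun t ht => ?_⟩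
    · have ht0 : 0 < t := (inv_pos.2 hp).trans_le ht.1
      refine ⟨⟨ht0, ht.2⟩, ?_⟩
      rcases le_total t η with h | h
      · have h1 := (abs_lt.1 (hηn t ht0 h)).2
        have h2 : t⁻¹ ≤ X - a - δ := inv_le_of_inv_le₀ hp ht.1
        rw [Set.mem_ofPred_eq]
        linarith
      · exact (le_abs_self _).trans ((hM t ⟨h, ht.2⟩).trans hX1)
    · refine ⟨?_, ht.1.2⟩
      have ht0 := ht.1.1
      have ht2 : n t ≤ X := ht.2
      refine inv_le_of_inv_le₀ ht0 ?_
      rcases le_total t η with h | h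
      · have h1 := (abs_lt.1 (hηn t ht0 h)).1
        linarith
      · have := inv_anti₀ hη h
        linarith
  have hinv : ∀ τ, 0 < τ → τ ≤ L → IntegrableOn (fun t : ℝ => (t ^ 2)⁻¹) (Set.Icc τ L) ∧
      ∫ t in Set.Icc τ L, (t ^ 2)⁻¹ = τ⁻¹ - L⁻¹ := by
    intro τ h0 h1
    have hc : ContinuousOn (fun t : ℝ => (t ^ 2)⁻¹) (Set.Icc τ L) :=
      (continuousOn_pow 2).inv₀ fun t ht => pow_ne_zero 2 (h0.trans_le ht.1).ne'
    refine ⟨hc.integrableOn_Icc, ?_⟩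
    rw [integral_Icc_eq_integral_Ioc, ← intervalIntegral.integral_of_le h1,
      intervalIntegral.integral_eq_sub_of_hasDerivAt (f := fun t => -t⁻¹)]
    · ring
    · intro t ht
      rw [Set.uIcc_of_le h1] at ht
      simpa using! (hasDerivAt_inv (h0.trans_le ht.1).ne').neg
    · exact (hc.mono (by rw [Set.uIcc_of_le h1])).intervalIntegrable
  have hSi : ∀ X, IntegrableOn (fun t : ℝ => (t ^ 2)⁻¹) (S X) := fun X => by
    obtain ⟨Y, hYX, h0, h1, -, h2⟩ := ((eventually_ge_atTop X).and (hsq 1 one_pos)).exists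
    refine ((hinv (Y - a + 1)⁻¹ (by rw [inv_pos]; linarith) ?_).1.mono_set h2).mono_set ?_
    · exact (inv_anti₀ h0 (by linarith)).trans h1
    · exact fun t ht => ⟨ht.1, le_trans ht.2 hYX⟩
  have hwi : IntegrableOn w (Set.Ioc 0 L) := hw.integrableOn_Ioc
  refine ⟨fun X => (hSi X).add (hwi.mono_set Set.inter_subset_left), ?_⟩
  have hw' : Tendsto (fun X => ∫ t in S X, w t) atTop (𝓝 (∫ t in Set.Ioc 0 L, w t)) := by
    have hcov : AECover (volume.restrict (Set.Ioc 0 L)) atTop S :=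
      ⟨(ae_restrict_iff' measurableSet_Ioc).2 (.of_forall fun t ht => by
        filter_upwards [eventually_ge_atTop (n t)] with X hX using ⟨ht, hX⟩), hSm⟩
    have := hcov.integral_tendsto_of_countably_generated hwi
    refine this.congr fun X => ?_
    rw [Measure.restrict_restrict (hSm X), Set.inter_eq_left.2 Set.inter_subset_left]
  have hs' : Tendsto (fun X => (∫ t in S X, (t ^ 2)⁻¹) - X) atTop (𝓝 (-a - L⁻¹)) := by
    rw [Metric.tendsto_nhds]
    intro δ hδ
    filter_upwards [hsq (δ / 2) (half_pos hδ)] with X hX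
    obtain ⟨h0, h1, h2, h3⟩ := hX
    have h0' : 0 < X - a + δ / 2 := by linarith
    have h1' : (X - a + δ / 2)⁻¹ ≤ L := (inv_anti₀ h0 (by linarith)).trans h1
    have hpos : ∀ T : Set ℝ, 0 ≤ᵐ[volume.restrict T] fun t : ℝ => (t ^ 2)⁻¹ := fun T =>
      .of_forall fun t => by positivity
    have hlo := setIntegral_mono_set (hSi X) (hpos _) h2.eventuallyLE
    have hup := setIntegral_mono_set (hinv _ (inv_pos.2 h0') h1').1 (hpos _) h3.eventuallyLE
    rw [(hinv _ (inv_pos.2 h0) h1).2, inv_inv] at hlo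
    rw [(hinv _ (inv_pos.2 h0') h1').2, inv_inv] at hup
    rw [Real.dist_eq, abs_lt]
    constructor <;> linarith
  have := hs'.add hw'
  rw [show (∫ t in Set.Ioc 0 L, w t) - a - L⁻¹ = -a - L⁻¹ + ∫ t in Set.Ioc 0 L, w t by ring]
  refine this.congr fun X => ?_
  rw [integral_add (hSi X) (hwi.mono_set Set.inter_subset_left)]
  ring

/-! ### The Korányi distance -/

theorem kdist_eq (p q : Heis) : kdist p q = (Complex.normSq (q.1 - p.1) ^ 2 +
    16 * (q.2 - p.2 + (1 / 2) * (p.1 * (starRingEnd ℂ) q.1).im) ^ 2) ^ (1 / 4 : ℝ) := by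
  unfold kdist knorm gmul ginv
  congr 1
  simp [Complex.normSq_apply]
  ring

theorem kdist_nonneg (p q : Heis) : 0 ≤ kdist p q := by
  rw [kdist_eq]; positivity

theorem kdist_pow_four (p q : Heis) : kdist p q ^ 4 = Complex.normSq (q.1 - p.1) ^ 2 +
    16 * (q.2 - p.2 + (1 / 2) * (p.1 * (starRingEnd ℂ) q.1).im) ^ 2 := by
  rw [kdist_eq, ← Real.rpow_natCast, ← Real.rpow_mul (by positivity)]
  norm_num

theorem continuous_kdist : Continuous fun x : Heis × Heis => kdist x.1 x.2 := by
  simp only [kdist_eq]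
  exact (by fun_prop : Continuous fun x : Heis × Heis => Complex.normSq (x.2.1 - x.1.1) ^ 2 +
    16 * (x.2.2 - x.1.2 + (1 / 2) * (x.1.1 * (starRingEnd ℂ) x.2.1).im) ^ 2).rpow_const
    fun x => Or.inr (by norm_num)

theorem continuous_kdist_left (p : Heis) : Continuous (kdist p) := by
  have h := continuous_kdist.comp (Continuous.prodMk_right p)
  exact h

theorem kdist_comm (p q : Heis) : kdist p q = kdist q p := by
  rw [kdist_eq, kdist_eq]
  congr 1
  simp [Complex.normSq_apply]
  ring

theorem kdist_self (p : Heis) : kdist p p = 0 := by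
  have h := kdist_pow_four p p
  have : (p.1 * (starRingEnd ℂ) p.1).im = 0 := by simp; ring
  rw [this] at h
  simpa using h

theorem eq_of_kdist_eq_zero {p q : Heis} (h : kdist p q = 0) : p = q := by
  have h4 := kdist_pow_four p q
  rw [h] at h4
  have h1 : Complex.normSq (q.1 - p.1) ^ 2 = 0 := by
    have ha := sq_nonneg (Complex.normSq (q.1 - p.1))
    have hb := sq_nonneg (q.2 - p.2 + (1 / 2) * (p.1 * (starRingEnd ℂ) q.1).im)
    linarith
  have h2 : q.1 - p.1 = 0 := by simpa using h1
  have h3 : q.1 = p.1 := sub_eq_zero.1 h2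
  rw [h1, h3] at h4
  have h5 : (p.1 * (starRingEnd ℂ) p.1).im = 0 := by simp; ring
  rw [h5] at h4
  have h6 : q.2 - p.2 = 0 := by simpa using h4.symm
  exact Prod.ext h3.symm (by linarith)

theorem kdist_pos {p q : Heis} (h : p ≠ q) : 0 < kdist p q :=
  (kdist_nonneg p q).lt_of_ne fun h' => h (eq_of_kdist_eq_zero h'.symm)

/-! ### Closed Legendrian curves in arc-length parameter -/

/-- A closed Legendrian curve in `ℋ` without self-intersections, parametrized by arc length. -/
structure UnitSpeedLoop where
  toFun : ℝ → Heis
  length : ℝ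
  length_pos : 0 < length
  smooth : ContDiff ℝ ((⊤ : ℕ∞) : WithTop ℕ∞) toFun
  periodic : Function.Periodic toFun length
  injOn : Set.InjOn toFun (Set.Ico 0 length)
  unit_speed : ∀ s, ‖(deriv toFun s).1‖ = 1
  legendrian : ∀ s, contactForm (toFun s) (deriv toFun s) = 0

/-- A function on pairs (start, displacement) that is odd under exchange of the end points vanishes
at displacement zero. -/
theorem eq_zero_of_odd_swap {g : ℝ × ℝ → ℝ} (hg : Continuous g)
    (h : ∀ s t, t ≠ 0 → g (s + t, -t) = -g (s, t)) (s : ℝ) : g (s, 0) = 0 := by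
  have : (fun t => g (s + t, -t)) = fun t => -g (s, t) :=
    Continuous.ext_on (dense_compl_singleton (0 : ℝ)) (by fun_prop) (by fun_prop)
      fun t ht => h s t ht
  have h0 := congrFun this 0
  simp only [add_zero, neg_zero] at h0
  linarith

namespace UnitSpeedLoop

variable (c : UnitSpeedLoop)

theorem eq_add_zsmul {s s' : ℝ} (h : c.toFun s = c.toFun s') :
    ∃ n : ℤ, s' = s + n * c.length := by
  have hmod : ∀ x, c.toFun (toIcoMod c.length_pos 0 x) = c.toFun x := fun x =>
    c.periodic.sub_zsmul_eq (toIcoDiv c.length_pos 0 x)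
  have hmem : ∀ x, toIcoMod c.length_pos 0 x ∈ Set.Ico 0 c.length := fun x => by
    simpa using toIcoMod_mem_Ico c.length_pos 0 x
  have he := c.injOn (hmem s) (hmem s') (by rw [hmod, hmod, h])
  refine ⟨toIcoDiv c.length_pos 0 s' - toIcoDiv c.length_pos 0 s, ?_⟩
  have h1 := toIcoMod_add_toIcoDiv_zsmul c.length_pos 0 s
  have h2 := toIcoMod_add_toIcoDiv_zsmul c.length_pos 0 s'
  rw [he] at h1
  push_cast
  simp only [zsmul_eq_mul] at h1 h2
  linarith

theorem toFun_add_ne {s t : ℝ} (h0 : t ≠ 0) (h1 : |t| < c.length) :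
    c.toFun s ≠ c.toFun (s + t) := by
  intro h
  obtain ⟨n, hn⟩ := c.eq_add_zsmul h
  have ht : t = n * c.length := by linarith
  rw [ht, abs_mul, abs_of_pos c.length_pos] at h1
  have h2 : |(n : ℝ)| < 1 := by
    by_contra hge
    nlinarith [c.length_pos]
  have h3 : n = 0 := by
    have : |n| < 1 := by exact_mod_cast h2
    exact Int.abs_lt_one_iff.1 this
  exact h0 (by rw [ht, h3]; simp)

theorem hasDerivAt (s : ℝ) : HasDerivAt c.toFun (deriv c.toFun s) s :=
  ((c.smooth.differentiable (by simp)) s).hasDerivAt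

theorem hasDerivAt_fst (s : ℝ) : HasDerivAt (fun s => (c.toFun s).1) (deriv c.toFun s).1 s :=
  (ContinuousLinearMap.fst ℝ ℂ ℝ).hasFDerivAt.comp_hasDerivAt s (c.hasDerivAt s)

theorem hasDerivAt_snd (s : ℝ) : HasDerivAt (fun s => (c.toFun s).2) (deriv c.toFun s).2 s :=
  (ContinuousLinearMap.snd ℝ ℂ ℝ).hasFDerivAt.comp_hasDerivAt s (c.hasDerivAt s)

/-- The fourth power of the distance of `c(s)` and `c(s + t)` is `t⁴ F(s, t)` with `F` smooth. The
vertical displacement is `O(t²)` as `c` is Legendrian, and then `O(t³)` since it is odd under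
exchange of the end points. -/
theorem exists_kdist_pow_four : ∃ F : ℝ × ℝ → ℝ, ContDiff ℝ ((⊤ : ℕ∞) : WithTop ℕ∞) F ∧
    (∀ y, 0 ≤ F y) ∧ (∀ s, F (s, 0) = 1) ∧
    ∀ s t, kdist (c.toFun s) (c.toFun (s + t)) ^ 4 = t ^ 4 * F (s, t) := by
  have hz : ContDiff ℝ ((⊤ : ℕ∞) : WithTop ℕ∞) fun s => (c.toFun s).1 := c.smooth.fst
  have hu : ContDiff ℝ ((⊤ : ℕ∞) : WithTop ℕ∞) fun s => (c.toFun s).2 := c.smooth.snd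
  obtain ⟨X, hX, hXe, hXd⟩ := exists_contDiff_sub_eq_smul
    (f := fun y : ℝ × ℝ => (c.toFun (y.1 + y.2)).1) (hz.comp (contDiff_fst.add contDiff_snd))
  set Y : ℝ × ℝ → ℝ := fun y => (c.toFun (y.1 + y.2)).2 - (c.toFun y.1).2 +
    (1 / 2) * ((c.toFun y.1).1 * (starRingEnd ℂ) (c.toFun (y.1 + y.2)).1).im with hYdef
  have hY : ContDiff ℝ ((⊤ : ℕ∞) : WithTop ℕ∞) Y := by
    have h1 : ContDiff ℝ ((⊤ : ℕ∞) : WithTop ℕ∞) fun y : ℝ × ℝ => (c.toFun (y.1 + y.2)).1 :=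
      hz.comp (contDiff_fst.add contDiff_snd)
    have h2 : ContDiff ℝ ((⊤ : ℕ∞) : WithTop ℕ∞) fun y : ℝ × ℝ => (c.toFun y.1).1 :=
      hz.comp contDiff_fst
    exact ((hu.comp (contDiff_fst.add contDiff_snd)).sub (hu.comp contDiff_fst)).add
      (contDiff_const.mul (Complex.imCLM.contDiff.comp
        (h2.mul (Complex.conjCLE.contDiff.comp h1))))
  -- `Y` is the vertical displacement from `c(s)` to `c(s + t)`
  have hYsymm : ∀ s t, Y (s + t, -t) = -Y (s, t) := by
    intro s t
    simp only [hYdef, add_neg_cancel_right, Complex.mul_im, Complex.conj_re, Complex.conj_im]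
    ring
  have hY0 : ∀ s, Y (s, 0) = 0 := by
    intro s
    simp only [hYdef, add_zero, Complex.mul_im, Complex.conj_re, Complex.conj_im]
    ring
  obtain ⟨Y₁, hY₁, hY₁e, hY₁d⟩ := exists_contDiff_sub_eq_smul hY
  have hY₁0 : ∀ s, Y₁ (s, 0) = 0 := by
    intro s
    have h1 : HasDerivAt (fun t => (c.toFun (s + t)).1) (deriv c.toFun s).1 0 := by
      have h := c.hasDerivAt_fst (s + 0)
      simpa using h.comp_const_add s 0
    have h2 : HasDerivAt (fun t => (c.toFun (s + t)).2) (deriv c.toFun s).2 0 := by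
      have h := c.hasDerivAt_snd (s + 0)
      simpa using h.comp_const_add s 0
    have h3 : HasDerivAt (fun t => ((c.toFun s).1 * (starRingEnd ℂ) (c.toFun (s + t)).1).im)
        ((c.toFun s).1 * (starRingEnd ℂ) (deriv c.toFun s).1).im 0 := by
      have h4 := (Complex.conjCLE.toContinuousLinearMap.hasFDerivAt.comp_hasDerivAt 0 h1).const_mul
        (c.toFun s).1
      exact (Complex.imCLM.hasFDerivAt.comp_hasDerivAt 0 h4)
    have h4 := ((h2.sub_const (c.toFun s).2).add (h3.const_mul (1 / 2))).unique (hY₁d s)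
    rw [← h4]
    have := c.legendrian s
    simp only [contactForm] at this
    rw [← this]
    simp only [Complex.mul_im, Complex.conj_re, Complex.conj_im]
    ring
  obtain ⟨Y₂, hY₂, hY₂e, -⟩ := exists_contDiff_sub_eq_smul hY₁
  have hYt : ∀ s t, Y (s, t) = t ^ 2 * Y₂ (s, t) := by
    intro s t
    have h1 := hY₁e s t
    have h2 := hY₂e s t
    rw [hY0, sub_zero, smul_eq_mul] at h1
    rw [hY₁0, sub_zero, smul_eq_mul] at h2
    rw [h1, h2]; ring
  have hY₂0 : ∀ s, Y₂ (s, 0) = 0 := by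
    refine eq_zero_of_odd_swap hY₂.continuous fun s t ht => ?_
    have h := hYsymm s t
    rw [hYt, hYt] at h
    have ht2 : t ^ 2 ≠ 0 := pow_ne_zero 2 ht
    have : t ^ 2 * (Y₂ (s + t, -t) + Y₂ (s, t)) = 0 := by linarith [h, neg_sq t]
    have := (mul_eq_zero.1 this).resolve_left ht2
    linarith
  have hX0 : ∀ s, X (s, 0) = (deriv c.toFun s).1 := by
    intro s
    have h1 : HasDerivAt (fun t => (c.toFun (s + t)).1) (deriv c.toFun s).1 0 := by
      have h := c.hasDerivAt_fst (s + 0)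
      simpa using h.comp_const_add s 0
    exact (hXd s).unique h1
  refine ⟨fun y => (‖X y‖ ^ 2) ^ 2 + 16 * Y₂ y ^ 2, ?_, fun y => by positivity, fun s => ?_,
    fun s t => ?_⟩
  · exact ((hX.norm_sq ℝ).pow 2).add (contDiff_const.mul (hY₂.pow 2))
  · simp [hY₂0, hX0, c.unit_speed]
  · have h1 := hXe s t
    simp only [add_zero] at h1
    have h2 := hYt s t
    simp only [hYdef] at h2
    rw [kdist_pow_four, h1, h2, Complex.real_smul, Complex.normSq_mul, Complex.normSq_ofReal,
      Complex.normSq_eq_norm_sq (X (s, t))]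
    ring

/-- As `d` is symmetric, `F` is `1 + O(t²)`. Positivity of `F` is arranged everywhere, at the price of
the restriction to `|t| ≤ ℓ/2`, where `ℓ` is the length. -/
theorem exists_kdist_pow_four' : ∃ F Q : ℝ × ℝ → ℝ, ContDiff ℝ ((⊤ : ℕ∞) : WithTop ℕ∞) F ∧
    ContDiff ℝ ((⊤ : ℕ∞) : WithTop ℕ∞) Q ∧ (∀ y, 0 < F y) ∧
    (∀ s t, F (s, t) = 1 + t ^ 2 * Q (s, t)) ∧
    ∀ s t, |t| ≤ c.length / 2 →
      kdist (c.toFun s) (c.toFun (s + t)) ^ 4 = t ^ 4 * F (s, t) := by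
  have hl := c.length_pos
  obtain ⟨F, hF, hF0, hF1, hFd⟩ := c.exists_kdist_pow_four
  obtain ⟨F₁, hF₁, hF₁e, -⟩ := exists_contDiff_sub_eq_smul hF
  have hF₁' : ∀ s t, F (s, t) = 1 + t * F₁ (s, t) := by
    intro s t
    have := hF₁e s t
    rw [hF1, smul_eq_mul] at this
    linarith
  have hF₁0 : ∀ s, F₁ (s, 0) = 0 := by
    refine eq_zero_of_odd_swap hF₁.continuous fun s t ht => ?_
    have h1 := hFd s t
    have h2 := hFd (s + t) (-t)
    rw [add_neg_cancel_right, kdist_comm, h1] at h2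
    have ht4 : t ^ 4 ≠ 0 := pow_ne_zero 4 ht
    have h3 : F (s, t) = F (s + t, -t) := by
      refine mul_left_cancel₀ ht4 ?_
      rw [h2]; ring
    rw [hF₁', hF₁'] at h3
    have : t * (F₁ (s + t, -t) + F₁ (s, t)) = 0 := by linarith
    have := (mul_eq_zero.1 this).resolve_left ht
    linarith
  obtain ⟨Q, hQ, hQe, -⟩ := exists_contDiff_sub_eq_smul hF₁
  have hFQ : ∀ s t, F (s, t) = 1 + t ^ 2 * Q (s, t) := by
    intro s t
    have := hQe s t
    rw [hF₁0, sub_zero, smul_eq_mul] at this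
    rw [hF₁', this]; ring
  -- `F` may vanish for `|t| ≥ ℓ`; a cut-off makes it positive without a change for `|t| ≤ ℓ/2`
  set χ : ℝ → ℝ := fun t => Real.smoothTransition (t ^ 2 - (c.length / 2) ^ 2) with hχ
  have hχs : ContDiff ℝ ((⊤ : ℕ∞) : WithTop ℕ∞) χ :=
    Real.smoothTransition.contDiff.comp (by fun_prop)
  have hχ2 : ContDiff ℝ ((⊤ : ℕ∞) : WithTop ℕ∞) fun y : ℝ × ℝ => χ y.2 := hχs.comp contDiff_snd
  refine ⟨fun y => F y + y.2 ^ 2 * χ y.2, fun y => Q y + χ y.2,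
    hF.add ((contDiff_snd.pow 2).mul hχ2), hQ.add hχ2, ?_, ?_, ?_⟩
  · rintro ⟨s, t⟩
    have hχ0 : 0 ≤ t ^ 2 * χ t := mul_nonneg (sq_nonneg t) (Real.smoothTransition.nonneg _)
    rcases le_or_gt |t| (c.length / 2) with h | h
    · have hpos : 0 < F (s, t) := by
        by_cases ht : t = 0
        · rw [ht, hF1]; exact one_pos
        · refine (hF0 _).lt_of_ne fun h0 => ?_
          have h1 := hFd s t
          rw [← h0, mul_zero] at h1
          have h2 := kdist_pos (c.toFun_add_ne (s := s) ht (by linarith))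
          exact (pow_pos h2 4).ne' h1
      show 0 < F (s, t) + t ^ 2 * χ t
      linarith
    · have ht2 : (c.length / 2) ^ 2 < t ^ 2 := by
        rw [← sq_abs t]
        exact pow_lt_pow_left₀ h (by linarith) two_ne_zero
      have h1 : 0 < χ t := Real.smoothTransition.pos_of_pos (by linarith)
      have h2 : 0 < t ^ 2 * χ t := mul_pos (lt_of_le_of_lt (sq_nonneg _) ht2) h1
      have h3 := hF0 (s, t)
      show 0 < F (s, t) + t ^ 2 * χ t
      linarith
  · intro s t
    simp only [hFQ]
    ring
  · intro s t ht
    have ht2 : t ^ 2 ≤ (c.length / 2) ^ 2 := by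
      rw [← sq_abs t]
      exact pow_le_pow_left₀ (abs_nonneg t) ht 2
    have : χ t = 0 := Real.smoothTransition.zero_of_nonpos (by linarith)
    simp only [this, mul_zero, add_zero, hFd]

/-- The expansion of all powers of the distance near the diagonal. -/
theorem exists_kdist_cpow : ∃ P : (ℂ × ℝ) × ℝ → ℂ, ContDiff ℝ ((⊤ : ℕ∞) : WithTop ℕ∞) P ∧
    (∀ t s, Differentiable ℂ fun ζ => P ((ζ, t), s)) ∧
    ∀ s t ζ, t ≠ 0 → |t| ≤ c.length / 2 →
      (kdist (c.toFun s) (c.toFun (s + t)) : ℂ) ^ ζ =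
        ((|t| : ℝ) : ℂ) ^ ζ * (1 + (t : ℂ) ^ 2 * P ((ζ, t), s)) := by
  obtain ⟨F, Q, hF, hQ, hF0, hFQ, hFd⟩ := c.exists_kdist_pow_four'
  -- `d^ζ = |t|^ζ exp(ζ/4 log F)`; with `exp w = 1 + w e(w)` and `log F = (F - 1) l(F) = t² Q l(F)`,
  -- where `e` and `l` are the difference quotients of `exp` at `0` and of `log` at `1`, the
  -- remainder is `P = Q l(F) (ζ/4) e(ζ/4 log F)`
  have hexp : Differentiable ℂ (dslope Complex.exp 0) := by
    rw [← differentiableOn_univ, Complex.differentiableOn_dslope univ_mem, differentiableOn_univ]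
    exact Complex.differentiable_exp
  have hlog : DifferentiableOn ℂ (dslope Complex.log 1) Complex.slitPlane := by
    rw [Complex.differentiableOn_dslope
      (Complex.isOpen_slitPlane.mem_nhds Complex.one_mem_slitPlane)]
    exact fun z hz => (Complex.differentiableAt_log hz).differentiableWithinAt
  have hF' : ContDiff ℝ ((⊤ : ℕ∞) : WithTop ℕ∞) fun y : (ℂ × ℝ) × ℝ => F (y.2, y.1.2) :=
    hF.comp (by fun_prop)
  have hQ' : ContDiff ℝ ((⊤ : ℕ∞) : WithTop ℕ∞) fun y : (ℂ × ℝ) × ℝ => Q (y.2, y.1.2) :=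
    hQ.comp (by fun_prop)
  have hlogF : ContDiff ℝ ((⊤ : ℕ∞) : WithTop ℕ∞)
      fun y : (ℂ × ℝ) × ℝ => ((Real.log (F (y.2, y.1.2)) : ℝ) : ℂ) :=
    Complex.ofRealCLM.contDiff.comp (hF'.log fun y => (hF0 _).ne')
  have hdl : ContDiff ℝ ((⊤ : ℕ∞) : WithTop ℕ∞)
      fun y : (ℂ × ℝ) × ℝ => dslope Complex.log 1 (F (y.2, y.1.2) : ℂ) := by
    rw [contDiff_iff_contDiffAt]
    intro y
    have h1 : ContDiffAt ℂ ((⊤ : ℕ∞) : WithTop ℕ∞) (dslope Complex.log 1)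
        (F (y.2, y.1.2) : ℂ) :=
      (hlog.contDiffOn Complex.isOpen_slitPlane).contDiffAt
        (Complex.isOpen_slitPlane.mem_nhds (Complex.ofReal_mem_slitPlane.2 (hF0 _)))
    exact (h1.restrict_scalars ℝ).comp y (Complex.ofRealCLM.contDiff.comp hF').contDiffAt
  refine ⟨fun y => (Q (y.2, y.1.2) : ℂ) * dslope Complex.log 1 (F (y.2, y.1.2) : ℂ) *
    (y.1.1 / 4) * dslope Complex.exp 0 (y.1.1 / 4 * (Real.log (F (y.2, y.1.2)) : ℝ)), ?_, ?_, ?_⟩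
  · have h1 : ContDiff ℝ ((⊤ : ℕ∞) : WithTop ℕ∞) fun y : (ℂ × ℝ) × ℝ => y.1.1 / 4 := by fun_prop
    have h2 : ContDiff ℝ ((⊤ : ℕ∞) : WithTop ℕ∞) (dslope Complex.exp 0) :=
      (hexp.contDiff (n := ((⊤ : ℕ∞) : WithTop ℕ∞))).restrict_scalars ℝ
    exact (((Complex.ofRealCLM.contDiff.comp hQ').mul hdl).mul h1).mul
      (h2.comp (h1.mul hlogF))
  · intro t s
    have h1 : Differentiable ℂ fun ζ : ℂ => ζ / 4 := by fun_prop
    exact (h1.const_mul ((Q (s, t) : ℂ) * dslope Complex.log 1 (F (s, t) : ℂ))).mul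
      (hexp.comp (h1.mul_const ((Real.log (F (s, t)) : ℝ) : ℂ)))
  · intro s t ζ ht htl
    have hFp := hF0 (s, t)
    have hd : kdist (c.toFun s) (c.toFun (s + t)) = |t| * F (s, t) ^ (1 / 4 : ℝ) := by
      refine (pow_left_inj₀ (kdist_nonneg _ _) (by positivity) four_ne_zero).1 ?_
      rw [hFd s t htl, mul_pow, ← Real.rpow_natCast (F (s, t) ^ (1 / 4 : ℝ)), ← Real.rpow_mul hFp.le,
        (show Even 4 by decide).pow_abs]
      norm_num
    rw [hd, Complex.ofReal_mul, Complex.mul_cpow_ofReal_nonneg (abs_nonneg t)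
      (Real.rpow_nonneg hFp.le _)]
    congr 1
    have hFr : (F (s, t) ^ (1 / 4 : ℝ)) ≠ 0 := (Real.rpow_pos_of_pos hFp _).ne'
    rw [Complex.cpow_def_of_ne_zero (Complex.ofReal_ne_zero.2 hFr),
      ← Complex.ofReal_log (Real.rpow_nonneg hFp.le _), Real.log_rpow hFp]
    have e1 : ((1 / 4 * Real.log (F (s, t)) : ℝ) : ℂ) * ζ =
        ζ / 4 * (Real.log (F (s, t)) : ℝ) := by push_cast; ring
    rw [e1]
    have e2 := sub_smul_dslope Complex.exp 0 (ζ / 4 * (Real.log (F (s, t)) : ℝ))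
    have e3 := sub_smul_dslope Complex.log 1 (F (s, t) : ℂ)
    rw [Complex.log_one, sub_zero, smul_eq_mul, ← Complex.ofReal_log hFp.le] at e3
    rw [sub_zero, smul_eq_mul, Complex.exp_zero] at e2
    have e4 : (F (s, t) : ℂ) - 1 = (t : ℂ) ^ 2 * Q (s, t) := by
      rw [hFQ]; push_cast; ring
    rw [e4] at e3
    have e5 : Complex.exp (ζ / 4 * (Real.log (F (s, t)) : ℝ)) = 1 + ζ / 4 *
      (Real.log (F (s, t)) : ℝ) * dslope Complex.exp 0 (ζ / 4 * (Real.log (F (s, t)) : ℝ)) := by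
      rw [e2]; ring
    rw [e5]
    nth_rewrite 1 [← e3]
    ring

end UnitSpeedLoop

/-! ### The Hermitian form and the conformal factor -/

/-- The Hermitian form `formD`, written out. -/
noncomputable def herm (P Q : Fin 3 → ℂ) : ℂ :=
  P 1 * (starRingEnd ℂ) (Q 1) + Complex.I / 2 * (P 2 * (starRingEnd ℂ) (Q 0)) -
    Complex.I / 2 * (P 0 * (starRingEnd ℂ) (Q 2))

theorem herm_eq_dotProduct (P Q : Fin 3 → ℂ) :
    herm P Q = P ⬝ᵥ (formD.mulVec fun i => (starRingEnd ℂ) (Q i)) := by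
  simp [herm, formD, dotProduct, Matrix.mulVec, Fin.sum_univ_three]
  ring

theorem PreservesForm.herm_mulVec {A : Matrix (Fin 3) (Fin 3) ℂ} (hA : PreservesForm A)
    (P Q : Fin 3 → ℂ) : herm (A.mulVec P) (A.mulVec Q) = herm P Q := by
  have h1 : (fun i => (starRingEnd ℂ) (A.mulVec Q i)) =
      (A.map (starRingEnd ℂ)).mulVec fun i => (starRingEnd ℂ) (Q i) := by
    funext i
    simp [Matrix.mulVec, dotProduct]
  rw [herm_eq_dotProduct, herm_eq_dotProduct, h1, Matrix.mulVec_mulVec, ← Matrix.vecMul_transpose,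
    ← Matrix.dotProduct_mulVec, Matrix.mulVec_mulVec, ← Matrix.mul_assoc, hA]

theorem homog_infty : homog OnePoint.infty = ![0, 0, 1] := rfl

theorem homog_coe (p : Heis) : homog (p : OnePoint Heis) =
    ![1, p.1, -4 * (p.2 : ℂ) + Complex.I * (p.1 * (starRingEnd ℂ) p.1)] := by
  have : homog (p : OnePoint Heis) =
    ![1, p.1, -4 * (p.2 : ℂ) + Complex.I * (‖p.1‖ : ℂ) ^ 2] := rfl
  rw [this, Complex.mul_conj, Complex.normSq_eq_norm_sq]
  push_cast
  rfl

/-- Homogeneous coordinates determine the point, even up to a factor. -/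
theorem homog_injective_projective {p q : OnePoint Heis} {c : ℂ} (h : homog p = c • homog q) :
    p = q := by
  have h0 := congrFun h 0
  have h1 := congrFun h 1
  have h2 := congrFun h 2
  induction p using OnePoint.rec with
  | infty =>
    induction q using OnePoint.rec with
    | infty => rfl
    | coe q =>
      simp [homog_infty, homog_coe] at h0 h2
      simp [← h0] at h2
  | coe p =>
    induction q using OnePoint.rec with
    | infty => simp [homog_infty, homog_coe] at h0
    | coe q =>
      simp only [homog_coe, Matrix.cons_val_zero, Pi.smul_apply, smul_eq_mul, mul_one] at h0
      simp only [homog_coe, Matrix.cons_val_one, Pi.smul_apply, smul_eq_mul, ← h0, one_mul,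
        Matrix.cons_val_zero] at h1
      simp only [homog_coe, Matrix.cons_val, Pi.smul_apply, smul_eq_mul, ← h0, one_mul, h1] at h2
      have h3 : (p.2 : ℂ) = q.2 := by linear_combination (-1 / 4) * h2
      exact congrArg _ (Prod.ext h1 (by exact_mod_cast h3))

/-- The Korányi distance in terms of the Hermitian form. -/
theorem kdist_pow_four_eq_herm (p q : Heis) :
    kdist p q ^ 4 = 4 * Complex.normSq (herm (homog p) (homog q)) := by
  rw [kdist_pow_four, homog_coe, homog_coe]
  simp [herm, Complex.normSq_apply]
  ring

theorem kdist_sq_eq_herm (p q : Heis) : kdist p q ^ 2 = 2 * ‖herm (homog p) (homog q)‖ := by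
  have h := kdist_pow_four_eq_herm p q
  rw [Complex.normSq_eq_norm_sq] at h
  refine (pow_left_inj₀ (sq_nonneg _) (by positivity) two_ne_zero).1 ?_
  rw [← pow_mul, mul_pow]
  norm_num
  exact h

/-- The factor `λ` in `A · homog p = λ homog (T p)`, where `T` is the Möbius transformation with the
matrix `A` and `T p` is finite. It vanishes where `T p = ∞`. Its norm is the conformal factor of `T`:
squared distances are divided by `|λ(p)| |λ(q)|`, and horizontal lengths at `p` by `|λ(p)|`. -/
noncomputable def lam (A : Matrix (Fin 3) (Fin 3) ℂ) (p : Heis) : ℂ := A.mulVec (homog p) 0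

/-- The Möbius transformation with the matrix `A` in coordinates, where it is finite (the value where
`lam A p = 0` is irrelevant). -/
noncomputable def mobiusCoord (A : Matrix (Fin 3) (Fin 3) ℂ) (p : Heis) : Heis :=
  (A.mulVec (homog p) 1 / lam A p, -(A.mulVec (homog p) 2 / lam A p).re / 4)

section Induced

variable {T : Equiv.Perm (OnePoint Heis)} {A : Matrix (Fin 3) (Fin 3) ℂ}

theorem IsInducedBy.mulVec_eq (hT : IsInducedBy T A) {p q : Heis}
    (h : T (p : OnePoint Heis) = (q : OnePoint Heis)) :
    lam A p ≠ 0 ∧ A.mulVec (homog p) = lam A p • homog q := by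
  obtain ⟨c, hc, he⟩ := hT p
  rw [h] at he
  have : lam A p = c := by
    rw [lam, he, homog_coe]; simp
  rw [this]
  exact ⟨hc, he⟩

theorem IsInducedBy.lam_eq_zero_iff (hT : IsInducedBy T A) (p : Heis) :
    lam A p = 0 ↔ T (p : OnePoint Heis) = OnePoint.infty := by
  constructor
  · intro h
    by_contra hne
    obtain ⟨q, hq⟩ := OnePoint.ne_infty_iff_exists.1 hne
    exact (hT.mulVec_eq hq.symm).1 h
  · intro h
    obtain ⟨c, -, he⟩ := hT p
    rw [lam, he, h, homog_infty]
    simp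

theorem IsInducedBy.apply_eq (hT : IsInducedBy T A) {p : Heis} (h : lam A p ≠ 0) :
    T (p : OnePoint Heis) = (mobiusCoord A p : OnePoint Heis) := by
  have hne : T (p : OnePoint Heis) ≠ OnePoint.infty := fun h' => h ((hT.lam_eq_zero_iff p).2 h')
  obtain ⟨q, hq⟩ := OnePoint.ne_infty_iff_exists.1 hne
  rw [← hq]
  have he := (hT.mulVec_eq hq.symm).2
  rw [mobiusCoord, he, homog_coe]
  refine congrArg _ (Prod.ext ?_ ?_)
  · simp [h]
  · simp [h]
    ring

/-- The Korányi distance scales by the conformal factors. -/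
theorem IsInducedBy.kdist_sq (hT : IsInducedBy T A) (hA : PreservesForm A) {p q p' q' : Heis}
    (hp : T (p : OnePoint Heis) = (p' : OnePoint Heis))
    (hq : T (q : OnePoint Heis) = (q' : OnePoint Heis)) :
    kdist p q ^ 2 = ‖lam A p‖ * ‖lam A q‖ * kdist p' q' ^ 2 := by
  have h1 := (hT.mulVec_eq hp).2
  have h2 := (hT.mulVec_eq hq).2
  have h3 : herm (lam A p • homog p') (lam A q • homog q') =
      lam A p * (starRingEnd ℂ) (lam A q) * herm (homog p') (homog q') := by
    simp [herm]; ring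
  rw [kdist_sq_eq_herm, kdist_sq_eq_herm, ← hA.herm_mulVec, h1, h2, h3, norm_mul, norm_mul,
    RCLike.norm_conj]
  ring

theorem contDiff_mulVec_homog (A : Matrix (Fin 3) (Fin 3) ℂ) (i : Fin 3) :
    ContDiff ℝ ((⊤ : ℕ∞) : WithTop ℕ∞) fun p : Heis => A.mulVec (homog p) i := by
  have h1 : ContDiff ℝ ((⊤ : ℕ∞) : WithTop ℕ∞) fun p : Heis => (starRingEnd ℂ) p.1 :=
    Complex.conjCLE.contDiff.comp contDiff_fst
  have h2 : ContDiff ℝ ((⊤ : ℕ∞) : WithTop ℕ∞) fun p : Heis => (p.2 : ℂ) :=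
    Complex.ofRealCLM.contDiff.comp contDiff_snd
  simp only [homog_coe, Matrix.mulVec, dotProduct, Fin.sum_univ_three]
  simp only [Matrix.cons_val]
  fun_prop

theorem contDiff_lam (A : Matrix (Fin 3) (Fin 3) ℂ) :
    ContDiff ℝ ((⊤ : ℕ∞) : WithTop ℕ∞) (lam A) := contDiff_mulVec_homog A 0

theorem contDiffAt_mobiusCoord {p : Heis} (h : lam A p ≠ 0) :
    ContDiffAt ℝ ((⊤ : ℕ∞) : WithTop ℕ∞) (mobiusCoord A) p := by
  have h1 : ∀ i, ContDiffAt ℝ ((⊤ : ℕ∞) : WithTop ℕ∞)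
      (fun p : Heis => A.mulVec (homog p) i / lam A p) p := fun i => by
    simp only [div_eq_mul_inv]
    exact (contDiff_mulVec_homog A i).contDiffAt.mul ((contDiff_lam A).contDiffAt.inv h)
  exact (h1 1).prodMk ((Complex.reCLM.contDiff.contDiffAt.comp p (h1 2)).neg.div_const 4)

/-- The derivative of `homog` at `p` in the direction `v`. -/
noncomputable def dhomog (p v : Heis) : Fin 3 → ℂ :=
  ![0, v.1, -4 * (v.2 : ℂ) + Complex.I * (v.1 * (starRingEnd ℂ) p.1 + p.1 * (starRingEnd ℂ) v.1)]

theorem hasDerivAt_homog {g : ℝ → Heis} {v : Heis} {t : ℝ} (h : HasDerivAt g v t) :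
    HasDerivAt (fun s => homog (g s)) (dhomog (g t) v) t := by
  have h1 : HasDerivAt (fun s => (g s).1) v.1 t :=
    (ContinuousLinearMap.fst ℝ ℂ ℝ).hasFDerivAt.comp_hasDerivAt t h
  have h2 : HasDerivAt (fun s => ((g s).2 : ℂ)) (v.2 : ℂ) t :=
    ((ContinuousLinearMap.snd ℝ ℂ ℝ).hasFDerivAt.comp_hasDerivAt t h).ofReal_comp
  have h3 : HasDerivAt (fun s => (starRingEnd ℂ) (g s).1) ((starRingEnd ℂ) v.1) t :=
    Complex.conjCLE.toContinuousLinearMap.hasFDerivAt.comp_hasDerivAt t h1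
  rw [hasDerivAt_pi]
  intro i
  fin_cases i
  · simpa [homog_coe, dhomog] using hasDerivAt_const t (1 : ℂ)
  · simpa [homog_coe, dhomog] using h1
  · simpa [homog_coe, dhomog] using! (h2.const_mul (-4)).add ((h1.mul h3).const_mul Complex.I)

theorem herm_homog_self (p : Heis) : herm (homog p) (homog p) = 0 := by
  have := kdist_pow_four_eq_herm p p
  rw [kdist_self] at this
  simpa using this.symm

/-- The contact form in terms of the Hermitian form. -/
theorem herm_dhomog_homog (p v : Heis) :
    herm (dhomog p v) (homog p) = -2 * Complex.I * (contactForm p v : ℝ) := by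
  rw [homog_coe]
  apply Complex.ext
  · simp [herm, dhomog, contactForm]; ring
  · simp [herm, dhomog, contactForm]; ring

theorem herm_homog_dhomog (p v : Heis) :
    herm (homog p) (dhomog p v) = 2 * Complex.I * (contactForm p v : ℝ) := by
  rw [homog_coe]
  apply Complex.ext
  · simp [herm, dhomog, contactForm]; ring
  · simp [herm, dhomog, contactForm]; ring

/-- The length of a horizontal vector in terms of the Hermitian form. -/
theorem herm_dhomog_self (p v : Heis) :
    herm (dhomog p v) (dhomog p v) = (hnorm v ^ 2 : ℝ) := by
  rw [hnorm, ← Complex.normSq_eq_norm_sq, ← Complex.mul_conj]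
  simp [herm, dhomog]

theorem IsRegularLegendrianAt.hnorm_ne_zero {g : ℝ → Heis} {t : ℝ}
    (h : IsRegularLegendrianAt g t) : hnorm (deriv g t) ≠ 0 := by
  intro h0
  have h1 : (deriv g t).1 = 0 := norm_eq_zero.1 h0
  have h2 := h.legendrian
  simp only [contactForm, h1, Complex.zero_re, Complex.zero_im, mul_zero, sub_zero, add_zero] at h2
  exact h.regular (Prod.ext h1 h2)

/-- Möbius transformations preserve the contact structure and scale horizontal vectors by the
inverse of the conformal factor. -/
theorem IsInducedBy.isRegularLegendrianAt (hT : IsInducedBy T A) (hA : PreservesForm A)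
    {g : ℝ → Heis} {t : ℝ} (hg : IsRegularLegendrianAt g t) (h : lam A (g t) ≠ 0) :
    IsRegularLegendrianAt (fun s => coord (T (g s))) t ∧
      hnorm (deriv g t) = ‖lam A (g t)‖ * hnorm (deriv (fun s => coord (T (g s))) t) := by
  have hgd : HasDerivAt g (deriv g t) t :=
    (hg.smooth.differentiableAt (by simp)).hasDerivAt
  have hne : ∀ᶠ s in 𝓝 t, lam A (g s) ≠ 0 :=
    ((contDiff_lam A).continuous.continuousAt.comp hgd.continuousAt).eventually_ne h
  have heq : (fun s => coord (T (g s))) =ᶠ[𝓝 t] fun s => mobiusCoord A (g s) := by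
    filter_upwards [hne] with s hs
    rw [hT.apply_eq hs]
    rfl
  have hsm : ContDiffAt ℝ ((⊤ : ℕ∞) : WithTop ℕ∞) (fun s => coord (T (g s))) t :=
    ((contDiffAt_mobiusCoord h).comp t hg.smooth).congr_of_eventuallyEq heq
  set w := deriv (fun s => coord (T (g s))) t with hw
  have hwd : HasDerivAt (fun s => coord (T (g s))) w t :=
    (hsm.differentiableAt (by simp)).hasDerivAt
  have hl : DifferentiableAt ℝ (fun s => lam A (g s)) t :=
    (((contDiff_lam A).differentiable (by simp)) _).comp t hgd.differentiableAt
  set k := coord (T (g t)) with hk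
  set l' := deriv (fun s => lam A (g s)) t with hl'
  -- differentiate `A h = λ k`
  have h1 : A.mulVec (dhomog (g t) (deriv g t)) =
      lam A (g t) • dhomog k w + l' • homog k := by
    have e1 : HasDerivAt (fun s => A.mulVec (homog (g s)))
        (A.mulVec (dhomog (g t) (deriv g t))) t :=
      (A.mulVecLin.restrictScalars ℝ).toContinuousLinearMap.hasFDerivAt.comp_hasDerivAt t
        (hasDerivAt_homog hgd)
    have e2 : HasDerivAt (fun s => lam A (g s) • homog (coord (T (g s))))
        (lam A (g t) • dhomog k w + l' • homog k) t := hl.hasDerivAt.smul (hasDerivAt_homog hwd)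
    refine e1.unique (e2.congr_of_eventuallyEq ?_)
    filter_upwards [hne] with s hs
    have h3 := hT.apply_eq hs
    rw [h3]
    exact (hT.mulVec_eq h3).2
  have h0 : A.mulVec (homog (g t)) = lam A (g t) • homog k := by
    have h3 := hT.apply_eq h
    rw [hk, h3]
    exact (hT.mulVec_eq h3).2
  set l := lam A (g t) with hldef
  -- as `A` preserves the Hermitian form and `k` is a null vector, the terms with `λ'` drop out
  have hθ : contactForm k w = 0 := by
    have e := hA.herm_mulVec (dhomog (g t) (deriv g t)) (homog (g t))
    have e3 : herm (l • dhomog k w + l' • homog k) (l • homog k) =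
        l * (starRingEnd ℂ) l * herm (dhomog k w) (homog k) +
        l' * (starRingEnd ℂ) l * herm (homog k) (homog k) := by
      simp [herm]; ring
    rw [h1, h0, e3, herm_homog_self, herm_dhomog_homog, herm_dhomog_homog, hg.legendrian] at e
    simpa [h] using e
  have hnorm_eq : hnorm (deriv g t) = ‖l‖ * hnorm w := by
    have e := hA.herm_mulVec (dhomog (g t) (deriv g t)) (dhomog (g t) (deriv g t))
    have e3 : herm (l • dhomog k w + l' • homog k) (l • dhomog k w + l' • homog k) =
        l * (starRingEnd ℂ) l * herm (dhomog k w) (dhomog k w) +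
        l' * (starRingEnd ℂ) l * herm (homog k) (dhomog k w) +
        l * (starRingEnd ℂ) l' * herm (dhomog k w) (homog k) +
        l' * (starRingEnd ℂ) l' * herm (homog k) (homog k) := by
      simp [herm]; ring
    rw [h1, e3, herm_homog_self, herm_dhomog_homog, herm_homog_dhomog, hθ, herm_dhomog_self,
      herm_dhomog_self, Complex.mul_conj, Complex.normSq_eq_norm_sq] at e
    simp only [Complex.ofReal_zero, mul_zero, add_zero] at e
    have e4 : ‖l‖ ^ 2 * hnorm w ^ 2 = hnorm (deriv g t) ^ 2 := by exact_mod_cast e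
    rw [← mul_pow] at e4
    exact ((pow_left_inj₀ (mul_nonneg (norm_nonneg _) (norm_nonneg _)) (norm_nonneg _)
      two_ne_zero).1 e4).symm
  refine ⟨⟨hsm, fun hw0 => hg.hnorm_ne_zero ?_, hθ⟩, hnorm_eq⟩
  rw [hnorm_eq, hw, hw0]
  simp [hnorm]

/-- Möbius transformations are continuous at finite points. -/
theorem IsInducedBy.continuousAt_coe (hT : IsInducedBy T A) (p : Heis) :
    ContinuousAt (fun q : Heis => T (q : OnePoint Heis)) p := by
  by_cases h : lam A p = 0
  · have hinf := (hT.lam_eq_zero_iff p).1 h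
    rw [ContinuousAt, hinf]
    refine OnePoint.le_nhds_infty.2 fun C _ hC => Filter.mem_map.2 ?_
    -- on `C` the last homogeneous coordinate is bounded by the first, which tends to `0`
    have hcont : ∀ i, Continuous fun q : Heis => A.mulVec (homog q) i := fun i =>
      (contDiff_mulVec_homog A i).continuous
    obtain ⟨M, hM⟩ := hC.exists_bound_of_continuousOn (f := fun q : Heis => homog q 2)
      (by simpa using (contDiff_mulVec_homog 1 2).continuous.continuousOn)
    obtain ⟨c, hc, he⟩ := hT p
    have h2 : A.mulVec (homog p) 2 = c := by rw [he, hinf, homog_infty]; simp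
    have hlim : Tendsto (fun q : Heis => ‖A.mulVec (homog q) 2‖ - ‖lam A q‖ * M) (𝓝 p)
        (𝓝 (‖c‖ - ‖lam A p‖ * M)) := by
      rw [← h2]
      exact ((hcont 2).norm.sub ((hcont 0).norm.mul continuous_const)).tendsto p
    rw [h, norm_zero, zero_mul, sub_zero] at hlim
    filter_upwards [hlim.eventually (lt_mem_nhds (norm_pos_iff.2 hc))] with q hq
    by_contra hnot
    have hfin : T (q : OnePoint Heis) ≠ OnePoint.infty := fun h' => hnot (Or.inr h')
    obtain ⟨k, hqk⟩ := OnePoint.ne_infty_iff_exists.1 hfin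
    have hk : k ∈ C := by
      by_contra hk
      exact hnot (Or.inl ⟨k, hk, hqk⟩)
    have h3 := (hT.mulVec_eq hqk.symm).2
    have h4 : ‖A.mulVec (homog q) 2‖ = ‖lam A q‖ * ‖homog k 2‖ := by
      rw [h3, Pi.smul_apply, norm_smul]
    rw [h4] at hq
    have := mul_le_mul_of_nonneg_left (hM k hk) (norm_nonneg (lam A q))
    linarith
  · have hne : ∀ᶠ q in 𝓝 p, lam A q ≠ 0 :=
      (contDiff_lam A).continuous.continuousAt.eventually_ne h
    have hc : ContinuousAt (fun q : Heis => (mobiusCoord A q : OnePoint Heis)) p :=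
      OnePoint.continuous_coe.continuousAt.comp (contDiffAt_mobiusCoord h).continuousAt
    refine hc.congr ?_
    filter_upwards [hne] with q hq
    exact (hT.apply_eq hq).symm

end Induced

/-! ### Inversion and translations as Möbius transformations -/

theorem coord_coe (p : Heis) : coord (p : OnePoint Heis) = p := rfl

theorem coe_coord {p : OnePoint Heis} (h : p ≠ OnePoint.infty) :
    (coord p : OnePoint Heis) = p := by
  obtain ⟨q, rfl⟩ := OnePoint.ne_infty_iff_exists.1 h
  rfl

/-- A matrix of the inversion. -/
noncomputable def inversionMatrix : Matrix (Fin 3) (Fin 3) ℂ :=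
  !![0, 0, 1; 0, Complex.I, 0; -1, 0, 0]

/-- A matrix of the left translation by `a`. -/
noncomputable def translationMatrix (a : Heis) : Matrix (Fin 3) (Fin 3) ℂ :=
  !![1, 0, 0; a.1, 1, 0; -4 * (a.2 : ℂ) + Complex.I * (a.1 * (starRingEnd ℂ) a.1),
    2 * Complex.I * (starRingEnd ℂ) a.1, 1]

theorem preservesForm_inversionMatrix : PreservesForm inversionMatrix := by
  unfold PreservesForm formD inversionMatrix
  ext i j
  fin_cases i <;> fin_cases j <;> simp [Matrix.mul_apply, Fin.sum_univ_three] <;> ring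

theorem preservesForm_translationMatrix (a : Heis) : PreservesForm (translationMatrix a) := by
  unfold PreservesForm formD translationMatrix
  ext i j
  fin_cases i <;> fin_cases j <;> apply Complex.ext <;>
    simp [Matrix.mul_apply, Fin.sum_univ_three] <;> ring

theorem inversion_infty : inversion OnePoint.infty = ((0 : Heis) : OnePoint Heis) := rfl

theorem inversion_zero : inversion ((0 : Heis) : OnePoint Heis) = OnePoint.infty := by
  show (if (0 : Heis) = 0 then OnePoint.infty else _) = _
  simp

theorem inversion_coe {p : Heis} (h : p ≠ 0) : inversion (p : OnePoint Heis) =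
    (((p.1 / ((‖p.1‖ : ℂ) ^ 2 + 4 * Complex.I * (p.2 : ℂ)),
      -p.2 / (‖p.1‖ ^ 4 + 16 * p.2 ^ 2)) : Heis) : OnePoint Heis) := by
  show (if p = 0 then OnePoint.infty else _) = _
  simp [h]

theorem inversionMatrix_mulVec (v : Fin 3 → ℂ) :
    inversionMatrix.mulVec v = ![v 2, Complex.I * v 1, -v 0] := by
  funext i
  fin_cases i <;> simp [inversionMatrix, Matrix.mulVec, dotProduct, Fin.sum_univ_three]

/-- The last homogeneous coordinate of `p` has the norm `‖p‖²`. -/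
theorem norm_homog_two (p : Heis) : ‖homog (p : OnePoint Heis) 2‖ = knorm p ^ 2 := by
  refine (pow_left_inj₀ (norm_nonneg _) (sq_nonneg _) two_ne_zero).1 ?_
  rw [← Complex.normSq_eq_norm_sq, ← pow_mul, knorm, ← Real.rpow_natCast, ← Real.rpow_mul
    (by positivity), homog_coe]
  simp [Complex.normSq_apply]
  ring

theorem homog_two_ne_zero {p : Heis} (h : p ≠ 0) : homog (p : OnePoint Heis) 2 ≠ 0 := by
  intro h0
  rw [homog_coe] at h0
  have hre := congrArg Complex.re h0
  have him := congrArg Complex.im h0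
  simp at hre him
  exact h (Prod.ext (Complex.ext (by simp; nlinarith) (by simp; nlinarith)) (by simp; linarith))

theorem inversion_mulVec (p : OnePoint Heis) :
    ∃ c : ℂ, c ≠ 0 ∧ inversionMatrix.mulVec (homog p) = c • homog (inversion p) := by
  rw [inversionMatrix_mulVec]
  induction p using OnePoint.rec with
  | infty =>
    refine ⟨1, one_ne_zero, ?_⟩
    rw [inversion_infty, homog_coe, homog_infty]
    simp
  | coe p =>
    by_cases h : p = 0
    · refine ⟨-1, by simp, ?_⟩
      rw [h, inversion_zero, homog_coe, homog_infty]
      simp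
    · have hw := homog_two_ne_zero h
      refine ⟨homog p 2, hw, ?_⟩
      rw [inversion_coe h]
      have e1 : homog (p : OnePoint Heis) 2 =
          Complex.I * ((‖p.1‖ : ℂ) ^ 2 + 4 * Complex.I * (p.2 : ℂ)) := by
        show -4 * (p.2 : ℂ) + Complex.I * (‖p.1‖ : ℂ) ^ 2 = _
        linear_combination (-4 * (p.2 : ℂ)) * Complex.I_sq
      set D : ℂ := (‖p.1‖ : ℂ) ^ 2 + 4 * Complex.I * (p.2 : ℂ) with hD
      have hD0 : D ≠ 0 := fun h0 => hw (by rw [e1, h0, mul_zero])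
      have hDc : (starRingEnd ℂ) D = (‖p.1‖ : ℂ) ^ 2 - 4 * Complex.I * (p.2 : ℂ) := by
        rw [hD]; simp [map_ofNat]; ring
      have hDD : D * (starRingEnd ℂ) D = ((‖p.1‖ ^ 4 + 16 * p.2 ^ 2 : ℝ) : ℂ) := by
        rw [hDc, hD]
        push_cast
        linear_combination (-16 * (p.2 : ℂ) ^ 2) * Complex.I_sq
      have hDc0 : (starRingEnd ℂ) D ≠ 0 := by simpa using hD0
      have hzz : p.1 * (starRingEnd ℂ) p.1 = (‖p.1‖ : ℂ) ^ 2 := by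
        rw [Complex.mul_conj, Complex.normSq_eq_norm_sq]; push_cast; rfl
      rw [e1, homog_coe p, homog_coe (_, _)]
      funext i
      fin_cases i
      · simp
      · simp; field_simp
      · have hv : (((-p.2 / (‖p.1‖ ^ 4 + 16 * p.2 ^ 2) : ℝ)) : ℂ) =
            -p.2 / (D * (starRingEnd ℂ) D) := by
          rw [hDD]; push_cast; rfl
        simp only [hv, map_div₀]
        simp
        field_simp
        linear_combination -hDc - Complex.I ^ 2 * hzz - ((‖p.1‖ : ℂ) ^ 2) * Complex.I_sq

theorem inversion_inversion (p : OnePoint Heis) : inversion (inversion p) = p := by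
  obtain ⟨c, hc, h1⟩ := inversion_mulVec p
  obtain ⟨d, hd, h2⟩ := inversion_mulVec (inversion p)
  have h3 : inversionMatrix.mulVec (inversionMatrix.mulVec (homog p)) = -homog p := by
    rw [inversionMatrix_mulVec, inversionMatrix_mulVec]
    funext i
    fin_cases i
    · simp
    · simp [← mul_assoc]
    · simp
  rw [h1, Matrix.mulVec_smul, h2, smul_smul] at h3
  refine homog_injective_projective (c := -(c * d)⁻¹) ?_
  rw [neg_smul, ← smul_neg, ← h3, inv_smul_smul₀ (mul_ne_zero hc hd)]

/-- The inversion as a permutation. -/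
noncomputable def inversionPerm : Equiv.Perm (OnePoint Heis) :=
  Function.Involutive.toPerm inversion inversion_inversion

theorem inversionPerm_apply (p : OnePoint Heis) : inversionPerm p = inversion p := rfl

theorem inversionPerm_isInducedBy : IsInducedBy inversionPerm inversionMatrix := inversion_mulVec

theorem inversionPerm_mem : inversionPerm ∈ PU21 := by
  refine ⟨Matrix.GeneralLinearGroup.mkOfDetNeZero inversionMatrix ?_,
    preservesForm_inversionMatrix, inversionPerm_isInducedBy⟩
  simp [inversionMatrix, Matrix.det_fin_three]

/-- The left translation by `a`, extended by `∞ ↦ ∞`. -/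
noncomputable def translationPerm (a : Heis) : Equiv.Perm (OnePoint Heis) :=
  Equiv.optionCongr
    { toFun := gmul a
      invFun := gmul (ginv a)
      left_inv := fun p => Prod.ext (by simp [gmul, ginv]) (by simp [gmul, ginv]; ring)
      right_inv := fun p => Prod.ext (by simp [gmul, ginv]) (by simp [gmul, ginv]; ring) }

theorem translationPerm_coe (a p : Heis) :
    translationPerm a (p : OnePoint Heis) = (gmul a p : OnePoint Heis) := rfl

theorem translationPerm_infty (a : Heis) :
    translationPerm a OnePoint.infty = OnePoint.infty := rfl

theorem translationPerm_mem (a : Heis) : translationPerm a ∈ PU21 := by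
  refine ⟨Matrix.GeneralLinearGroup.mkOfDetNeZero (translationMatrix a) ?_,
    preservesForm_translationMatrix a, fun p => ⟨1, one_ne_zero, ?_⟩⟩
  · simp [translationMatrix, Matrix.det_fin_three]
  · rw [one_smul]
    show (translationMatrix a).mulVec (homog p) = _
    induction p using OnePoint.rec with
    | infty =>
      rw [translationPerm_infty, homog_infty]
      funext i
      fin_cases i <;> simp [translationMatrix, Matrix.mulVec, dotProduct, Fin.sum_univ_three]
    | coe p =>
      rw [translationPerm_coe, homog_coe, homog_coe]
      funext i
      fin_cases i
      · simp [translationMatrix, Matrix.mulVec, dotProduct, Fin.sum_univ_three]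
      · simp [translationMatrix, Matrix.mulVec, dotProduct, Fin.sum_univ_three, gmul]
      · apply Complex.ext
        · simp [translationMatrix, Matrix.mulVec, dotProduct, Fin.sum_univ_three, gmul]
          ring
        · simp [translationMatrix, Matrix.mulVec, dotProduct, Fin.sum_univ_three, gmul]
          ring

/-- Some Möbius transformation moves a given finite point to infinity. -/
theorem exists_mem_PU21_apply_eq_infty (q : Heis) :
    ∃ T ∈ PU21, T (q : OnePoint Heis) = OnePoint.infty := by
  refine ⟨inversionPerm * translationPerm (ginv q),
    PU21.mul_mem inversionPerm_mem (translationPerm_mem _), ?_⟩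
  rw [Equiv.Perm.mul_apply, translationPerm_coe]
  have : gmul (ginv q) q = 0 := Prod.ext (by simp [gmul, ginv]) (by simp [gmul, ginv]; ring)
  rw [this]
  exact inversion_zero

/-! ### Möbius images of Legendrian knots -/

namespace LegendrianKnot

variable (K : LegendrianKnot)

theorem isOpen_finite : IsOpen {t | K.toFun t ≠ OnePoint.infty} :=
  isOpen_compl_singleton.preimage K.continuous

/-- Near a parameter where the knot passes through infinity it is the inversion of a regular
Legendrian path in `ℋ`. -/
theorem eventually_eq_inversion {t : ℝ} (h : K.toFun t = OnePoint.infty) :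
    ∀ᶠ s in 𝓝 t, K.toFun s = inversion (coord (inversion (K.toFun s)) : OnePoint Heis) := by
  have hne : ∀ᶠ s in 𝓝 t, K.toFun s ≠ ((0 : Heis) : OnePoint Heis) :=
    K.continuous.continuousAt.eventually_ne (by rw [h]; exact OnePoint.infty_ne_coe 0)
  filter_upwards [hne] with s hs
  rw [coe_coord, inversion_inversion]
  intro h'
  apply hs
  rw [← inversion_inversion (K.toFun s), h', inversion_infty]

/-- The image of a knot under a Möbius transformation is regular and Legendrian where it is finite. -/
theorem isRegularLegendrianAt_apply {T : Equiv.Perm (OnePoint Heis)} (hT : T ∈ PU21) {t : ℝ}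
    (h : T (K.toFun t) ≠ OnePoint.infty) :
    IsRegularLegendrianAt (fun s => coord (T (K.toFun s))) t := by
  -- near `t` the path `T(K)` is the image of a regular Legendrian path of `ℋ` under a Möbius
  -- transformation `S`: `S = T` if `K` is finite at `t`, and `S = T ∘ ι` otherwise
  have key : ∀ {S : Equiv.Perm (OnePoint Heis)}, S ∈ PU21 → ∀ {g : ℝ → Heis},
      IsRegularLegendrianAt g t → (∀ᶠ s in 𝓝 t, T (K.toFun s) = S (g s)) →
      IsRegularLegendrianAt (fun s => coord (T (K.toFun s))) t := by
    rintro S ⟨A, hA, hS⟩ g hg he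
    have hl : lam A.val (g t) ≠ 0 := by
      rw [Ne, hS.lam_eq_zero_iff, ← he.self_of_nhds]
      exact h
    have h1 := (hS.isRegularLegendrianAt hA hg hl).1
    have he' : (fun s => coord (T (K.toFun s))) =ᶠ[𝓝 t] fun s => coord (S (g s)) :=
      he.mono fun s hs => congrArg coord hs
    refine ⟨h1.smooth.congr_of_eventuallyEq he', ?_, ?_⟩
    · rw [he'.deriv_eq]; exact h1.regular
    · have h2 := h1.legendrian
      rwa [← he'.deriv_eq, ← he.self_of_nhds] at h2
  by_cases ht : K.toFun t = OnePoint.infty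
  · refine key (PU21.mul_mem hT inversionPerm_mem) (K.regular_infty t ht) ?_
    filter_upwards [K.eventually_eq_inversion ht] with s hs
    rw [Equiv.Perm.mul_apply, inversionPerm_apply, ← hs]
  · refine key hT (K.regular_finite t ht) ?_
    filter_upwards [K.isOpen_finite.mem_nhds ht] with s hs
    rw [coe_coord hs]

theorem continuous_apply {T : Equiv.Perm (OnePoint Heis)} (hT : T ∈ PU21) :
    Continuous fun t => T (K.toFun t) := by
  rw [continuous_iff_continuousAt]
  intro t
  have key : ∀ {S : Equiv.Perm (OnePoint Heis)}, S ∈ PU21 → ∀ {g : ℝ → Heis},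
      IsRegularLegendrianAt g t → (∀ᶠ s in 𝓝 t, T (K.toFun s) = S (g s)) →
      ContinuousAt (fun t => T (K.toFun t)) t := by
    rintro S ⟨A, hA, hS⟩ g hg he
    exact ((hS.continuousAt_coe (g t)).comp hg.smooth.continuousAt).congr_of_eventuallyEq he
  by_cases ht : K.toFun t = OnePoint.infty
  · refine key (PU21.mul_mem hT inversionPerm_mem) (K.regular_infty t ht) ?_
    filter_upwards [K.eventually_eq_inversion ht] with s hs
    rw [Equiv.Perm.mul_apply, inversionPerm_apply, ← hs]
  · refine key hT (K.regular_finite t ht) ?_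
    filter_upwards [K.isOpen_finite.mem_nhds ht] with s hs
    rw [coe_coord hs]

/-- The image of a Legendrian knot under a Möbius transformation. -/
def mobiusImage {T : Equiv.Perm (OnePoint Heis)} (hT : T ∈ PU21) : LegendrianKnot where
  toFun t := T (K.toFun t)
  period := K.period
  period_pos := K.period_pos
  continuous := K.continuous_apply hT
  periodic t := congrArg T (K.periodic t)
  injOn := T.injective.comp_injOn K.injOn
  regular_finite _ h := K.isRegularLegendrianAt_apply hT h
  regular_infty t h := by
    refine K.isRegularLegendrianAt_apply (PU21.mul_mem inversionPerm_mem hT) ?_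
    rw [Equiv.Perm.mul_apply, h]
    exact OnePoint.coe_ne_infty 0

theorem carrier_mobiusImage {T : Equiv.Perm (OnePoint Heis)} (hT : T ∈ PU21) :
    (K.mobiusImage hT).carrier = T '' K.carrier :=
  Set.range_comp T K.toFun

/-- A knot does not fill `ℋ`, since its Hausdorff dimension is one. -/
theorem exists_notMem_carrier : ∃ q : Heis, (q : OnePoint Heis) ∉ K.carrier := by
  set U := {t | K.toFun t ≠ OnePoint.infty}
  have hdim : dimH ((fun t => coord (K.toFun t)) '' U) ≤ dimH U := by
    refine dimH_image_le_of_locally_lipschitzOn fun t ht => ?_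
    obtain ⟨C, N, hN, hC⟩ := ((K.regular_finite t ht).smooth.of_le
      (by exact_mod_cast le_top : (1 : WithTop ℕ∞) ≤ ((⊤ : ℕ∞) : WithTop ℕ∞))).exists_lipschitzOnWith
    exact ⟨C, N, nhdsWithin_le_nhds hN, hC⟩
  have hlt : dimH ((fun t => coord (K.toFun t)) '' U) < Module.finrank ℝ Heis := by
    refine (hdim.trans (dimH_mono (Set.subset_univ U))).trans_lt ?_
    rw [Real.dimH_univ, Module.finrank_prod, Complex.finrank_real_complex, Module.finrank_self]
    norm_num
  obtain ⟨q, hq⟩ := (dense_compl_of_dimH_lt_finrank hlt).nonempty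
  refine ⟨q, ?_⟩
  rintro ⟨t, ht⟩
  refine hq ⟨t, ?_, ?_⟩
  · show K.toFun t ≠ _
    rw [ht]; exact OnePoint.coe_ne_infty q
  · show coord (K.toFun t) = q
    rw [ht]; rfl

end LegendrianKnot

/-! ### The arc-length measure -/

/-- The arc-length measure of one period of a parametrized closed curve in `ℋ ∪ {∞}`. -/
noncomputable def arcMeasure (γ : ℝ → OnePoint Heis) (P : ℝ) : Measure Heis :=
  ((volume.restrict (Set.Ico 0 P ∩ {t | γ t ≠ OnePoint.infty})).withDensity
    (fun t => ENNReal.ofReal (hnorm (deriv (fun s => coord (γ s)) t)))).map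
      (fun t => coord (γ t))

theorem LegendrianKnot.arcLength_eq (K : LegendrianKnot) :
    K.arcLength = arcMeasure K.toFun K.period := rfl

theorem measurable_speed (γ : ℝ → Heis) :
    Measurable fun t => ENNReal.ofReal (hnorm (deriv γ t)) :=
  ((measurable_deriv γ).fst.norm).ennreal_ofReal

section ArcMeasure

variable {γ : ℝ → OnePoint Heis} {P : ℝ}

theorem measurableSet_finite_period (hγ : Continuous γ) :
    MeasurableSet (Set.Ico 0 P ∩ {t | γ t ≠ OnePoint.infty}) :=
  measurableSet_Ico.inter (isOpen_compl_singleton.preimage hγ).measurableSet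

theorem continuousOn_coord (hγ : Continuous γ)  :
    ContinuousOn (fun t => coord (γ t)) {t | γ t ≠ OnePoint.infty} := by
  intro t ht
  have h1 : ContinuousAt (fun t => ((coord (γ t) : Heis) : OnePoint Heis)) t := by
    refine hγ.continuousAt.congr ?_
    filter_upwards [(isOpen_compl_singleton.preimage hγ).mem_nhds ht] with s hs
    exact (coe_coord hs).symm
  exact ((OnePoint.isOpenEmbedding_coe.isInducing.continuousAt_iff).2 h1).continuousWithinAt

theorem aemeasurable_coord (hγ : Continuous γ) : AEMeasurable (fun t => coord (γ t))
    (volume.restrict (Set.Ico 0 P ∩ {t | γ t ≠ OnePoint.infty})) :=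
  ((continuousOn_coord hγ).mono Set.inter_subset_right).aemeasurable
    (measurableSet_finite_period hγ)

theorem lintegral_arcMeasure (hγ : Continuous γ) {f : Heis → ENNReal} (hf : Measurable f) :
    ∫⁻ p, f p ∂(arcMeasure γ P) = ∫⁻ t in Set.Ico 0 P ∩ {t | γ t ≠ OnePoint.infty},
      ENNReal.ofReal (hnorm (deriv (fun s => coord (γ s)) t)) * f (coord (γ t)) := by
  have h1 := aemeasurable_coord (P := P) hγ
  rw [arcMeasure, lintegral_map' hf.aemeasurable
    (h1.mono_ac (withDensity_absolutelyContinuous _ _))]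
  exact lintegral_withDensity_eq_lintegral_mul₀ (measurable_speed _).aemeasurable
    (hf.comp_aemeasurable h1)

end ArcMeasure

/-- A continuous solution `φ` of `f(φ(τ)) = h(τ)` is differentiable where `h` is and `f' ≠ 0`. -/
theorem hasDerivAt_of_comp_eq {f h φ : ℝ → ℝ} {t a b : ℝ} (hf : HasStrictDerivAt f a (φ t))
    (ha : a ≠ 0) (hh : HasDerivAt h b t) (hφ : ContinuousAt φ t)
    (he : ∀ᶠ s in 𝓝 t, f (φ s) = h s) : HasDerivAt φ (b / a) t := by
  have h1 : HasDerivAt (hf.localInverse f a (φ t) ha) a⁻¹ (h t) := by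
    rw [← he.self_of_nhds]
    exact (hf.to_localInverse ha).hasDerivAt
  have h2 := h1.comp t hh
  rw [div_eq_inv_mul]
  refine h2.congr_of_eventuallyEq ?_
  filter_upwards [he, hφ.eventually (hf.eventually_left_inverse ha)] with s hs1 hs2
  rw [Function.comp_apply, ← hs1, hs2]

namespace LegendrianKnot

variable (K : LegendrianKnot)

theorem exists_mem_Ico {p : OnePoint Heis} (h : p ∈ K.carrier) :
    ∃ t ∈ Set.Ico 0 K.period, K.toFun t = p := by
  obtain ⟨t, rfl⟩ := h
  obtain ⟨s, hs, he⟩ := K.periodic.exists_mem_Ico₀ K.period_pos t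
  exact ⟨s, hs, he.symm⟩

/-- The inverse of a parametrization of a knot is continuous away from the base point. -/
theorem continuousAt_of_toFun_comp_eq {γ : ℝ → OnePoint Heis} {φ : ℝ → ℝ} {t : ℝ}
    (hγ : ContinuousAt γ t) (hφ : ∀ s, φ s ∈ Set.Ico 0 K.period) (he : ∀ s, K.toFun (φ s) = γ s)
    (h0 : φ t ≠ 0) : ContinuousAt φ t := by
  rw [ContinuousAt, tendsto_order]
  have key : ∀ C : Set ℝ, IsCompact C → C ⊆ Set.Icc 0 K.period → φ t ∉ C →
      ∀ᶠ s in 𝓝 t, φ s ∉ C := by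
    intro C hC hsub hnot
    have hcl : IsClosed (K.toFun '' C) := (hC.image K.continuous).isClosed
    have hn : γ t ∉ K.toFun '' C := by
      rintro ⟨s, hs, hs'⟩
      rw [← he t] at hs'
      rcases (hsub hs).2.lt_or_eq with h | h
      · exact hnot (K.injOn ⟨(hsub hs).1, h⟩ (hφ t) hs' ▸ hs)
      · have hz : K.toFun 0 = K.toFun (φ t) := by
          rw [← hs', h]
          simpa using (K.periodic 0).symm
        exact h0 (K.injOn ⟨le_rfl, K.period_pos⟩ (hφ t) hz).symm
    filter_upwards [hγ.eventually (hcl.isOpen_compl.mem_nhds hn)] with s hs hsC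
    exact hs ⟨φ s, hsC, he s⟩
  constructor
  · intro a ha
    filter_upwards [key (Set.Icc 0 (min a K.period)) isCompact_Icc
      (Set.Icc_subset_Icc_right (min_le_right _ _))
      (fun h => absurd (h.2.trans (min_le_left _ _)) (not_le.2 ha))] with s hs
    by_contra hle
    exact hs ⟨(hφ s).1, le_min (not_lt.1 hle) (hφ s).2.le⟩
  · intro a ha
    filter_upwards [key (Set.Icc (max a 0) K.period) isCompact_Icc
      (Set.Icc_subset_Icc_left (le_max_right _ _))
      (fun h => absurd ((le_max_left _ _).trans h.1) (not_le.2 ha))] with s hs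
    by_contra hle
    exact hs ⟨max_le (not_lt.1 hle) (hφ s).1, (hφ s).2.le⟩

/-- The arc-length measure does not depend on the parametrization. -/
theorem arcLength_eq_arcMeasure {γ : ℝ → OnePoint Heis} {P : ℝ} (hP : 0 < P) (hγ : Continuous γ)
    (hper : Function.Periodic γ P) (hinj : Set.InjOn γ (Set.Ico 0 P))
    (hrange : Set.range γ = K.carrier)
    (hdiff : ∀ t, γ t ≠ OnePoint.infty → DifferentiableAt ℝ (fun s => coord (γ s)) t) :
    K.arcLength = arcMeasure γ P := by
  have hex : ∀ t, ∃ t' ∈ Set.Ico 0 K.period, K.toFun t' = γ t := fun t =>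
    K.exists_mem_Ico (hrange ▸ Set.mem_range_self t)
  -- the change of parameter; it may jump where it takes the value `0`, that is on `N`
  choose φ hφ he using hex
  set U := Set.Ico 0 P ∩ {t | γ t ≠ OnePoint.infty} with hU
  set V := Set.Ico 0 K.period ∩ {t | K.toFun t ≠ OnePoint.infty} with hV
  have hUm : MeasurableSet U := measurableSet_finite_period hγ
  have hinjφ : Set.InjOn φ U := fun s hs t ht hst =>
    hinj hs.1 ht.1 (by rw [← he s, ← he t, hst])
  set N := {t | t ∈ U ∧ φ t = 0} with hN
  have hNs : N.Subsingleton := fun s hs t ht => hinjφ hs.1 ht.1 (hs.2.trans ht.2.symm)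
  have himage : φ '' (U \ N) = V \ {0} := by
    ext t'
    constructor
    · rintro ⟨t, ⟨ht, htN⟩, rfl⟩
      refine ⟨⟨hφ t, ?_⟩, fun h => htN ⟨ht, h⟩⟩
      show K.toFun (φ t) ≠ _
      rw [he]; exact ht.2
    · rintro ⟨⟨ht1, ht2⟩, ht3⟩
      have hmem : K.toFun t' ∈ Set.range γ := by rw [hrange]; exact Set.mem_range_self t'
      obtain ⟨t0, ht0⟩ := hmem
      obtain ⟨t, ht, htt⟩ := hper.exists_mem_Ico₀ hP t0
      have h1 : γ t = K.toFun t' := by rw [← htt, ht0]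
      have h2 : φ t = t' := K.injOn (hφ t) ht1 (by rw [he, h1])
      refine ⟨t, ⟨⟨ht, ?_⟩, fun h => ht3 (h2 ▸ h.2)⟩, h2⟩
      show γ t ≠ _
      rw [h1]; exact ht2
  have hderiv : ∀ t ∈ U \ N, ∃ d : ℝ, HasDerivAt φ d t ∧
      |d| * hnorm (deriv (fun s => coord (K.toFun s)) (φ t)) =
        hnorm (deriv (fun s => coord (γ s)) t) := by
    rintro t ⟨ht, htN⟩
    have hcont : ContinuousAt φ t := K.continuousAt_of_toFun_comp_eq hγ.continuousAt hφ he
      fun h => htN ⟨ht, h⟩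
    have hfin : K.toFun (φ t) ≠ OnePoint.infty := by rw [he]; exact ht.2
    have hreg := K.regular_finite _ hfin
    set w := deriv (fun s => coord (K.toFun s)) (φ t) with hw
    set v := deriv (fun s => coord (γ s)) t with hv
    have hwd : HasStrictDerivAt (fun s => coord (K.toFun s)) w (φ t) :=
      hreg.smooth.hasStrictDerivAt (by simp)
    have hvd : HasDerivAt (fun s => coord (γ s)) v t := (hdiff t ht.2).hasDerivAt
    have hce : ∀ s, coord (K.toFun (φ s)) = coord (γ s) := fun s => by rw [he]
    -- one of the two horizontal coordinates is a local parameter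
    obtain ⟨l, hl⟩ : ∃ l : Heis →L[ℝ] ℝ, l w ≠ 0 := by
      have hw1 : w.1 ≠ 0 := fun h => hreg.hnorm_ne_zero (norm_eq_zero.2 h)
      by_cases hre : w.1.re = 0
      · refine ⟨Complex.imCLM.comp (ContinuousLinearMap.fst ℝ ℂ ℝ), fun him => ?_⟩
        exact hw1 (Complex.ext hre him)
      · exact ⟨Complex.reCLM.comp (ContinuousLinearMap.fst ℝ ℂ ℝ), hre⟩
    have hφd : HasDerivAt φ (l v / l w) t :=
      hasDerivAt_of_comp_eq (l.hasStrictFDerivAt.comp_hasStrictDerivAt _ hwd) hl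
        (l.hasFDerivAt.comp_hasDerivAt t hvd) hcont (.of_forall fun s => congrArg l (hce s))
    refine ⟨_, hφd, ?_⟩
    have h1 : HasDerivAt (fun s => coord (γ s)) ((l v / l w) • w) t := by
      have := hwd.hasDerivAt.scomp t hφd
      exact this.congr_of_eventuallyEq (.of_forall fun s => (hce s).symm)
    have hv1 : v.1 = (l v / l w) • w.1 := congrArg Prod.fst (hvd.unique h1)
    rw [hnorm, hnorm, hv1, norm_smul, Real.norm_eq_abs]
  choose! d hd hdn using hderiv
  have hae : ∀ {S : Set ℝ} {M : Set ℝ}, M.Subsingleton → (S \ M : Set ℝ) =ᵐ[volume] S :=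
    fun hM => sdiff_null_ae_eq_self (hM.measure_zero _)
  refine Measure.ext_of_lintegral _ fun f hf => ?_
  rw [arcLength_eq, lintegral_arcMeasure K.continuous hf, lintegral_arcMeasure hγ hf, ← hU, ← hV,
    ← setLIntegral_congr (hae (S := V) Set.subsingleton_singleton), ← himage,
    lintegral_image_eq_lintegral_abs_deriv_mul (hUm.diff hNs.measurableSet)
      (fun t ht => (hd t ht).hasDerivWithinAt) (hinjφ.mono Set.sdiff_subset),
    ← setLIntegral_congr (hae (S := U) hNs)]
  refine setLIntegral_congr_fun (hUm.diff hNs.measurableSet) fun t ht => ?_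
  rw [← mul_assoc, ← ENNReal.ofReal_mul (abs_nonneg _), hdn t ht, he]

end LegendrianKnot

/-- Integrals over the arc-length measure, in the parameter. As the parametrization is a measurable
embedding, the integrand need not be measurable. -/
theorem integral_arcMeasure {γ : ℝ → OnePoint Heis} {P : ℝ} (hγ : Continuous γ)
    (hinj : Set.InjOn γ (Set.Ico 0 P)) (f : Heis → ℝ) :
    (Integrable f (arcMeasure γ P) ↔
      IntegrableOn (fun t => hnorm (deriv (fun s => coord (γ s)) t) * f (coord (γ t)))
        (Set.Ico 0 P ∩ {t | γ t ≠ OnePoint.infty})) ∧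
    ∫ p, f p ∂(arcMeasure γ P) = ∫ t in Set.Ico 0 P ∩ {t | γ t ≠ OnePoint.infty},
      hnorm (deriv (fun s => coord (γ s)) t) * f (coord (γ t)) := by
  set U := Set.Ico 0 P ∩ {t | γ t ≠ OnePoint.infty} with hU
  have hUm : MeasurableSet U := measurableSet_finite_period hγ
  set ν := (volume.restrict U).withDensity
    (fun t => ENNReal.ofReal (hnorm (deriv (fun s => coord (γ s)) t))) with hν
  have hemb : MeasurableEmbedding (U.domRestrict fun t => coord (γ t)) := by
    refine ContinuousOn.measurableEmbedding hUm
      ((continuousOn_coord hγ).mono Set.inter_subset_right) fun s hs t ht hst => ?_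
    refine hinj hs.1 ht.1 ?_
    rw [← coe_coord hs.2, ← coe_coord ht.2]
    exact congrArg _ hst
  have hνU : ν.restrict U = ν := by
    rw [hν, restrict_withDensity hUm, Measure.restrict_restrict hUm, Set.inter_self]
  have hmeas : arcMeasure γ P =
      (ν.comap ((↑) : U → ℝ)).map (U.domRestrict fun t => coord (γ t)) := by
    have h1 : AEMeasurable (fun t => coord (γ t)) ν :=
      (aemeasurable_coord hγ).mono_ac (withDensity_absolutelyContinuous _ _)
    have h2 : (ν.comap ((↑) : U → ℝ)).map ((↑) : U → ℝ) = ν := by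
      rw [map_comap_subtype_coe hUm, hνU]
    have h3 : arcMeasure γ P = ν.map fun t => coord (γ t) := rfl
    have h4 := AEMeasurable.map_map_of_aemeasurable (μ := ν.comap ((↑) : U → ℝ))
      (by rwa [h2]) measurable_subtype_coe.aemeasurable
    rw [h2] at h4
    rw [h3, h4]
    rfl
  have hsp : ∀ t, (ENNReal.ofReal (hnorm (deriv (fun s => coord (γ s)) t))).toReal =
      hnorm (deriv (fun s => coord (γ s)) t) := fun t =>
    ENNReal.toReal_ofReal (norm_nonneg _)
  have hlt : ∀ᵐ t ∂(volume.restrict U),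
      ENNReal.ofReal (hnorm (deriv (fun s => coord (γ s)) t)) < ⊤ :=
    .of_forall fun t => ENNReal.ofReal_lt_top
  constructor
  · rw [hmeas, hemb.integrable_map_iff]
    have h1 : Integrable (f ∘ U.domRestrict fun t => coord (γ t)) (ν.comap ((↑) : U → ℝ)) ↔
        IntegrableOn (fun t => f (coord (γ t))) U ν :=
      (integrableOn_iff_comap_subtypeVal (f := fun t => f (coord (γ t))) hUm).symm
    rw [h1, IntegrableOn, hνU, hν, integrable_withDensity_iff_integrable_smul'
      (measurable_speed _) hlt]
    simp only [hsp, smul_eq_mul]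
    rfl
  · rw [hmeas, hemb.integral_map]
    have h1 := integral_subtype_comap (μ := ν) hUm fun t => f (coord (γ t))
    rw [hνU] at h1
    refine h1.trans ?_
    rw [hν, integral_withDensity_eq_integral_toReal_smul (measurable_speed _) hlt]
    simp only [hsp, smul_eq_mul]

/-! ### Knots as Möbius images of unit speed loops -/

namespace LegendrianKnot

variable (K : LegendrianKnot)

/-- A finite knot has a parametrization by arc length. -/
theorem IsFinite.exists_unitSpeedLoop {K : LegendrianKnot} (hK : K.IsFinite) :
    ∃ c : UnitSpeedLoop, Set.range (fun s => (c.toFun s : OnePoint Heis)) = K.carrier := by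
  have hfin : ∀ t, K.toFun t ≠ OnePoint.infty := fun t h => hK ⟨t, h⟩
  set γ : ℝ → Heis := fun t => coord (K.toFun t) with hγ
  have hreg : ∀ t, IsRegularLegendrianAt γ t := fun t => K.regular_finite t (hfin t)
  have hcoe : ∀ t, (γ t : OnePoint Heis) = K.toFun t := fun t => coe_coord (hfin t)
  have hsm : ContDiff ℝ ((⊤ : ℕ∞) : WithTop ℕ∞) γ :=
    contDiff_iff_contDiffAt.2 fun t => (hreg t).smooth
  have hγd : ∀ t, HasDerivAt γ (deriv γ t) t := fun t =>
    ((hsm.differentiable (by simp)) t).hasDerivAt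
  have hγp : Function.Periodic γ K.period := fun t => congrArg coord (K.periodic t)
  set g : ℝ → ℝ := fun t => hnorm (deriv γ t) with hg
  have hgpos : ∀ t, 0 < g t := fun t => (norm_nonneg _).lt_of_ne' (hreg t).hnorm_ne_zero
  have hgs : ContDiff ℝ ((⊤ : ℕ∞) : WithTop ℕ∞) g :=
    (contDiff_infty_iff_deriv.1 hsm).2.fst.norm ℝ fun t h =>
      (hreg t).hnorm_ne_zero (norm_eq_zero.2 h)
  have hgp : Function.Periodic g K.period := by
    intro t
    have : deriv γ (t + K.period) = deriv γ t := by
      rw [← deriv_comp_add_const]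
      exact congrArg (fun f => deriv f t) (funext hγp)
    rw [hg]
    exact congrArg hnorm this
  have hgi : ∀ a b, IntervalIntegrable g volume a b := fun a b =>
    hgs.continuous.intervalIntegrable a b
  -- the arc length from the base point, a diffeomorphism of `ℝ`
  set S : ℝ → ℝ := fun t => ∫ x in (0 : ℝ)..t, g x with hS
  have hSd : ∀ t, HasDerivAt S (g t) t := fun t =>
    (hgs.continuous.integral_hasStrictDerivAt 0 t).hasDerivAt
  have hSs : ContDiff ℝ ((⊤ : ℕ∞) : WithTop ℕ∞) S := by
    rw [contDiff_infty_iff_deriv]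
    refine ⟨fun t => (hSd t).differentiableAt, ?_⟩
    rwa [funext fun t => (hSd t).deriv]
  have hSm : StrictMono S := strictMono_of_deriv_pos fun t => by rw [(hSd t).deriv]; exact hgpos t
  have hS0 : S 0 = 0 := intervalIntegral.integral_same
  set l := S K.period with hl
  have hlpos : 0 < l := by rw [← hS0]; exact hSm K.period_pos
  have hSper : ∀ t, S (t + K.period) = S t + l := by
    intro t
    have h1 := intervalIntegral.integral_add_adjacent_intervals (hgi 0 t) (hgi t (t + K.period))
    rw [hgp.intervalIntegral_add_eq t 0, zero_add] at h1
    exact h1.symm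
  have hSn : ∀ n : ℕ, S (n * K.period) = n * l ∧ S (-(n * K.period)) = -(n * l) := by
    intro n
    induction n with
    | zero => simp [hS0]
    | succ n ih =>
      constructor
      · have := hSper (n * K.period)
        rw [ih.1] at this
        push_cast
        rw [add_mul, one_mul, this]; ring
      · have := hSper (-((n + 1 : ℕ) * K.period))
        have e : -(((n + 1 : ℕ) : ℝ) * K.period) + K.period = -(n * K.period) := by
          push_cast; ring
        rw [e, ih.2] at this
        push_cast at this ⊢
        linarith
  have hsurj : Function.Surjective S := by
    intro y
    obtain ⟨n, hn⟩ := exists_nat_ge (|y| / l)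
    rw [div_le_iff₀ hlpos] at hn
    refine mem_range_of_exists_le_of_exists_ge hSs.continuous
      ⟨-(n * K.period), ?_⟩ ⟨n * K.period, ?_⟩
    · rw [(hSn n).2]; linarith [neg_abs_le y]
    · rw [(hSn n).1]; linarith [le_abs_self y]
  set e := (hSm.orderIsoOfSurjective S hsurj).toHomeomorph with he
  set σ : ℝ → ℝ := fun s => e.symm s with hσ
  have hSσ : ∀ s, S (σ s) = s := fun s => e.apply_symm_apply s
  have hσS : ∀ t, σ (S t) = t := fun t => e.symm_apply_apply t
  have hσs : ContDiff ℝ ((⊤ : ℕ∞) : WithTop ℕ∞) σ :=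
    e.contDiff_symm_deriv (fun t => (hgpos t).ne') hSd hSs
  have hσd : ∀ s, HasDerivAt σ (g (σ s))⁻¹ s := fun s =>
    HasDerivAt.of_local_left_inverse hσs.continuous.continuousAt (hSd _) (hgpos _).ne'
      (.of_forall hSσ)
  have hσmem : ∀ s ∈ Set.Ico 0 l, σ s ∈ Set.Ico 0 K.period := by
    intro s hs
    constructor
    · rw [← hSm.le_iff_le, hS0, hSσ]; exact hs.1
    · rw [← hSm.lt_iff_lt, hSσ]; exact hs.2
  have hcd : ∀ s, deriv (fun s => γ (σ s)) s = (g (σ s))⁻¹ • deriv γ (σ s) := fun s =>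
    ((hγd (σ s)).scomp s (hσd s)).deriv
  refine ⟨⟨fun s => γ (σ s), l, hlpos, hsm.comp hσs, fun s => ?_, fun s hs t ht hst => ?_,
    fun s => ?_, fun s => ?_⟩, ?_⟩
  · have : σ (s + l) = σ s + K.period := by
      rw [← hσS (σ s + K.period), hSper, hSσ]
    beta_reduce
    rw [this, hγp]
  · have h1 : K.toFun (σ s) = K.toFun (σ t) := by
      rw [← hcoe, ← hcoe]; exact congrArg _ hst
    have h2 := K.injOn (hσmem s hs) (hσmem t ht) h1
    rw [← hSσ s, ← hSσ t, h2]
  · rw [hcd, Prod.smul_fst, norm_smul, Real.norm_eq_abs, abs_of_pos (inv_pos.2 (hgpos _))]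
    exact inv_mul_cancel₀ (hgpos _).ne'
  · have h := (hreg (σ s)).legendrian
    rw [hcd]
    simp only [contactForm, Prod.smul_fst, Prod.smul_snd, Complex.smul_re, Complex.smul_im,
      smul_eq_mul] at h ⊢
    linear_combination (g (σ s))⁻¹ * h
  · ext p
    constructor
    · rintro ⟨s, rfl⟩
      exact ⟨σ s, (hcoe _).symm⟩
    · rintro ⟨t, rfl⟩
      refine ⟨S t, ?_⟩
      simp only [hσS, hcoe]

end LegendrianKnot

/-- `K` is the image of the loop `c` under the Möbius transformation `T` with the matrix `A`. -/
structure IsMobiusImage (K : LegendrianKnot) (c : UnitSpeedLoop) (T : Equiv.Perm (OnePoint Heis))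
    (A : GL (Fin 3) ℂ) : Prop where
  preserves : PreservesForm A.val
  induced : IsInducedBy T A.val
  carrier_eq : K.carrier = Set.range fun s => T (c.toFun s : OnePoint Heis)

theorem LegendrianKnot.IsFinite.exists_isMobiusImage_one {K : LegendrianKnot} (hK : K.IsFinite) :
    ∃ c, IsMobiusImage K c 1 1 := by
  obtain ⟨c, hc⟩ := hK.exists_unitSpeedLoop
  refine ⟨c, by simp [PreservesForm], fun p => ⟨1, one_ne_zero, by simp⟩, hc.symm⟩

/-- Every knot is the image of a closed curve in `ℋ`: a point off the knot is moved to `∞`. -/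
theorem LegendrianKnot.exists_isMobiusImage (K : LegendrianKnot) :
    ∃ c T A, IsMobiusImage K c T A := by
  obtain ⟨q, hq⟩ := K.exists_notMem_carrier
  obtain ⟨T, hT, hTq⟩ := exists_mem_PU21_apply_eq_infty q
  have hfin : (K.mobiusImage hT).IsFinite := by
    rintro h
    rw [K.carrier_mobiusImage hT] at h
    obtain ⟨p, hp, hpT⟩ := h
    rw [← hTq] at hpT
    exact hq (T.injective hpT ▸ hp)
  obtain ⟨c, hc⟩ := hfin.exists_unitSpeedLoop
  obtain ⟨A, hA, hTA⟩ := PU21.inv_mem hT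
  refine ⟨c, T⁻¹, A, hA, hTA, ?_⟩
  rw [K.carrier_mobiusImage hT] at hc
  have : (Set.range fun s => T⁻¹ (c.toFun s : OnePoint Heis)) =
      ⇑T⁻¹ '' Set.range fun s => (c.toFun s : OnePoint Heis) := Set.range_comp _ _
  rw [this, hc, Set.image_image]
  simp

theorem IsMobiusImage.comp {K K' : LegendrianKnot} {c : UnitSpeedLoop}
    {T S : Equiv.Perm (OnePoint Heis)} {A B : GL (Fin 3) ℂ} (h : IsMobiusImage K c T A)
    (hB : PreservesForm B.val) (hS : IsInducedBy S B.val) (hK' : K'.carrier = S '' K.carrier) :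
    IsMobiusImage K' c (S * T) (B * A) := by
  refine ⟨?_, fun p => ?_, ?_⟩
  · unfold PreservesForm
    calc (B * A).val.transpose * formD * (B * A).val.map (starRingEnd ℂ)
        = A.val.transpose * (B.val.transpose * formD * B.val.map (starRingEnd ℂ))
            * A.val.map (starRingEnd ℂ) := by
          simp [Matrix.transpose_mul, Matrix.map_mul, Matrix.mul_assoc]
      _ = formD := by rw [hB, h.preserves]
  · obtain ⟨b, hb, hbp⟩ := h.induced p
    obtain ⟨a, ha, hap⟩ := hS (T p)
    refine ⟨b * a, mul_ne_zero hb ha, ?_⟩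
    rw [Units.val_mul, ← Matrix.mulVec_mulVec, hbp, Matrix.mulVec_smul, hap, smul_smul]
    rfl
  · rw [hK', h.carrier_eq, ← Set.range_comp]
    rfl

section

variable {K : LegendrianKnot} {c : UnitSpeedLoop} {T : Equiv.Perm (OnePoint Heis)}
  {A : GL (Fin 3) ℂ}

theorem UnitSpeedLoop.isRegularLegendrianAt (c : UnitSpeedLoop) (s : ℝ) :
    IsRegularLegendrianAt c.toFun s := by
  refine ⟨c.smooth.contDiffAt, fun h => ?_, c.legendrian s⟩
  have := c.unit_speed s
  rw [h] at this
  simp at this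

theorem IsMobiusImage.continuous (h : IsMobiusImage K c T A) :
    Continuous fun s => T (c.toFun s : OnePoint Heis) := by
  rw [continuous_iff_continuousAt]
  exact fun s => (h.induced.continuousAt_coe (c.toFun s)).comp c.smooth.continuous.continuousAt

theorem IsMobiusImage.injOn (_ : IsMobiusImage K c T A) :
    Set.InjOn (fun s => T (c.toFun s : OnePoint Heis)) (Set.Ico 0 c.length) := fun _ hs _ ht hst =>
  c.injOn hs ht (OnePoint.coe_injective (T.injective hst))

theorem IsMobiusImage.arcLength_eq (h : IsMobiusImage K c T A) :
    K.arcLength = arcMeasure (fun s => T (c.toFun s : OnePoint Heis)) c.length := by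
  refine K.arcLength_eq_arcMeasure c.length_pos h.continuous (fun s => ?_) h.injOn
    h.carrier_eq.symm fun s hs => ?_
  · show T _ = T _
    rw [c.periodic s]
  · exact (h.induced.isRegularLegendrianAt h.preserves (c.isRegularLegendrianAt s)
      (by rwa [Ne, h.induced.lam_eq_zero_iff])).1.smooth.differentiableAt (by simp)

/-- Integration over the knot `T(c)` in the arc-length parameter of `c`: one period can be used,
since at most one parameter is mapped to `∞`. -/
theorem IsMobiusImage.integral_arcLength (h : IsMobiusImage K c T A) (f : Heis → ℝ) :
    (Integrable f K.arcLength ↔ IntegrableOn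
      (fun s => ‖lam A.val (c.toFun s)‖⁻¹ * f (coord (T (c.toFun s)))) (Set.Ico 0 c.length)) ∧
    ∫ p, f p ∂K.arcLength = ∫ s in Set.Ico 0 c.length,
      ‖lam A.val (c.toFun s)‖⁻¹ * f (coord (T (c.toFun s))) := by
  obtain ⟨h1, h2⟩ := integral_arcMeasure h.continuous h.injOn f
  rw [h.arcLength_eq, h1, h2]
  set U := Set.Ico 0 c.length ∩ {t | T (c.toFun t : OnePoint Heis) ≠ OnePoint.infty} with hU
  have hUm : MeasurableSet U := measurableSet_finite_period h.continuous
  have hae : U =ᵐ[volume] Set.Ico 0 c.length := by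
    have hsub : (Set.Ico 0 c.length ∩
        {t | T (c.toFun t : OnePoint Heis) = OnePoint.infty}).Subsingleton :=
      fun s hs t ht => h.injOn hs.1 ht.1 (hs.2.trans ht.2.symm)
    have : U = Set.Ico 0 c.length \ (Set.Ico 0 c.length ∩
        {t | T (c.toFun t : OnePoint Heis) = OnePoint.infty}) := by
      ext s
      simp only [hU, Set.mem_inter_iff, Set.mem_sdiff, Set.mem_ofPred_eq, not_and]
      tauto
    rw [this]
    exact sdiff_null_ae_eq_self (hsub.measure_zero _)
  have hcongr : Set.EqOn
      (fun t => hnorm (deriv (fun s => coord (T (c.toFun s))) t) * f (coord (T (c.toFun t))))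
      (fun s => ‖lam A.val (c.toFun s)‖⁻¹ * f (coord (T (c.toFun s)))) U := by
    intro s hs
    have hl : lam A.val (c.toFun s) ≠ 0 := by
      rw [Ne, h.induced.lam_eq_zero_iff]; exact hs.2
    have h3 := (h.induced.isRegularLegendrianAt h.preserves (c.isRegularLegendrianAt s) hl).2
    rw [show hnorm (deriv c.toFun s) = 1 from c.unit_speed s] at h3
    beta_reduce
    rw [eq_inv_of_mul_eq_one_right h3.symm]
  constructor
  · rw [integrableOn_congr_fun hcongr hUm, integrableOn_congr_set_ae hae]
  · rw [setIntegral_congr_fun hUm hcongr, setIntegral_congr_set hae]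

end

/-! ### The potential of a unit speed loop and of its Möbius images -/

/-- An integral over a period, centered at `s₀` and folded. -/
theorem integral_period_fold {E : Type*} [NormedAddCommGroup E] [NormedSpace ℝ E] {G : ℝ → E}
    {l : ℝ} (hl : 0 < l) (hG : Function.Periodic G l) (s₀ : ℝ)
    (h1 : IntegrableOn (fun t => G (s₀ + t)) (Set.Ioc 0 (l / 2)))
    (h2 : IntegrableOn (fun t => G (s₀ - t)) (Set.Ioc 0 (l / 2))) :
    IntegrableOn G (Set.Ico 0 l) ∧ ∫ s in Set.Ico 0 l, G s =
      (∫ t in Set.Ioc 0 (l / 2), G (s₀ + t)) + ∫ t in Set.Ioc 0 (l / 2), G (s₀ - t) := by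
  have hl2 : (0 : ℝ) ≤ l / 2 := by linarith
  have i1 : IntervalIntegrable (fun t => G (s₀ + t)) volume 0 (l / 2) :=
    (intervalIntegrable_iff_integrableOn_Ioc_of_le hl2).2 h1
  have i2 : IntervalIntegrable (fun t => G (s₀ - t)) volume 0 (l / 2) :=
    (intervalIntegrable_iff_integrableOn_Ioc_of_le hl2).2 h2
  have j1 : IntervalIntegrable G volume s₀ (s₀ + l / 2) := by
    simpa [add_comm] using i1.comp_sub_right s₀
  have j2 : IntervalIntegrable G volume (s₀ - l / 2) s₀ := by
    simpa using (i2.comp_sub_left s₀).symm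
  have j : IntervalIntegrable G volume (s₀ - l / 2) (s₀ - l / 2 + l) := by
    have := j2.trans j1
    rwa [show s₀ - l / 2 + l = s₀ + l / 2 by ring]
  have j0 : IntervalIntegrable G volume 0 l := hG.intervalIntegrable hl.ne' j 0 l
  refine ⟨?_, ?_⟩
  · rw [integrableOn_Ico_iff_integrableOn_Ioo, ← integrableOn_Ioc_iff_integrableOn_Ioo]
    exact (intervalIntegrable_iff_integrableOn_Ioc_of_le hl.le).1 j0
  · rw [integral_Ico_eq_integral_Ioo, ← integral_Ioc_eq_integral_Ioo,
      ← intervalIntegral.integral_of_le hl.le, ← intervalIntegral.integral_of_le hl2,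
      ← intervalIntegral.integral_of_le hl2, intervalIntegral.integral_comp_add_left,
      intervalIntegral.integral_comp_sub_left, add_zero, sub_zero, add_comm,
      intervalIntegral.integral_add_adjacent_intervals j2 j1]
    have := hG.intervalIntegral_add_eq 0 (s₀ - l / 2)
    rw [zero_add, show s₀ - l / 2 + l = s₀ + l / 2 by ring] at this
    exact this

/-- The product of a function `q = 1 + a t + o(t)` and `1/t + O(t)` is `1/t + a + o(1)`. -/
theorem tendsto_mul_inv_sub_inv {q k : ℝ → ℝ} {a : ℝ} (hq : HasDerivAt q a 0) (h1 : q 0 = 1)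
    (hk : Continuous k) :
    Tendsto (fun t => q t * (t⁻¹ + t * k t) - t⁻¹) (𝓝[>] 0) (𝓝 a) := by
  have hs : Tendsto (slope q 0) (𝓝[>] 0) (𝓝 a) :=
    hq.tendsto_slope.mono_left (nhdsWithin_mono _ fun t ht => (Set.mem_Ioi.1 ht).ne')
  have hc : Tendsto (fun t => q t * (t * k t)) (𝓝[>] 0) (𝓝 (q 0 * (0 * k 0))) :=
    (hq.continuousAt.mul (continuousAt_id.mul hk.continuousAt)).tendsto.mono_left
      nhdsWithin_le_nhds
  have := hs.add hc
  rw [zero_mul, mul_zero, add_zero] at this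
  refine this.congr fun t => ?_
  rw [slope_def_field, h1, sub_zero]
  ring

namespace UnitSpeedLoop

variable (c : UnitSpeedLoop)

/-- The remainder `P(s, t, ζ)` in `d(c(s), c(s + t))^ζ = |t|^ζ (1 + t² P(s, t, ζ))`, as a function
of `((ζ, t), s)`. -/
noncomputable def remainder : (ℂ × ℝ) × ℝ → ℂ := Classical.choose c.exists_kdist_cpow

theorem contDiff_remainder : ContDiff ℝ ((⊤ : ℕ∞) : WithTop ℕ∞) c.remainder :=
  (Classical.choose_spec c.exists_kdist_cpow).1

theorem differentiable_remainder (t s : ℝ) :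
    Differentiable ℂ fun ζ => c.remainder ((ζ, t), s) :=
  (Classical.choose_spec c.exists_kdist_cpow).2.1 t s

theorem kdist_cpow {s t : ℝ} (ζ : ℂ) (h0 : t ≠ 0) (h1 : |t| ≤ c.length / 2) :
    (kdist (c.toFun s) (c.toFun (s + t)) : ℂ) ^ ζ =
      ((|t| : ℝ) : ℂ) ^ ζ * (1 + (t : ℂ) ^ 2 * c.remainder ((ζ, t), s)) :=
  (Classical.choose_spec c.exists_kdist_cpow).2.2 s t ζ h0 h1

theorem inv_kdist {s t : ℝ} (h0 : t ≠ 0) (h1 : |t| ≤ c.length / 2) :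
    (kdist (c.toFun s) (c.toFun (s + t)))⁻¹ =
      |t|⁻¹ + |t| * (c.remainder ((-1, t), s)).re := by
  have h := c.kdist_cpow (s := s) (-1) h0 h1
  rw [Complex.cpow_neg_one, Complex.cpow_neg_one, ← Complex.ofReal_inv, ← Complex.ofReal_inv] at h
  have hre := congrArg Complex.re h
  rw [Complex.ofReal_re, Complex.re_ofReal_mul, Complex.add_re, Complex.one_re,
    ← Complex.ofReal_pow, Complex.re_ofReal_mul, ← sq_abs t] at hre
  have h2 : |t| ≠ 0 := abs_ne_zero.2 h0
  rw [hre]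
  field_simp

theorem inv_kdist_sq_ofReal {s t : ℝ} (h0 : t ≠ 0) (h1 : |t| ≤ c.length / 2) :
    (((kdist (c.toFun s) (c.toFun (s + t)) ^ 2)⁻¹ : ℝ) : ℂ) =
      ((t ^ 2)⁻¹ : ℝ) + c.remainder ((-2, t), s) := by
  have h := c.kdist_cpow (s := s) (-2) h0 h1
  have h2 : (t : ℂ) ≠ 0 := Complex.ofReal_ne_zero.2 h0
  rw [Complex.cpow_neg, Complex.cpow_neg, Complex.cpow_ofNat, Complex.cpow_ofNat,
    ← Complex.ofReal_pow, ← Complex.ofReal_pow, sq_abs] at h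
  rw [Complex.ofReal_inv, h]
  push_cast
  field_simp

theorem inv_kdist_sq {s t : ℝ} (h0 : t ≠ 0) (h1 : |t| ≤ c.length / 2) :
    (kdist (c.toFun s) (c.toFun (s + t)) ^ 2)⁻¹ =
      (t ^ 2)⁻¹ + (c.remainder ((-2, t), s)).re := by
  have hre := congrArg Complex.re (c.inv_kdist_sq_ofReal (s := s) h0 h1)
  rwa [Complex.add_re, Complex.ofReal_re, Complex.ofReal_re] at hre

/-- The potential of the loop at `c(s)`: with the expansion `1/d² = 1/t² + P`, it is the integral of
`P` plus the finite part of `∫ 1/t² dt`. -/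
noncomputable def potential (s : ℝ) : ℝ :=
  (∫ t in Set.Ioc 0 (c.length / 2), (c.remainder ((-2, t), s)).re) +
    (∫ t in Set.Ioc 0 (c.length / 2), (c.remainder ((-2, -t), s)).re) - 4 / c.length

theorem kdist_base_pos (s₀ : ℝ) {t : ℝ} (h0 : t ≠ 0) (h1 : |t| ≤ c.length / 2) :
    0 < kdist (c.toFun s₀) (c.toFun (s₀ + t)) :=
  kdist_pos (c.toFun_add_ne h0 (by linarith [c.length_pos]))

theorem continuous_kdist_base (s₀ : ℝ) :
    Continuous fun s => kdist (c.toFun s₀) (c.toFun s) :=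
  (continuous_kdist_left _).comp c.smooth.continuous

/-- One half of the cut-off integral `∫ 1/d²` over the points `c(s₀ ± t)` with `d ≥ ε r`, where `r`
is a variable radius with `r = 1` and `r' = ± a` at `s₀`. -/
theorem integral_half_cutoff (s₀ : ℝ) {σ : ℝ} (hσ : σ = 1 ∨ σ = -1) {r : ℝ → ℝ} {a : ℝ}
    (hr : Continuous r) (hrd : HasDerivAt (fun t => r (s₀ + σ * t)) a 0) (hr1 : r s₀ = 1) :
    (∀ ε : ℝ, 0 < ε → IntegrableOn (fun t => {s | ε * r s ≤ kdist (c.toFun s₀) (c.toFun s)}.indicator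
      (fun s => (kdist (c.toFun s₀) (c.toFun s) ^ 2)⁻¹) (s₀ + σ * t)) (Set.Ioc 0 (c.length / 2))) ∧
    Tendsto (fun ε : ℝ => (∫ t in Set.Ioc 0 (c.length / 2),
      {s | ε * r s ≤ kdist (c.toFun s₀) (c.toFun s)}.indicator
        (fun s => (kdist (c.toFun s₀) (c.toFun s) ^ 2)⁻¹) (s₀ + σ * t)) - ε⁻¹) (𝓝[>] 0)
      (𝓝 ((∫ t in Set.Ioc 0 (c.length / 2), (c.remainder ((-2, σ * t), s₀)).re) - a -
        (c.length / 2)⁻¹)) := by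
  have hl := c.length_pos
  have hσ0 : σ ≠ 0 := by rcases hσ with h | h <;> simp [h]
  have hσa : |σ| = 1 := by rcases hσ with h | h <;> simp [h]
  have hσ2 : σ ^ 2 = 1 := by rcases hσ with h | h <;> simp [h]
  set L := c.length / 2 with hL
  have hL0 : 0 < L := by rw [hL]; linarith
  have hD := c.continuous_kdist_base s₀
  have habs : ∀ t ∈ Set.Ioc 0 L, |σ * t| = t := fun t ht => by
    rw [abs_mul, hσa, one_mul, abs_of_pos ht.1]
  have hne : ∀ t ∈ Set.Ioc 0 L, σ * t ≠ 0 := fun t ht => mul_ne_zero hσ0 ht.1.ne'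
  have hle : ∀ t ∈ Set.Ioc 0 L, |σ * t| ≤ c.length / 2 := fun t ht => by
    rw [habs t ht]; exact ht.2
  have hDpos : ∀ t ∈ Set.Ioc 0 L, 0 < kdist (c.toFun s₀) (c.toFun (s₀ + σ * t)) := fun t ht =>
    c.kdist_base_pos s₀ (hne t ht) (hle t ht)
  -- the condition `d ≥ ε r` reads `n ≤ 1/ε` for `n = r/d`, and `n(t) = 1/t + a + o(1)`
  set n : ℝ → ℝ := fun t => r (s₀ + σ * t) * (kdist (c.toFun s₀) (c.toFun (s₀ + σ * t)))⁻¹ with hn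
  have hline : Continuous fun t : ℝ => s₀ + σ * t := by fun_prop
  have hncont : ContinuousOn n (Set.Ioc 0 L) := by
    have h1 : Continuous fun t => r (s₀ + σ * t) := hr.comp hline
    have h2 : Continuous fun t => kdist (c.toFun s₀) (c.toFun (s₀ + σ * t)) := hD.comp hline
    exact h1.continuousOn.mul (h2.continuousOn.inv₀ fun t ht => (hDpos t ht).ne')
  have hrem : ∀ ζ : ℂ, Continuous fun t : ℝ => (c.remainder ((ζ, σ * t), s₀)).re := fun ζ => by
    have h1 : Continuous fun t : ℝ => ((ζ, σ * t), s₀) := by fun_prop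
    exact Complex.continuous_re.comp (c.contDiff_remainder.continuous.comp h1)
  have hnlim : Tendsto (fun t => n t - t⁻¹) (𝓝[>] 0) (𝓝 a) := by
    have h1 := tendsto_mul_inv_sub_inv hrd (by simpa using hr1) (hrem (-1))
    refine h1.congr' ?_
    filter_upwards [Ioc_mem_nhdsGT hL0] with t ht
    rw [hn]
    beta_reduce
    rw [c.inv_kdist (hne t ht) (hle t ht), habs t ht]
  obtain ⟨k1, k2⟩ := integral_cutoff hL0 hncont hnlim (hrem (-2))
  have hset : ∀ ε > 0, Set.Ioc 0 L ∩ {t | n t ≤ ε⁻¹} = Set.Ioc 0 L ∩ (fun t => s₀ + σ * t) ⁻¹'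
      {s | ε * r s ≤ kdist (c.toFun s₀) (c.toFun s)} := by
    intro ε hε
    have key : ∀ t ∈ Set.Ioc 0 L, n t ≤ ε⁻¹ ↔
        ε * r (s₀ + σ * t) ≤ kdist (c.toFun s₀) (c.toFun (s₀ + σ * t)) := by
      intro t ht
      have := hDpos t ht
      show r (s₀ + σ * t) * (kdist (c.toFun s₀) (c.toFun (s₀ + σ * t)))⁻¹ ≤ ε⁻¹ ↔ _
      rw [← div_eq_mul_inv, div_le_iff₀ this, inv_mul_eq_div, le_div_iff₀ hε, mul_comm]
    exact Set.ext fun t => ⟨fun h => ⟨h.1, (key t h.1).1 h.2⟩, fun h => ⟨h.1, (key t h.1).2 h.2⟩⟩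
  have hmeas : ∀ ε, MeasurableSet ((fun t => s₀ + σ * t) ⁻¹'
      {s | ε * r s ≤ kdist (c.toFun s₀) (c.toFun s)}) := fun ε =>
    ((isClosed_le (continuous_const.mul hr) hD).preimage hline).measurableSet
  have hfun : ∀ ε, (fun t => {s | ε * r s ≤ kdist (c.toFun s₀) (c.toFun s)}.indicator
      (fun s => (kdist (c.toFun s₀) (c.toFun s) ^ 2)⁻¹) (s₀ + σ * t)) =
      ((fun t => s₀ + σ * t) ⁻¹' {s | ε * r s ≤ kdist (c.toFun s₀) (c.toFun s)}).indicator
      fun t => (kdist (c.toFun s₀) (c.toFun (s₀ + σ * t)) ^ 2)⁻¹ := fun ε => rfl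
  have heq : ∀ ε, Set.EqOn (fun t => (kdist (c.toFun s₀) (c.toFun (s₀ + σ * t)) ^ 2)⁻¹)
      (fun t => (t ^ 2)⁻¹ + (c.remainder ((-2, σ * t), s₀)).re) (Set.Ioc 0 L ∩
        (fun t => s₀ + σ * t) ⁻¹' {s | ε * r s ≤ kdist (c.toFun s₀) (c.toFun s)}) := by
    rintro ε t ⟨ht, -⟩
    beta_reduce
    rw [c.inv_kdist_sq (hne t ht) (hle t ht), mul_pow, hσ2, one_mul]
  have hmeas' : ∀ ε, MeasurableSet (Set.Ioc 0 L ∩ (fun t => s₀ + σ * t) ⁻¹'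
      {s | ε * r s ≤ kdist (c.toFun s₀) (c.toFun s)}) := fun ε =>
    measurableSet_Ioc.inter (hmeas ε)
  constructor
  · intro ε hε
    rw [hfun, integrableOn_indicator_iff (hmeas ε), Set.inter_comm,
      integrableOn_congr_fun (heq ε) (hmeas' ε), ← hset ε hε]
    exact k1 _
  · have k3 := k2.comp tendsto_inv_nhdsGT_zero
    refine k3.congr' ?_
    filter_upwards [self_mem_nhdsWithin] with ε hε
    rw [hfun, setIntegral_indicator (hmeas ε), setIntegral_congr_fun (hmeas' ε) (heq ε),
      ← hset ε hε]
    rfl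

end UnitSpeedLoop

/-- A Möbius transformation maps at most one point of a loop to `∞`. -/
theorem IsMobiusImage.ae_lam_ne_zero {K : LegendrianKnot} {c : UnitSpeedLoop}
    {T : Equiv.Perm (OnePoint Heis)} {A : GL (Fin 3) ℂ} (h : IsMobiusImage K c T A) :
    ∀ᵐ s ∂(volume.restrict (Set.Ico 0 c.length)), lam A.val (c.toFun s) ≠ 0 := by
  have hsub : {s | s ∈ Set.Ico 0 c.length ∧ lam A.val (c.toFun s) = 0}.Subsingleton := by
    intro s hs t ht
    refine h.injOn hs.1 ht.1 ?_
    show T _ = T _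
    rw [(h.induced.lam_eq_zero_iff _).1 hs.2, (h.induced.lam_eq_zero_iff _).1 ht.2]
  rw [ae_restrict_iff' measurableSet_Ico]
  filter_upwards [compl_mem_ae_iff.2 (hsub.measure_zero volume)] with s hs hsI h0
  exact hs ⟨hsI, h0⟩

/-- The potential of the image of a loop under a Möbius transformation is the potential of the loop
times the conformal factor. In the parameter of the loop the cut-off `d ≥ ε` becomes `d ≥ ε r` with
a variable radius `r`; the derivative of `r` cancels between the two sides of the point. -/
theorem IsMobiusImage.tendsto_truncatedPotential {K : LegendrianKnot} {c : UnitSpeedLoop}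
    {T : Equiv.Perm (OnePoint Heis)} {A : GL (Fin 3) ℂ} (h : IsMobiusImage K c T A) {s₀ : ℝ}
    {p : Heis} (hp : T (c.toFun s₀) = (p : OnePoint Heis)) :
    (∀ ε : ℝ, 0 < ε →
      IntegrableOn (fun q => (kdist p q ^ 2)⁻¹) {q | ε ≤ kdist p q} K.arcLength) ∧
    Tendsto (K.truncatedPotential p) (𝓝[>] (0 : ℝ))
      (𝓝 (‖lam A.val (c.toFun s₀)‖ * c.potential s₀)) := by
  have hl := c.length_pos
  have hc : Continuous c.toFun := c.smooth.continuous
  set ρ := ‖lam A.val (c.toFun s₀)‖ with hρ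
  have hl0 : lam A.val (c.toFun s₀) ≠ 0 := (h.induced.mulVec_eq hp).1
  have hρ0 : 0 < ρ := norm_pos_iff.2 hl0
  -- the radius, normalized to be `1` at `s₀`
  set r : ℝ → ℝ := fun s => Real.sqrt (‖lam A.val (c.toFun s)‖ / ρ) with hr
  have hlc : Continuous fun s => lam A.val (c.toFun s) := (contDiff_lam A.val).continuous.comp hc
  have hrc : Continuous r := (hlc.norm.div_const ρ).sqrt
  have hr1 : r s₀ = 1 := by
    show Real.sqrt (ρ / ρ) = 1
    rw [div_self hρ0.ne', Real.sqrt_one]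
  have hrd : DifferentiableAt ℝ r s₀ := by
    have h1 : DifferentiableAt ℝ (fun s => lam A.val (c.toFun s)) s₀ :=
      (((contDiff_lam A.val).differentiable (by simp)) _).comp s₀
        ((c.smooth.differentiable (by simp)) s₀)
    refine ((h1.norm ℝ hl0).div_const ρ).sqrt ?_
    exact (div_pos hρ0 hρ0).ne'
  have hr2 : ∀ s, ρ ^ 2 * r s ^ 2 = ρ * ‖lam A.val (c.toFun s)‖ := by
    intro s
    rw [hr]
    beta_reduce
    rw [Real.sq_sqrt (by positivity)]
    field_simp
  set a := deriv r s₀ with ha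
  set D : ℝ → ℝ := fun s => kdist (c.toFun s₀) (c.toFun s) with hD
  set E : ℝ → Set ℝ := fun ε => {s | ε * r s ≤ D s} with hE
  set G : ℝ → ℝ → ℝ := fun ε => (E ε).indicator fun s => (D s ^ 2)⁻¹ with hG
  have hlim : ∀ {σ : ℝ}, HasDerivAt (fun t => r (s₀ + σ * t)) (a * σ) 0 := by
    intro σ
    have h1 : HasDerivAt (fun t : ℝ => s₀ + σ * t) σ 0 := by
      simpa using ((hasDerivAt_id (0 : ℝ)).const_mul σ).const_add s₀
    have h2 : HasDerivAt r a (s₀ + σ * 0) := by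
      rw [mul_zero, add_zero]; exact hrd.hasDerivAt
    exact HasDerivAt.comp (h₂ := r) 0 h2 h1
  obtain ⟨i1, l1⟩ := c.integral_half_cutoff s₀ (σ := 1) (Or.inl rfl) hrc hlim hr1
  obtain ⟨i2, l2⟩ := c.integral_half_cutoff s₀ (σ := -1) (Or.inr rfl) hrc hlim hr1
  have hGper : ∀ ε, Function.Periodic (G ε) c.length := by
    intro ε s
    have hcs := c.periodic s
    have hrs : r (s + c.length) = r s := by simp only [hr, hcs]
    have hDs : D (s + c.length) = D s := by simp only [hD, hcs]
    simp only [hG, hE, Set.indicator_apply, Set.mem_ofPred_eq, hrs, hDs]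
  have hfold : ∀ ε > 0, IntegrableOn (G ε) (Set.Ico 0 c.length) ∧
      ∫ s in Set.Ico 0 c.length, G ε s = (∫ t in Set.Ioc 0 (c.length / 2), G ε (s₀ + 1 * t)) +
        ∫ t in Set.Ioc 0 (c.length / 2), G ε (s₀ + -1 * t) := by
    intro ε hε
    have e2 : ∀ t, s₀ + -1 * t = s₀ - t := fun t => by ring
    have j1 := i1 ε hε
    have j2 := i2 ε hε
    simp only [one_mul] at j1
    simp only [e2] at j2
    simp only [one_mul, e2]
    exact integral_period_fold hl (hGper ε) s₀ j1 j2
  -- the integrand over the knot, pulled back to the loop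
  set f : ℝ → Heis → ℝ := fun ε => {q | ε ≤ kdist p q}.indicator fun q => (kdist p q ^ 2)⁻¹
  have hclosed : ∀ ε, MeasurableSet {q | ε ≤ kdist p q} := fun ε =>
    (isClosed_le continuous_const (continuous_kdist_left p)).measurableSet
  have hpull : ∀ ε > 0, (fun s => ‖lam A.val (c.toFun s)‖⁻¹ * f ε (coord (T (c.toFun s))))
      =ᵐ[volume.restrict (Set.Ico 0 c.length)] fun s => ρ * G (ε * ρ) s := by
    intro ε hε
    filter_upwards [h.ae_lam_ne_zero] with s hs
    have hsq := h.induced.kdist_sq h.preserves hp (h.induced.apply_eq hs)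
    rw [h.induced.apply_eq hs, coord_coe]
    set q := mobiusCoord A.val (c.toFun s)
    have hlp : 0 < ‖lam A.val (c.toFun s)‖ := norm_pos_iff.2 hs
    -- `ρ |λ(s)| d(p, q)² = D(s)²` and `ρ |λ(s)| = ρ² r(s)²`
    have hiff : ε ≤ kdist p q ↔ ε * ρ * r s ≤ D s := by
      have hr0 : 0 ≤ r s := Real.sqrt_nonneg _
      rw [← pow_le_pow_iff_left₀ hε.le (kdist_nonneg p q) two_ne_zero,
        ← pow_le_pow_iff_left₀ (by positivity) (kdist_nonneg _ _) two_ne_zero, hsq, ← hρ,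
        mul_pow, mul_pow, mul_assoc, hr2, mul_comm (ε ^ 2)]
      exact (mul_le_mul_iff_right₀ (mul_pos hρ0 hlp)).symm
    simp only [f, hG, hE, Set.indicator_apply, Set.mem_ofPred_eq, hiff]
    split_ifs with hcond
    · simp only [hD]
      rw [hsq, ← hρ, mul_inv, mul_inv]
      field_simp
    · simp
  have hint : ∀ ε > 0, IntegrableOn (fun q => (kdist p q ^ 2)⁻¹) {q | ε ≤ kdist p q} K.arcLength ∧
      ∫ q in {q | ε ≤ kdist p q}, (kdist p q ^ 2)⁻¹ ∂K.arcLength =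
        ρ * ∫ s in Set.Ico 0 c.length, G (ε * ρ) s := by
    intro ε hε
    obtain ⟨k1, k2⟩ := h.integral_arcLength (f ε)
    rw [← integrable_indicator_iff (hclosed ε), ← integral_indicator (hclosed ε)]
    refine ⟨k1.2 ?_, ?_⟩
    · exact (((hfold _ (mul_pos hε hρ0)).1.const_mul ρ).congr (hpull ε hε).symm)
    · rw [k2, integral_congr_ae (hpull ε hε), integral_const_mul]
  refine ⟨fun ε hε => (hint ε hε).1, ?_⟩
  have hscale : Tendsto (fun ε : ℝ => ε * ρ) (𝓝[>] 0) (𝓝[>] 0) := by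
    refine tendsto_nhdsWithin_iff.2 ⟨?_, ?_⟩
    · have : ContinuousAt (fun ε : ℝ => ε * ρ) 0 := by fun_prop
      simpa using this.tendsto.mono_left nhdsWithin_le_nhds
    · filter_upwards [self_mem_nhdsWithin] with ε hε using mul_pos hε hρ0
  have hsum := ((l1.add l2).comp hscale).const_mul ρ
  have hval : (∫ t in Set.Ioc 0 (c.length / 2), (c.remainder ((-2, 1 * t), s₀)).re) - a * 1 -
      (c.length / 2)⁻¹ + ((∫ t in Set.Ioc 0 (c.length / 2),
        (c.remainder ((-2, -1 * t), s₀)).re) - a * -1 - (c.length / 2)⁻¹) = c.potential s₀ := by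
    simp only [one_mul, neg_one_mul, UnitSpeedLoop.potential]
    field_simp
    ring
  rw [hval] at hsum
  refine hsum.congr' ?_
  filter_upwards [self_mem_nhdsWithin] with ε hε
  have hε' : (0 : ℝ) < ε := hε
  have h3 := (hfold (ε * ρ) (mul_pos hε' hρ0)).2
  rw [LegendrianKnot.truncatedPotential, (hint ε hε).2, h3]
  simp only [Function.comp_apply]
  have h4 : ρ * (ε * ρ)⁻¹ = 1 / ε := by field_simp
  simp only [hG, hE, hD]
  linear_combination -2 * h4

/-! ### The beta function of a unit speed loop -/

theorem integrable_cpow_mul_prod {k : ℝ × ℝ → ℂ} (hk : Continuous k) {l L : ℝ} (hL : 0 ≤ L)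
    {η : ℂ} (hη : -1 < η.re) :
    Integrable (fun x : ℝ × ℝ => (x.2 : ℂ) ^ η * k x)
      ((volume.restrict (Set.Ico 0 l)).prod (volume.restrict (Set.Ioc 0 L))) := by
  have h1 : Integrable (fun t : ℝ => (t : ℂ) ^ η) (volume.restrict (Set.Ioc 0 L)) :=
    (intervalIntegrable_iff_integrableOn_Ioc_of_le hL).1
      (intervalIntegral.intervalIntegrable_cpow' hη)
  have h2 := h1.comp_snd (volume.restrict (Set.Ico 0 l))
  obtain ⟨C, hC⟩ := ((isCompact_Icc (a := (0 : ℝ)) (b := l)).prod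
    (isCompact_Icc (a := (0 : ℝ)) (b := L))).exists_bound_of_continuousOn hk.continuousOn
  refine h2.mul_bdd (c := C) hk.aestronglyMeasurable ?_
  rw [Measure.prod_restrict]
  refine (ae_restrict_iff' (measurableSet_Ico.prod measurableSet_Ioc)).2 (.of_forall fun x hx => ?_)
  exact hC x ⟨Set.Ico_subset_Icc_self hx.1, Set.Ioc_subset_Icc_self hx.2⟩

theorem integral_cpow_mul_swap {k : ℝ × ℝ → ℂ} (hk : Continuous k) {l L : ℝ} (hL : 0 ≤ L)
    {η : ℂ} (hη : -1 < η.re) :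
    ∫ s in Set.Ico 0 l, ∫ t in Set.Ioc 0 L, (t : ℂ) ^ η * k (s, t) =
      ∫ t in Set.Ioc 0 L, (t : ℂ) ^ η * ∫ s in Set.Ico 0 l, k (s, t) := by
  rw [integral_integral_swap (f := fun (s t : ℝ) => ((t : ℝ) : ℂ) ^ η * k (s, t))
    (integrable_cpow_mul_prod hk hL hη)]
  exact integral_congr_ae (.of_forall fun t => integral_const_mul _ _)

namespace UnitSpeedLoop

variable (c : UnitSpeedLoop)

/-- The sum of the remainders on the two sides of the point `c(s)`. -/
noncomputable def foldedRemainder (y : (ℂ × ℝ) × ℝ) : ℂ :=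
  c.remainder y + c.remainder ((y.1.1, -y.1.2), y.2)

theorem contDiff_foldedRemainder :
    ContDiff ℝ ((⊤ : ℕ∞) : WithTop ℕ∞) c.foldedRemainder := by
  have h1 : ContDiff ℝ ((⊤ : ℕ∞) : WithTop ℕ∞)
      fun y : (ℂ × ℝ) × ℝ => ((y.1.1, -y.1.2), y.2) := by fun_prop
  exact c.contDiff_remainder.add (c.contDiff_remainder.comp h1)

/-- The amplitude of the beta function: the remainders, integrated along the loop. -/
noncomputable def amplitude (y : ℂ × ℝ) : ℂ :=
  ∫ s in (0 : ℝ)..c.length, c.foldedRemainder (y, s)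

theorem isAmplitude : IsAmplitude c.amplitude := by
  refine ⟨contDiff_intervalIntegral_param c.contDiff_foldedRemainder 0 c.length, fun t ζ => ?_⟩
  have hcont := c.contDiff_foldedRemainder.continuous
  obtain ⟨C, hC⟩ := ((isCompact_closedBall ζ 1).prod
    (isCompact_Icc (a := (0 : ℝ)) (b := c.length))).exists_bound_of_continuousOn
    (f := fun x : ℂ × ℝ => c.foldedRemainder ((x.1, t), x.2))
    (hcont.comp (by fun_prop : Continuous fun x : ℂ × ℝ => ((x.1, t), x.2))).continuousOn
  simp only [amplitude, intervalIntegral.integral_of_le c.length_pos.le]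
  refine differentiableAt_integral_of_dominated one_pos (b := fun _ => C) ?_ ?_ ?_ ?_
  · intro w _
    exact (hcont.comp (by fun_prop : Continuous fun s : ℝ => ((w, t), s))).aestronglyMeasurable
  · exact .of_forall fun s w _ =>
      ((c.differentiable_remainder t s).add (c.differentiable_remainder (-t) s)) w
  · refine (ae_restrict_iff' measurableSet_Ioc).2 (.of_forall fun s hs w hw => ?_)
    exact hC (w, s) ⟨Metric.ball_subset_closedBall hw, Set.Ioc_subset_Icc_self hs⟩
  · exact integrable_const C

theorem kdist_cpow_add {s t : ℝ} (ζ : ℂ) (ht : t ∈ Set.Ioc 0 (c.length / 2)) :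
    (kdist (c.toFun s) (c.toFun (s + t)) : ℂ) ^ ζ =
      (t : ℂ) ^ ζ * (1 + (t : ℂ) ^ 2 * c.remainder ((ζ, t), s)) := by
  have := c.kdist_cpow (s := s) ζ ht.1.ne' (by rw [abs_of_pos ht.1]; exact ht.2)
  rwa [abs_of_pos ht.1] at this

theorem kdist_cpow_sub {s t : ℝ} (ζ : ℂ) (ht : t ∈ Set.Ioc 0 (c.length / 2)) :
    (kdist (c.toFun s) (c.toFun (s - t)) : ℂ) ^ ζ =
      (t : ℂ) ^ ζ * (1 + (t : ℂ) ^ 2 * c.remainder ((ζ, -t), s)) := by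
  have := c.kdist_cpow (s := s) (t := -t) ζ (neg_ne_zero.2 ht.1.ne')
    (by rw [abs_neg, abs_of_pos ht.1]; exact ht.2)
  rwa [abs_neg, abs_of_pos ht.1, ← sub_eq_add_neg, Complex.ofReal_neg, neg_sq] at this

theorem periodic_kdist_cpow (s : ℝ) (ζ : ℂ) :
    Function.Periodic (fun s' => (kdist (c.toFun s) (c.toFun s') : ℂ) ^ ζ) c.length := fun s' => by
  beta_reduce
  rw [c.periodic s']

theorem continuous_one_add_remainder (ζ : ℂ) (σ : ℝ) (s : ℝ) :
    Continuous fun t : ℝ => 1 + (t : ℂ) ^ 2 * c.remainder ((ζ, σ * t), s) := by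
  have h1 : Continuous fun t : ℝ => ((ζ, σ * t), s) := by fun_prop
  exact continuous_const.add ((Complex.continuous_ofReal.pow 2).mul
    (c.contDiff_remainder.continuous.comp h1))

/-- The inner integral of the beta function. -/
theorem integral_kdist_cpow (s : ℝ) {ζ : ℂ} (hζ : -1 < ζ.re) :
    IntegrableOn (fun s' => (kdist (c.toFun s) (c.toFun s') : ℂ) ^ ζ) (Set.Ico 0 c.length) ∧
    ∫ s' in Set.Ico 0 c.length, (kdist (c.toFun s) (c.toFun s') : ℂ) ^ ζ =
      2 * (((c.length / 2 : ℝ) : ℂ) ^ (ζ + 1) / (ζ + 1)) +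
        ∫ t in Set.Ioc 0 (c.length / 2), (t : ℂ) ^ (ζ + 2) * c.foldedRemainder ((ζ, t), s) := by
  have hL : (0 : ℝ) ≤ c.length / 2 := by linarith [c.length_pos]
  have hpow : IntegrableOn (fun t : ℝ => (t : ℂ) ^ ζ) (Set.Ioc 0 (c.length / 2)) :=
    (intervalIntegrable_iff_integrableOn_Ioc_of_le hL).1
      (intervalIntegral.intervalIntegrable_cpow' hζ)
  have hside : ∀ σ : ℝ, IntegrableOn
      (fun t : ℝ => (t : ℂ) ^ ζ * (1 + (t : ℂ) ^ 2 * c.remainder ((ζ, σ * t), s)))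
      (Set.Ioc 0 (c.length / 2)) := fun σ =>
    (intervalIntegrable_iff_integrableOn_Ioc_of_le hL).1
      (intervalIntegrable_cpow_mul (c.continuous_one_add_remainder ζ σ s) hζ)
  have h1 := hside 1
  have h2 := hside (-1)
  simp only [one_mul, neg_one_mul] at h1 h2
  have e1 : Set.EqOn (fun t => (kdist (c.toFun s) (c.toFun (s + t)) : ℂ) ^ ζ)
      (fun t : ℝ => (t : ℂ) ^ ζ * (1 + (t : ℂ) ^ 2 * c.remainder ((ζ, t), s)))
      (Set.Ioc 0 (c.length / 2)) := fun t ht => c.kdist_cpow_add ζ ht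
  have e2 : Set.EqOn (fun t => (kdist (c.toFun s) (c.toFun (s - t)) : ℂ) ^ ζ)
      (fun t : ℝ => (t : ℂ) ^ ζ * (1 + (t : ℂ) ^ 2 * c.remainder ((ζ, -t), s)))
      (Set.Ioc 0 (c.length / 2)) := fun t ht => c.kdist_cpow_sub ζ ht
  obtain ⟨k1, k2⟩ := integral_period_fold c.length_pos (c.periodic_kdist_cpow s ζ) s
    ((integrableOn_congr_fun e1 measurableSet_Ioc).2 h1)
    ((integrableOn_congr_fun e2 measurableSet_Ioc).2 h2)
  refine ⟨k1, ?_⟩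
  rw [k2, setIntegral_congr_fun measurableSet_Ioc e1, setIntegral_congr_fun measurableSet_Ioc e2,
    ← integral_add h1 h2]
  have hζ1 : ζ + 1 ≠ 0 := by
    intro h0
    have := congrArg Complex.re h0
    simp at this
    linarith
  have hcpow : ∫ t in Set.Ioc 0 (c.length / 2), (t : ℂ) ^ ζ =
      ((c.length / 2 : ℝ) : ℂ) ^ (ζ + 1) / (ζ + 1) := by
    rw [← intervalIntegral.integral_of_le hL, integral_cpow (Or.inl hζ)]
    simp [Complex.zero_cpow hζ1]
  have hfold : Continuous fun t : ℝ => c.foldedRemainder ((ζ, t), s) := by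
    have h1 : Continuous fun t : ℝ => ((ζ, t), s) := by fun_prop
    exact c.contDiff_foldedRemainder.continuous.comp h1
  have hrest : IntegrableOn (fun t : ℝ => (t : ℂ) ^ (ζ + 2) * c.foldedRemainder ((ζ, t), s))
      (Set.Ioc 0 (c.length / 2)) :=
    (intervalIntegrable_iff_integrableOn_Ioc_of_le hL).1
      (intervalIntegrable_cpow_mul hfold (by simp; linarith))
  rw [← hcpow, ← integral_const_mul, ← integral_add (hpow.const_mul 2) hrest]
  refine setIntegral_congr_fun measurableSet_Ioc fun t ht => ?_
  have ht0 : (t : ℂ) ≠ 0 := Complex.ofReal_ne_zero.2 ht.1.ne'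
  rw [Complex.cpow_add _ _ ht0, Complex.cpow_ofNat, foldedRemainder]
  ring

theorem measurable_kdist_cpow (ζ : ℂ) :
    Measurable fun x : Heis × Heis => (kdist x.1 x.2 : ℂ) ^ ζ :=
  (Complex.measurable_ofReal.comp continuous_kdist.measurable).pow_const ζ

theorem integrable_kdist_cpow {ζ : ℂ} (hζ : -1 < ζ.re) :
    Integrable (fun x : ℝ × ℝ => (kdist (c.toFun x.1) (c.toFun x.2) : ℂ) ^ ζ)
      ((volume.restrict (Set.Ico 0 c.length)).prod (volume.restrict (Set.Ico 0 c.length))) := by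
  have hL : (0 : ℝ) ≤ c.length / 2 := by linarith [c.length_pos]
  have hc := c.smooth.continuous.measurable
  have hmeas : AEStronglyMeasurable
      (fun x : ℝ × ℝ => (kdist (c.toFun x.1) (c.toFun x.2) : ℂ) ^ ζ)
      ((volume.restrict (Set.Ico 0 c.length)).prod (volume.restrict (Set.Ico 0 c.length))) :=
    ((measurable_kdist_cpow ζ).comp ((hc.comp measurable_fst).prodMk
      (hc.comp measurable_snd))).aestronglyMeasurable
  rw [integrable_prod_iff hmeas]
  refine ⟨.of_forall fun s => (c.integral_kdist_cpow s hζ).1, ?_⟩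
  -- the inner integrals are bounded: the remainder is bounded on a compact set
  have hcont : ∀ σ : ℝ, Continuous fun x : ℝ × ℝ =>
      1 + (x.2 : ℂ) ^ 2 * c.remainder ((ζ, σ * x.2), x.1) := fun σ => by
    have h1 : Continuous fun x : ℝ × ℝ => ((ζ, σ * x.2), x.1) := by fun_prop
    exact continuous_const.add (((Complex.continuous_ofReal.comp continuous_snd).pow 2).mul
      (c.contDiff_remainder.continuous.comp h1))
  have hcpt : IsCompact (Set.Icc (0 : ℝ) c.length ×ˢ Set.Icc (0 : ℝ) (c.length / 2)) :=
    isCompact_Icc.prod isCompact_Icc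
  obtain ⟨C₁, hC₁⟩ := hcpt.exists_bound_of_continuousOn (hcont 1).continuousOn
  obtain ⟨C₂, hC₂⟩ := hcpt.exists_bound_of_continuousOn (hcont (-1)).continuousOn
  simp only [one_mul, neg_one_mul] at hC₁ hC₂
  have hpow : IntegrableOn (fun t : ℝ => t ^ ζ.re) (Set.Ioc 0 (c.length / 2)) :=
    (intervalIntegrable_iff_integrableOn_Ioc_of_le hL).1
      (intervalIntegral.intervalIntegrable_rpow' hζ)
  refine Integrable.of_bound hmeas.norm.integral_prod_right'
    ((∫ t in Set.Ioc 0 (c.length / 2), t ^ ζ.re * C₁) +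
      ∫ t in Set.Ioc 0 (c.length / 2), t ^ ζ.re * C₂) ?_
  refine (ae_restrict_iff' measurableSet_Ico).2 (.of_forall fun s hs => ?_)
  rw [Real.norm_of_nonneg (integral_nonneg fun _ => norm_nonneg _)]
  have hb1 : ∀ t ∈ Set.Ioc 0 (c.length / 2),
      ‖(kdist (c.toFun s) (c.toFun (s + t)) : ℂ) ^ ζ‖ ≤ t ^ ζ.re * C₁ := fun t ht => by
    rw [c.kdist_cpow_add ζ ht, norm_mul, Complex.norm_cpow_eq_rpow_re_of_pos ht.1]
    exact mul_le_mul_of_nonneg_left (hC₁ (s, t) ⟨Set.Ico_subset_Icc_self hs,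
      Set.Ioc_subset_Icc_self ht⟩) (Real.rpow_nonneg ht.1.le _)
  have hb2 : ∀ t ∈ Set.Ioc 0 (c.length / 2),
      ‖(kdist (c.toFun s) (c.toFun (s - t)) : ℂ) ^ ζ‖ ≤ t ^ ζ.re * C₂ := fun t ht => by
    rw [c.kdist_cpow_sub ζ ht, norm_mul, Complex.norm_cpow_eq_rpow_re_of_pos ht.1]
    exact mul_le_mul_of_nonneg_left (hC₂ (s, t) ⟨Set.Ico_subset_Icc_self hs,
      Set.Ioc_subset_Icc_self ht⟩) (Real.rpow_nonneg ht.1.le _)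
  have hm : Measurable fun s' => ‖(kdist (c.toFun s) (c.toFun s') : ℂ) ^ ζ‖ :=
    ((Complex.measurable_ofReal.comp (c.continuous_kdist_base s).measurable).pow_const ζ).norm
  have hi1 : IntegrableOn (fun t => ‖(kdist (c.toFun s) (c.toFun (s + t)) : ℂ) ^ ζ‖)
      (Set.Ioc 0 (c.length / 2)) :=
    (hpow.mul_const C₁).mono' (hm.comp (measurable_const_add s)).aestronglyMeasurable
      ((ae_restrict_iff' measurableSet_Ioc).2 (.of_forall fun t ht => by
        rw [norm_norm]; exact hb1 t ht))
  have hi2 : IntegrableOn (fun t => ‖(kdist (c.toFun s) (c.toFun (s - t)) : ℂ) ^ ζ‖)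
      (Set.Ioc 0 (c.length / 2)) :=
    (hpow.mul_const C₂).mono' (hm.comp (measurable_const.sub measurable_id)).aestronglyMeasurable
      ((ae_restrict_iff' measurableSet_Ioc).2 (.of_forall fun t ht => by
        rw [norm_norm]; exact hb2 t ht))
  have hfold := (integral_period_fold c.length_pos
    (G := fun s' => ‖(kdist (c.toFun s) (c.toFun s') : ℂ) ^ ζ‖)
    (fun s' => congrArg norm (c.periodic_kdist_cpow s ζ s')) s hi1 hi2).2
  rw [hfold]
  exact add_le_add (setIntegral_mono_on hi1 (hpow.mul_const C₁) measurableSet_Ioc hb1)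
    (setIntegral_mono_on hi2 (hpow.mul_const C₂) measurableSet_Ioc hb2)

/-- Fubini for the double integral of the remainders, with independent exponent and parameter. -/
theorem integral_amplitude {ζ : ℂ} {η : ℂ} (hη : -1 < η.re) :
    ∫ s in Set.Ico 0 c.length, ∫ t in Set.Ioc 0 (c.length / 2),
      (t : ℂ) ^ η * c.foldedRemainder ((ζ, t), s) =
    ∫ t in (0 : ℝ)..(c.length / 2), (t : ℂ) ^ η * c.amplitude (ζ, t) := by
  have hL : (0 : ℝ) ≤ c.length / 2 := by linarith [c.length_pos]
  have h1 : Continuous fun x : ℝ × ℝ => ((ζ, x.2), x.1) := by fun_prop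
  have hk : Continuous fun x : ℝ × ℝ => c.foldedRemainder ((ζ, x.2), x.1) :=
    c.contDiff_foldedRemainder.continuous.comp h1
  have h := integral_cpow_mul_swap (l := c.length) hk hL hη
  rw [intervalIntegral.integral_of_le hL]
  refine h.trans (setIntegral_congr_fun measurableSet_Ioc fun t _ => ?_)
  simp only [amplitude]
  rw [intervalIntegral.integral_of_le c.length_pos.le, integral_Ioc_eq_integral_Ioo,
    integral_Ico_eq_integral_Ioo]

/-- The beta integral in terms of the amplitude: the pole at `-1` is split off, and the exponent of
the remaining integral is `ζ + 2`. -/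
theorem integral_integral_kdist_cpow {ζ : ℂ} (hζ : -1 < ζ.re) :
    ∫ x : ℝ × ℝ, (kdist (c.toFun x.1) (c.toFun x.2) : ℂ) ^ ζ
      ∂((volume.restrict (Set.Ico 0 c.length)).prod (volume.restrict (Set.Ico 0 c.length))) =
    c.length * (2 * (((c.length / 2 : ℝ) : ℂ) ^ (ζ + 1) / (ζ + 1))) +
      ∫ t in (0 : ℝ)..(c.length / 2), (t : ℂ) ^ (ζ + 2) * c.amplitude (ζ, t) := by
  have hL : (0 : ℝ) ≤ c.length / 2 := by linarith [c.length_pos]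
  have hη : -1 < (ζ + 2).re := by simp; linarith
  rw [integral_prod _ (c.integrable_kdist_cpow hζ)]
  simp only [(c.integral_kdist_cpow _ hζ).2]
  have h1 : Continuous fun x : ℝ × ℝ => ((ζ, x.2), x.1) := by fun_prop
  have hk : Continuous fun x : ℝ × ℝ => c.foldedRemainder ((ζ, x.2), x.1) :=
    c.contDiff_foldedRemainder.continuous.comp h1
  rw [integral_add (integrable_const _)
    (integrable_cpow_mul_prod (l := c.length) hk hL hη).integral_prod_left,
    c.integral_amplitude hη]
  simp [c.length_pos.le]

theorem continuous_potential : Continuous c.potential := by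
  have hL : (0 : ℝ) ≤ c.length / 2 := by linarith [c.length_pos]
  have h : ∀ σ : ℝ, Continuous fun s =>
      ∫ t in (0 : ℝ)..(c.length / 2), (c.remainder ((-2, σ * t), s)).re := fun σ => by
    refine intervalIntegral.continuous_parametric_intervalIntegral_of_continuous'
      (f := fun s t => (c.remainder ((-2, σ * t), s)).re) ?_ 0 (c.length / 2)
    have h1 : Continuous fun x : ℝ × ℝ => (((-2 : ℂ), σ * x.2), x.1) := by fun_prop
    exact Complex.continuous_re.comp (c.contDiff_remainder.continuous.comp h1)
  have h1 := h 1
  have h2 := h (-1)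
  simp only [one_mul, neg_one_mul] at h1 h2
  simp only [intervalIntegral.integral_of_le hL] at h1 h2
  exact (h1.add h2).sub continuous_const

/-- At `ζ = -2` the remainders integrate to the potential, up to the finite part of `∫ 1/t² dt`. -/
theorem integral_foldedRemainder_neg_two (s : ℝ) :
    ∫ t in Set.Ioc 0 (c.length / 2), (t : ℂ) ^ (0 : ℂ) * c.foldedRemainder ((-2, t), s) =
      ((c.potential s + 4 / c.length : ℝ) : ℂ) := by
  have hreal : ∀ t : ℝ, t ≠ 0 → |t| ≤ c.length / 2 →
      c.remainder ((-2, t), s) = ((c.remainder ((-2, t), s)).re : ℂ) := fun t h0 h1 => by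
    have h := c.inv_kdist_sq_ofReal (s := s) h0 h1
    have him := congrArg Complex.im h
    simp only [Complex.add_im, Complex.ofReal_im, zero_add] at him
    exact Complex.ext (by simp) (by simp [← him])
  have hcont : ∀ σ : ℝ, Continuous fun t : ℝ => (c.remainder ((-2, σ * t), s)).re := fun σ => by
    have h1 : Continuous fun t : ℝ => (((-2 : ℂ), σ * t), s) := by fun_prop
    exact Complex.continuous_re.comp (c.contDiff_remainder.continuous.comp h1)
  have h1 := (hcont 1).integrableOn_Ioc (μ := volume) (a := 0) (b := c.length / 2)
  have h2 := (hcont (-1)).integrableOn_Ioc (μ := volume) (a := 0) (b := c.length / 2)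
  simp only [one_mul, neg_one_mul] at h1 h2
  rw [potential, sub_add_cancel, ← integral_add h1 h2, ← integral_complex_ofReal]
  refine setIntegral_congr_fun measurableSet_Ioc fun t ht => ?_
  rw [Complex.cpow_zero, one_mul, foldedRemainder, Complex.ofReal_add,
    ← hreal t ht.1.ne' (by rw [abs_of_pos ht.1]; exact ht.2),
    ← hreal (-t) (neg_ne_zero.2 ht.1.ne') (by rw [abs_neg, abs_of_pos ht.1]; exact ht.2)]

/-- The meromorphic continuation of the double integral `∬ d^ζ` over the loop, and its value
at `-2`. -/
theorem exists_meromorphic_continuation : ∃ B : ℂ → ℂ, (∀ ζ, MeromorphicAt B ζ) ∧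
    AnalyticAt ℂ B (-2) ∧
    (∀ ζ : ℂ, -1 < ζ.re → B ζ = ∫ x : ℝ × ℝ, (kdist (c.toFun x.1) (c.toFun x.2) : ℂ) ^ ζ
      ∂((volume.restrict (Set.Ico 0 c.length)).prod (volume.restrict (Set.Ico 0 c.length)))) ∧
    B (-2) = ((∫ s in Set.Ico 0 c.length, c.potential s : ℝ) : ℂ) := by
  have hl := c.length_pos
  have hL : 0 < c.length / 2 := by linarith
  have hLc : ((c.length / 2 : ℝ) : ℂ) ∈ Complex.slitPlane := Complex.ofReal_mem_slitPlane.2 hL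
  have hamp := c.isAmplitude.comp_sub 2
  obtain ⟨M, hM, hMe⟩ := hamp.exists_meromorphic hL
  have hMa : AnalyticAt ℂ M 0 := by
    have hopen : IsOpen {ζ : ℂ | -1 < ζ.re} := isOpen_lt continuous_const Complex.continuous_re
    refine DifferentiableOn.analyticAt (s := {ζ : ℂ | -1 < ζ.re}) (fun w hw => ?_)
      (hopen.mem_nhds (by simp))
    refine ((hamp.differentiableAt_integral hL hw).differentiableWithinAt).congr
      (fun z hz => hMe z hz) (hMe w hw)
  have ha : ∀ ζ : ℂ, AnalyticAt ℂ (fun ζ : ℂ => ((c.length / 2 : ℝ) : ℂ) ^ (ζ + 1)) ζ := fun ζ =>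
    analyticAt_const.cpow (by fun_prop) hLc
  have hb : ∀ ζ : ℂ, AnalyticAt ℂ (fun ζ : ℂ => ζ + 1) ζ := fun ζ => by fun_prop
  have hs : ∀ ζ : ℂ, AnalyticAt ℂ (fun ζ : ℂ => ζ + 2) ζ := fun ζ => by fun_prop
  -- with `ℓ` the length, `B(ζ) = 2ℓ (ℓ/2)^(ζ+1)/(ζ+1) + ∫₀^{ℓ/2} t^(ζ+2) g(ζ, t) dt`, and at `ζ = -2`
  -- the first term is `-4`, which is the integral of `-4/ℓ` over the loop
  refine ⟨fun ζ => c.length * (2 * (((c.length / 2 : ℝ) : ℂ) ^ (ζ + 1) / (ζ + 1))) + M (ζ + 2),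
    fun ζ => ?_, ?_, fun ζ hζ => ?_, ?_⟩
  · have hm : MeromorphicAt (M ∘ fun ζ => ζ + 2) ζ :=
      MeromorphicAt.comp_analyticAt (hM _) (hs ζ)
    exact ((MeromorphicAt.const _ ζ).mul ((MeromorphicAt.const _ ζ).mul
      ((ha ζ).meromorphicAt.div (hb ζ).meromorphicAt))).add hm
  · have hm : AnalyticAt ℂ (M ∘ fun ζ => ζ + 2) (-2) := by
      refine AnalyticAt.comp ?_ (hs (-2))
      rw [show (-2 : ℂ) + 2 = 0 by norm_num]
      exact hMa
    exact (analyticAt_const.mul (analyticAt_const.mul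
      ((ha (-2)).div (hb (-2)) (by norm_num)))).add hm
  · beta_reduce
    rw [c.integral_integral_kdist_cpow hζ, hMe (ζ + 2) (by simp; linarith)]
    simp
  · have h0 : M 0 = ((∫ s in Set.Ico 0 c.length, (c.potential s + 4 / c.length) : ℝ) : ℂ) := by
      rw [hMe 0 (by simp)]
      have h1 := c.integral_amplitude (ζ := -2) (η := 0) (by simp)
      simp only [zero_sub]
      rw [← h1]
      simp only [c.integral_foldedRemainder_neg_two]
      exact integral_complex_ofReal
    have hpi : IntegrableOn c.potential (Set.Ico 0 c.length) :=
      (c.continuous_potential.integrableOn_Icc).mono_set Set.Ico_subset_Icc_self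
    beta_reduce
    rw [show (-2 : ℂ) + 2 = 0 by norm_num, show (-2 : ℂ) + 1 = -1 by norm_num, h0,
      integral_add hpi (integrable_const _), Complex.cpow_neg_one]
    have hlc : (c.length : ℂ) ≠ 0 := Complex.ofReal_ne_zero.2 hl.ne'
    simp [hl.le]
    field_simp
    ring

end UnitSpeedLoop

theorem IsMobiusImage.arcLength_one {K : LegendrianKnot} {c : UnitSpeedLoop}
    (h : IsMobiusImage K c 1 1) :
    K.arcLength = (volume.restrict (Set.Ico 0 c.length)).map c.toFun := by
  have hset : Set.Ico 0 c.length ∩ {t | (1 : Equiv.Perm (OnePoint Heis))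
      (c.toFun t : OnePoint Heis) ≠ OnePoint.infty} = Set.Ico 0 c.length :=
    Set.inter_eq_left.2 fun t _ => OnePoint.coe_ne_infty _
  have hone : (fun t => ENNReal.ofReal (hnorm (deriv (fun s => coord
      ((1 : Equiv.Perm (OnePoint Heis)) (c.toFun s : OnePoint Heis))) t))) = 1 := by
    funext t
    have : hnorm (deriv c.toFun t) = 1 := c.unit_speed t
    show ENNReal.ofReal (hnorm (deriv c.toFun t)) = 1
    rw [this, ENNReal.ofReal_one]
  rw [h.arcLength_eq, arcMeasure, hset, hone, withDensity_one]
  rfl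

/-! ### The potential and its integral -/

section Potential

variable {K : LegendrianKnot} {c : UnitSpeedLoop} {T : Equiv.Perm (OnePoint Heis)}
  {A : GL (Fin 3) ℂ}

theorem IsMobiusImage.potential_eq (h : IsMobiusImage K c T A) {s : ℝ} {p : Heis}
    (hp : T (c.toFun s) = (p : OnePoint Heis)) :
    K.potential p = ‖lam A.val (c.toFun s)‖ * c.potential s :=
  (h.tendsto_truncatedPotential hp).2.limUnder_eq

/-- The integral of the potential is that of the loop: the conformal factors of the potential and of
the arc length cancel. -/
theorem IsMobiusImage.integral_potential (h : IsMobiusImage K c T A) :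
    Integrable K.potential K.arcLength ∧
      ∫ p, K.potential p ∂K.arcLength = ∫ s in Set.Ico 0 c.length, c.potential s := by
  obtain ⟨h1, h2⟩ := h.integral_arcLength K.potential
  have hae : (fun s => ‖lam A.val (c.toFun s)‖⁻¹ * K.potential (coord (T (c.toFun s))))
      =ᵐ[volume.restrict (Set.Ico 0 c.length)] c.potential := by
    filter_upwards [h.ae_lam_ne_zero] with s hs
    have hp := h.induced.apply_eq hs
    rw [hp, coord_coe, h.potential_eq hp]
    exact inv_mul_cancel_left₀ (norm_ne_zero_iff.2 hs) _
  have hpi : IntegrableOn c.potential (Set.Ico 0 c.length) :=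
    (c.continuous_potential.integrableOn_Icc).mono_set Set.Ico_subset_Icc_self
  exact ⟨h1.2 (hpi.congr hae.symm), h2.trans (integral_congr_ae hae)⟩

end Potential

/-! ### The energy -/

namespace LegendrianKnot

variable {K : LegendrianKnot}

/-- The value of the beta function at `-2` is unique, by the identity theorem and continuity. The
other values of a beta function need not be, since those at poles are arbitrary. -/
theorem IsBetaFunction.apply_neg_two_eq {B B' : ℂ → ℂ} (h : K.IsBetaFunction B)
    (h' : K.IsBetaFunction B') : B (-2) = B' (-2) := by
  refine eq_of_eventuallyEq_punctured h.regular.continuousAt h'.regular.continuousAt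
    (eventuallyEq_of_eq_on_halfPlane (a := -3) (by norm_num) (fun ζ _ => h.meromorphic ζ)
      (fun ζ _ => h'.meromorphic ζ) (fun ζ hζ => ?_) (by norm_num))
  rw [h.eq_integral ζ hζ, h'.eq_integral ζ hζ]

/-- A finite knot has a beta function, with the value `∫ V(K;p) dp` at `-2`. -/
theorem IsFinite.exists_isBetaFunction (hK : K.IsFinite) : ∃ B, K.IsBetaFunction B ∧
    B (-2) = ((∫ p, K.potential p ∂K.arcLength : ℝ) : ℂ) := by
  obtain ⟨c, h⟩ := hK.exists_isMobiusImage_one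
  obtain ⟨B, hB, hBa, hBi, hB2⟩ := c.exists_meromorphic_continuation
  have hc := c.smooth.continuous.measurable
  have hprod : K.arcLength.prod K.arcLength = ((volume.restrict (Set.Ico 0 c.length)).prod
      (volume.restrict (Set.Ico 0 c.length))).map (Prod.map c.toFun c.toFun) := by
    rw [h.arcLength_one, Measure.map_prod_map _ _ hc hc]
  refine ⟨B, ⟨hB, hBa, fun ζ hζ => ?_, fun ζ hζ => ?_⟩, ?_⟩
  · rw [hprod, integrable_map_measure
      (UnitSpeedLoop.measurable_kdist_cpow ζ).aestronglyMeasurable (hc.prodMap hc).aemeasurable]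
    exact c.integrable_kdist_cpow hζ
  · rw [hprod, integral_map (hc.prodMap hc).aemeasurable
      (UnitSpeedLoop.measurable_kdist_cpow ζ).aestronglyMeasurable, hBi ζ hζ]
    rfl
  · rw [hB2, h.integral_potential.2]

theorem energy_eq (K : LegendrianKnot) : K.energy = ∫ p, K.potential p ∂K.arcLength := by
  rw [energy]
  split_ifs with hK
  · obtain ⟨B, hB, hB2⟩ := hK.exists_isBetaFunction
    have hbeta : K.IsBetaFunction K.beta := Classical.epsilon_spec ⟨B, hB⟩
    rw [hbeta.apply_neg_two_eq hB, hB2, Complex.ofReal_re]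
  · rfl

end LegendrianKnot

theorem IsMobiusImage.energy_eq {K : LegendrianKnot} {c : UnitSpeedLoop}
    {T : Equiv.Perm (OnePoint Heis)} {A : GL (Fin 3) ℂ} (h : IsMobiusImage K c T A) :
    K.energy = ∫ s in Set.Ico 0 c.length, c.potential s := by
  rw [K.energy_eq, h.integral_potential.2]

/-- The conformal factor of the inversion is `‖p‖²`. -/
theorem norm_lam_inversionMatrix (p : Heis) : ‖lam inversionMatrix p‖ = knorm p ^ 2 := by
  rw [lam, inversionMatrix_mulVec, ← norm_homog_two]
  rfl

/-- If `K = T(c)`, then `ι(K) = (ι ∘ T)(c)`, and the conformal factors of `T` and `ι` multiply. -/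
theorem LegendrianKnot.potential_inversion {K K' : LegendrianKnot}
    (hK : K'.carrier = inversion '' K.carrier) {p p' : Heis}
    (hp : (p : OnePoint Heis) ∈ K.carrier)
    (hpp : inversion (p : OnePoint Heis) = (p' : OnePoint Heis)) :
    K'.potential p' = knorm p ^ 2 * K.potential p := by
  obtain ⟨c, T, A, h⟩ := K.exists_isMobiusImage
  have hdet : inversionMatrix.det ≠ 0 := by
    simp [inversionMatrix, Matrix.det_fin_three]
  have h' : IsMobiusImage K' c (inversionPerm * T)
      (Matrix.GeneralLinearGroup.mkOfDetNeZero inversionMatrix hdet * A) :=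
    h.comp preservesForm_inversionMatrix inversionPerm_isInducedBy hK
  rw [h.carrier_eq] at hp
  obtain ⟨s, hs⟩ := hp
  have hs' : (inversionPerm * T) (c.toFun s) = (p' : OnePoint Heis) := by
    rw [Equiv.Perm.mul_apply]
    show inversion (T (c.toFun s)) = _
    rw [← hpp, ← hs]
  have hlam : lam (Matrix.GeneralLinearGroup.mkOfDetNeZero inversionMatrix hdet * A).val
      (c.toFun s) = lam A.val (c.toFun s) * lam inversionMatrix p := by
    have h1 := (h.induced.mulVec_eq hs).2
    show ((inversionMatrix * A.val).mulVec _) 0 = _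
    rw [← Matrix.mulVec_mulVec, h1, Matrix.mulVec_smul]
    rfl
  rw [h'.potential_eq hs', h.potential_eq hs, hlam, norm_mul, norm_lam_inversionMatrix]
  ring

end Heis

theorem mainTheorem1 :
    -- the beta function, the potential and the energy are well defined, and `E(K) = ∫ V(K;p) dp`
    (∀ K : Heis.LegendrianKnot,
      (K.IsFinite → (∃ B, K.IsBetaFunction B) ∧
        ∀ B, K.IsBetaFunction B → B (-2) = (K.energy : ℂ)) ∧
      (∀ p : Heis, (p : OnePoint Heis) ∈ K.carrier →
        (∀ ε : ℝ, 0 < ε →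
          IntegrableOn (fun q => (Heis.kdist p q ^ 2)⁻¹) {q | ε ≤ Heis.kdist p q} K.arcLength) ∧
        Tendsto (K.truncatedPotential p) (𝓝[>] (0 : ℝ)) (𝓝 (K.potential p))) ∧
      Integrable K.potential K.arcLength ∧
      K.energy = ∫ p, K.potential p ∂K.arcLength) ∧
    -- the pointwise behaviour of the potential under the inversion
    (∀ K K' : Heis.LegendrianKnot, K'.carrier = Heis.inversion '' K.carrier →
      ∀ p p' : Heis, (p : OnePoint Heis) ∈ K.carrier →
        Heis.inversion (p : OnePoint Heis) = (p' : OnePoint Heis) →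
        K'.potential p' = Heis.knorm p ^ 2 * K.potential p) ∧
    -- Möbius invariance of the energy
    (∀ T ∈ Heis.PU21, ∀ K : Heis.LegendrianKnot,
      (∃ K' : Heis.LegendrianKnot, K'.carrier = T '' K.carrier) ∧
      ∀ K' : Heis.LegendrianKnot, K'.carrier = T '' K.carrier → K'.energy = K.energy) := by
  refine ⟨fun K => ⟨fun hK => ?_, fun p hp => ?_, ?_, K.energy_eq⟩, ?_, fun T hT K => ⟨?_, ?_⟩⟩
  · obtain ⟨B, hB, hB2⟩ := hK.exists_isBetaFunction
    refine ⟨⟨B, hB⟩, fun B' hB' => ?_⟩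
    rw [hB'.apply_neg_two_eq hB, hB2, K.energy_eq]
  · obtain ⟨c, T, A, h⟩ := K.exists_isMobiusImage
    rw [h.carrier_eq] at hp
    obtain ⟨s, hs⟩ := hp
    obtain ⟨h1, h2⟩ := h.tendsto_truncatedPotential hs
    refine ⟨h1, ?_⟩
    rwa [h.potential_eq hs]
  · obtain ⟨c, T, A, h⟩ := K.exists_isMobiusImage
    exact h.integral_potential.1
  · exact fun K K' hK p p' hp hpp => Heis.LegendrianKnot.potential_inversion hK hp hpp
  · exact ⟨K.mobiusImage hT, K.carrier_mobiusImage hT⟩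
  · intro K' hK'
    obtain ⟨c, S, A, h⟩ := K.exists_isMobiusImage
    obtain ⟨B, hB, hTB⟩ := hT
    rw [h.energy_eq, (h.comp hB hTB hK').energy_eq]
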